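/- Let $\Omega$ be a finite set, $k\ge 0$, $X_k=\Omega^{\{0,\dots,k\}}$ and $X=\Omega^{\mathbb Z}$. *Definitions.* A probability measure $\mu_k$ on $X_k$ is *locally translation invariant* (LTI) if, whenever $A\subset\{0,\dots,k\}$ and a translate $A'\subset\{0,\dots,k\}$ of $A$ are given, the marginal of $\mu_k$ on $A'$ is the translate of its marginal on $A$. Write $\mu_k(\eta_k\mid\eta_0,\dots,\eta_{k-1})$ for the conditional probability of the last letter, set to $0$ when the condition has probability $0$. A *Markov extension* of $\mu_k$ is a probability measure $\mu$ on $X$ such that for all $a\in\mathbb Z$, $n\ge0$ and all configurations, $$\mu(\eta_a,\dots,\eta_{a+k+n})=\mu_k(\eta_a,\dots,\eta_{a+k})\prod_{i=1}^{n}\mu_k(\eta_{a+i+k}\mid\eta_{a+i},\dots,\eta_{a+i+k-1}).$$ An *interaction* is a family $(\Phi_A)$ of functions $X\to(-\infty,+\infty]$, indexed by the finite sets $A\subset\mathbb Z$, such that $\Phi_A(\eta)$ depends only on $\eta|_A$; it has *range at most $k$* if $\Phi_A=0$ whenever $\operatorname{diam}A>k$. For such a family put $H_\Lambda(\eta)=\sum_{A\cap\Lambda\neq\emptyset}\Phi_A(\eta)$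 for finite $\Lambda\subset\mathbb Z$. A probability measure $\nu$ on $X$ is a *Gibbs state* for $\Phi$ if for every finite $\Lambda\subset\mathbb Z$ and $\nu$-almost every $\eta$, $Z_\Lambda(\eta)=\sum_{\xi\in\Omega^\Lambda}e^{-H_\Lambda(\xi\,\eta_{\Lambda^c})}>0$, and for every $\xi\in\Omega^\Lambda$ the conditional $\nu$-probability of $\xi$ in $\Lambda$ given $\eta_{\Lambda^c}$ is $e^{-H_\Lambda(\xi\,\eta_{\Lambda^c})}/Z_\Lambda(\eta)$ (with $e^{-\infty}=0$). *Theorem.* (1) Let $\mu_k$ be an LTI probability measure on $X_k$. Then $\mu_k$ has exactly one Markov extension $\mu$; the marginal of $\mu$ on $X_k$ is $\mu_k$, $\mu$ is translation invariant, and $\mu$ is a Gibbs state for the translation-invariant interaction of range at most $k$ with formal energy $U(\eta)=\sum_{i\in\mathbb Z}\Phi(\eta_i,\dots,\eta_{i+k})$, where $$\Phi(\eta_0,\dots,\eta_k)=-\ln\mu_k(\eta_k\mid\eta_0,\dots,\eta_{k-1})\in(-\infty,+\infty],$$ that is, $\Phi_{\{i,\dots,i+k\}}(\eta)=\Phi(\eta_i,\dots,\eta_{i+k})$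 and $\Phi_A=0$ for all other $A$. (The value $+\infty$ is taken where the conditional probability is $0$.) (2) Conversely, let $\nu$ be a translation-invariant probability measure on $X$ that is a Gibbs state for some interaction of range at most $k$ (possibly taking the value $+\infty$). Then the marginal $\nu_k$ of $\nu$ on $X_k$ is LTI, and $\nu$ is the Markov extension of $\nu_k$. -/

import Mathlib

open MeasureTheory ProbabilityTheory
open scoped ENNReal

noncomputable section

namespace GibbsMarkov

variable {Ω : Type*}

/-- The translate of a configuration on `ℤ`. -/
def shift (t : ℤ) (η : ℤ → Ω) : ℤ → Ω := fun i => η (i + t)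

/-- The restriction of `η` to the sites `a, a + 1, …, a + k`, as a configuration on `{0, …, k}`. -/
def window (k : ℕ) (η : ℤ → Ω) (a : ℤ) : Fin (k + 1) → Ω := fun j => η (a + (j : ℕ))

/-! ### Interactions and Gibbs states on `ℤ` -/

/-- An interaction: for every finite `A ⊆ ℤ` an energy `Φ A` with values in `(-∞, +∞]`
that depends on the configuration in `A` only. The value `+∞` encodes a hard constraint. -/
structure IsInteraction (Φ : Finset ℤ → (ℤ → Ω) → EReal) : Prop where
  dependsOn : ∀ A : Finset ℤ, DependsOn (Φ A) (A : Set ℤ)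
  ne_bot : ∀ A η, Φ A η ≠ ⊥

/-- Range at most `k`: sets of diameter larger than `k` do not contribute. -/
def HasRangeAtMost (k : ℕ) (Φ : Finset ℤ → (ℤ → Ω) → EReal) : Prop :=
  ∀ A : Finset ℤ, (∃ i ∈ A, ∃ j ∈ A, (k : ℤ) < j - i) → ∀ η, Φ A η = 0

/-- A translation invariant interaction. -/
def IsTIInteraction (Φ : Finset ℤ → (ℤ → Ω) → EReal) : Prop :=
  ∀ (A : Finset ℤ) (t : ℤ) (η : ℤ → Ω),
    Φ (A.map (addRightEmbedding t)) η = Φ A (shift t η)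

/-- The energy of `η` in the finite volume `Λ` including the interaction with the outside:
the sum of `Φ A η` over all finite `A` that meet `Λ`. It is used for interactions of finite range,
where only finitely many terms are nonzero. -/
def energy (Φ : Finset ℤ → (ℤ → Ω) → EReal) (Λ : Finset ℤ) (η : ℤ → Ω) : EReal :=
  ∑ᶠ (A : Finset ℤ) (_ : (A ∩ Λ).Nonempty), Φ A η

/-- The Boltzmann weight `exp (-H)` of the configuration equal to `ξ` in `Λ` and to `η` outside,
with `exp (-∞) = 0`. -/
def boltzmann (Φ : Finset ℤ → (ℤ → Ω) → EReal) (Λ : Finset ℤ) (ξ : Λ → Ω) (η : ℤ → Ω) : ℝ≥0∞ :=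
  EReal.exp (-energy Φ Λ (Function.updateFinset η Λ ξ))

/-- The partition function in `Λ` with boundary condition `η`. -/
def partitionFunction [Fintype Ω] (Φ : Finset ℤ → (ℤ → Ω) → EReal) (Λ : Finset ℤ) (η : ℤ → Ω) :
    ℝ≥0∞ :=
  ∑ ξ : Λ → Ω, boltzmann Φ Λ ξ η

/-- Infinite volume Gibbs states (Dobrushin-Lanford-Ruelle): for every finite `Λ`, almost every
boundary condition is admissible, and the conditional probability of seeing `ξ` in `Λ`, given
the configuration outside `Λ`, is the finite volume Gibbs weight of `ξ`. -/
structure IsGibbsState [Fintype Ω] [MeasurableSpace Ω] (Φ : Finset ℤ → (ℤ → Ω) → EReal)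
    (μ : Measure (ℤ → Ω)) : Prop where
  isProbabilityMeasure : IsProbabilityMeasure μ
  admissible : ∀ Λ : Finset ℤ, ∀ᵐ η ∂μ, partitionFunction Φ Λ η ≠ 0
  condProb : ∀ (Λ : Finset ℤ) (ξ : Λ → Ω),
    μ⟦{η : ℤ → Ω | Λ.restrict η = ξ} | cylinderEvents (X := fun _ : ℤ => Ω) ((Λ : Set ℤ)ᶜ)⟧
      =ᵐ[μ] fun η => (boltzmann Φ Λ ξ η / partitionFunction Φ Λ η).toReal

/-! ### Local translation invariance and the Markov extension -/

variable [MeasurableSpace Ω]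

/-- A translation invariant measure on `ℤ → Ω`. -/
def IsTranslationInvariant (μ : Measure (ℤ → Ω)) : Prop :=
  ∀ t : ℤ, μ.map (shift t) = μ

/-- The marginal on the sites `0, …, k`. -/
def marginal (k : ℕ) (μ : Measure (ℤ → Ω)) : Measure (Fin (k + 1) → Ω) :=
  μ.map (fun η => window k η 0)

/-- Local translation invariance of a measure on configurations on `{0, …, k}`: whenever `A` and
its translate `{s i | i ∈ A}` by `t` are both contained in `{0, …, k}`, the marginals on the two
sets are translates of each other. -/
def IsLTI {k : ℕ} (m : Measure (Fin (k + 1) → Ω)) : Prop :=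
  ∀ (A : Finset (Fin (k + 1))) (t : ℕ) (s : A → Fin (k + 1)),
    (∀ i : A, (s i : ℕ) = (i : Fin (k + 1)) + t) →
      m.map (fun η (i : A) => η (s i)) = m.map (fun η (i : A) => η i)

/-- The conditional probability `m (ζ k ∣ ζ 0, …, ζ (k - 1))`. It is `0` if the condition has
probability `0`, since `0 / 0 = 0` in `ℝ≥0∞`. -/
def condLast {k : ℕ} (m : Measure (Fin (k + 1) → Ω)) (ζ : Fin (k + 1) → Ω) : ℝ≥0∞ :=
  m {ζ} / m {η | Fin.init η = Fin.init ζ}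

/-- `μ` is the Markov extension of `m` to `ℤ`: the probability that `μ` gives to a configuration
on an interval `{a, …, a + k + n}` is the probability under `m` of its first `k + 1` letters times
the product of the transition probabilities to the `n` remaining letters. -/
structure IsMarkovExtension {k : ℕ} (m : Measure (Fin (k + 1) → Ω)) (μ : Measure (ℤ → Ω)) :
    Prop where
  isProbabilityMeasure : IsProbabilityMeasure μ
  apply_cylinder : ∀ (a : ℤ) (n : ℕ) (η : ℤ → Ω),
    μ {ξ | ∀ i ∈ Finset.Icc a (a + k + n), ξ i = η i} =
      m {window k η a} * ∏ i ∈ Finset.range n, condLast m (window k η (a + i + 1))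

/-- The potential `φ (η 0, …, η k) = -log m (η k ∣ η 0, …, η (k - 1))`, equal to `+∞` where the
conditional probability vanishes. -/
def markovPotential {k : ℕ} (m : Measure (Fin (k + 1) → Ω)) (ζ : Fin (k + 1) → Ω) : EReal :=
  -ENNReal.log (condLast m ζ)

open Classical in
/-- The interaction with formal total energy `∑ i, φ (η i, …, η (i + k))`: only the intervals
`{i, …, i + k}` contribute. -/
def windowInteraction {k : ℕ} (φ : (Fin (k + 1) → Ω) → EReal) (A : Finset ℤ) (η : ℤ → Ω) : EReal :=
  if h : ∃ i : ℤ, A = Finset.Icc i (i + k) then φ (window k η h.choose) else 0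

end GibbsMarkov

end

set_option linter.unusedSectionVars false

noncomputable section

namespace GibbsMarkov

/-! ### Entropy of finite-valued maps -/

section Entropy

variable {X : Type*} [MeasurableSpace X]

/-! Part (1). LTI enters through one consequence: under `m` the first `k` letters and the last `k`
letters have the same law (`IsLTI.measure_tail`), so this law on `k`-words is stationary for the
transitions `condLast m`. Chain weights are then consistent both when a letter is appended on the
right and when the first letter is summed out (`IsLTI.sum_chainWeight`). This gives measures with
the right probabilities on longer and longer intervals, and compactness gives a limit on `ℤ`.
Cylinders determine a measure, whence uniqueness and translation invariance. A cylinder probability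
is a product over windows: the windows meeting `Λ` give `exp (-H_Λ)`, the other factors do not see
`Λ`, and such a factorization yields the DLR equations (`gibbs_of_product`).

Part (2). The interaction need not be translation invariant and may be infinite, so the argument
compares entropies. Read a configuration as a path in the graph whose vertices are `k`-words and
whose edges are windows of length `k + 1`. The Gibbs property says that, given the endpoints, path
probabilities are proportional to products of one-edge weights (`IsPathGibbs`). Let `μ` be the
Markov process with the same edge distribution as `ν`, and let `h n` be minus the entropy under `ν`
of a path of length `n`, with `h 0` that of a vertex.

By strong subadditivity and stationarity `h` is convex, and equality in all these inequalities means
that `ν` is Markov. For `μ` the corresponding sequence is the tangent `h 0 + n (h 1 - h 0)`. The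
essential estimate (`exists_log_bound`) is that for lengths `n` in an arithmetic progression the
log-probability of a path under `ν` is, up to an error independent of `n`, a sum of one-edge
functions plus a function of the last vertex. Such sums have the same mean under `μ` and `ν`, so
Gibbs' inequality bounds `h n` by the tangent plus a constant (`negEntropy_le`). A convex sequence
with this property is affine (`affine_of_convex_of_le`), so `ν` is Markov and equals `μ`.

The estimate must compare paths with different starting vertices, although the Gibbs property fixes
both endpoints. Poincaré recurrence supplies this: every path of charged edges is charged, and
reachability in a suitable number `N` of steps is symmetric and transitive, so a bounded prefix can
move the starting vertex. -/

lemma integrable_comp_of_finite {F : Type*} [Finite F] [MeasurableSpace F]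
    [DiscreteMeasurableSpace F] (μ : Measure X) [IsFiniteMeasure μ] {f : X → F}
    (hf : Measurable f) (φ : F → ℝ) : Integrable (fun x => φ (f x)) μ := by
  have : IsFiniteMeasure (μ.map f) := Measure.isFiniteMeasure_map μ f
  exact (Integrable.of_finite (f := φ) (μ := μ.map f)).comp_measurable hf

lemma integral_comp_of_finite {F : Type*} [Fintype F] [MeasurableSpace F]
    [DiscreteMeasurableSpace F] (μ : Measure X) [IsFiniteMeasure μ] {f : X → F}
    (hf : Measurable f) (φ : F → ℝ) :
    ∫ x, φ (f x) ∂μ = ∑ y, μ.real (f ⁻¹' {y}) * φ y := by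
  have : IsFiniteMeasure (μ.map f) := Measure.isFiniteMeasure_map μ f
  rw [← integral_map (f := φ) hf.aemeasurable (measurable_of_finite φ).aestronglyMeasurable,
    integral_fintype (Integrable.of_finite)]
  refine Finset.sum_congr rfl fun y _ => ?_
  rw [map_measureReal_apply hf (measurableSet_singleton y), smul_eq_mul]

lemma measureReal_eq_sum_fiber {F : Type*} [Fintype F] [MeasurableSpace F]
    [DiscreteMeasurableSpace F] (μ : Measure X) [IsFiniteMeasure μ] {f : X → F}
    (hf : Measurable f) (D : Set X) :
    μ.real D = ∑ y, μ.real (D ∩ f ⁻¹' {y}) := by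
  have h := sum_measureReal_preimage_singleton (μ := μ.restrict D) Finset.univ (f := f)
    (fun y _ => hf (measurableSet_singleton y))
  simp only [Finset.coe_univ, Set.preimage_univ] at h
  rw [measureReal_restrict_apply MeasurableSet.univ, Set.univ_inter] at h
  rw [← h]
  refine Finset.sum_congr rfl fun y _ => ?_
  rw [measureReal_restrict_apply (hf (measurableSet_singleton y)), Set.inter_comm]

/-- The mean logarithm of the probability of the fibre of `f`, that is, minus the Shannon entropy
of `f`. -/
def negEntropy {F : Type*} (μ : Measure X) (f : X → F) : ℝ :=
  ∫ x, Real.log (μ.real (f ⁻¹' {f x})) ∂μ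

/-- Entropy sees only the partition into fibres, so different encodings of the same block of letters
are interchangeable. -/
lemma negEntropy_congr {F F' : Type*} (μ : Measure X) {f : X → F} {f' : X → F'}
    (h : ∀ x y, f x = f y ↔ f' x = f' y) : negEntropy μ f = negEntropy μ f' := by
  unfold negEntropy
  congr 1
  ext x
  congr 2
  ext y
  simp [h]

lemma negEntropy_comp (μ : Measure X) {T : X → X} (hT : MeasurePreserving T μ μ)
    {F : Type*} [Finite F] [MeasurableSpace F] [DiscreteMeasurableSpace F] {f : X → F}
    (hf : Measurable f) : negEntropy μ (fun x => f (T x)) = negEntropy μ f := by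
  have h1 : ∀ y, μ.real ((fun x => f (T x)) ⁻¹' {y}) = μ.real (f ⁻¹' {y}) := fun y =>
    hT.measureReal_preimage (hf (measurableSet_singleton y)).nullMeasurableSet
  unfold negEntropy
  simp only [h1]
  have : (fun x => Real.log (μ.real (f ⁻¹' {f (T x)})))
    = fun x => (fun z => Real.log (μ.real (f ⁻¹' {f z}))) (T x) := rfl
  have hm := (measurable_of_finite (fun y => Real.log (μ.real (f ⁻¹' {y})))).comp hf
  rw [this]
  conv_rhs => rw [← hT.map_eq]
  rw [integral_map hT.measurable.aemeasurable, hT.map_eq]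
  rw [hT.map_eq]
  exact hm.aestronglyMeasurable

lemma one_sub_inv_le_log' {x : ℝ} (hx : 0 < x) : 1 - x⁻¹ ≤ Real.log x := by
  have := Real.log_le_sub_one_of_pos (inv_pos.2 hx)
  rw [Real.log_inv] at this
  linarith

lemma eq_one_of_log_eq {x : ℝ} (hx : 0 < x) (h : Real.log x = 1 - x⁻¹) : x = 1 := by
  by_contra hne
  have := Real.log_lt_sub_one_of_pos (inv_pos.2 hx) (by simpa using hne)
  rw [Real.log_inv] at this
  linarith

/-- These inclusions of fibres control the degenerate cases: a vanishing marginal forces the finer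
probabilities to vanish. -/
lemma ssa_bounds (μ : Measure X) [IsFiniteMeasure μ] {A B C : Type*} (f : X → A) (g : X → B) (h : X → C)
    (p : A × B × C) :
    μ.real ((fun x => (f x, g x, h x)) ⁻¹' {p}) ≤
      μ.real ((fun x => (f x, g x)) ⁻¹' {(p.1, p.2.1)}) ∧
    μ.real ((fun x => (f x, g x, h x)) ⁻¹' {p}) ≤ μ.real ((fun x => (g x, h x)) ⁻¹' {p.2}) ∧
    μ.real ((fun x => (f x, g x)) ⁻¹' {(p.1, p.2.1)}) ≤ μ.real (g ⁻¹' {p.2.1}) := by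
  refine ⟨?_, ?_, ?_⟩
  · refine measureReal_mono fun x hx => ?_
    simp only [Set.mem_preimage, Set.mem_singleton_iff, Prod.ext_iff] at hx ⊢
    tauto
  · refine measureReal_mono fun x hx => ?_
    simp only [Set.mem_preimage, Set.mem_singleton_iff, Prod.ext_iff] at hx ⊢
    tauto
  · refine measureReal_mono fun x hx => ?_
    simp only [Set.mem_preimage, Set.mem_singleton_iff, Prod.ext_iff] at hx ⊢
    tauto

/-! ### Strong subadditivity and its equality case -/

section SSA

variable {A B C : Type*} [Fintype A] [Fintype B] [Fintype C] [MeasurableSpace A]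
  [MeasurableSpace B] [MeasurableSpace C] [DiscreteMeasurableSpace A] [DiscreteMeasurableSpace B]
  [DiscreteMeasurableSpace C]

/-- Apply `log x ≥ 1 - 1/x` to `x = m * mb / (mab * mbc)`. The bounds make all four numbers positive
as soon as `m` is; for `m = 0` only a sign remains. -/
lemma ssa_pointwise {m mb mab mbc : ℝ} (hm : 0 ≤ m) (h1 : m ≤ mab) (h2 : m ≤ mbc) (h3 : mab ≤ mb) :
    m - mab * mbc / mb ≤ m * (Real.log m + Real.log mb - Real.log mab - Real.log mbc) := by
  rcases hm.eq_or_lt with rfl | hm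
  · simp only [zero_sub, zero_mul, Left.neg_nonpos_iff]
    exact div_nonneg (mul_nonneg h1 h2) (h1.trans h3)
  have hab := hm.trans_le h1
  have hbc := hm.trans_le h2
  have hb := hab.trans_le h3
  have := one_sub_inv_le_log' (x := m * mb / (mab * mbc)) (by positivity)
  rw [Real.log_div (by positivity) (by positivity), Real.log_mul hm.ne' hb.ne',
    Real.log_mul hab.ne' hbc.ne'] at this
  calc m - mab * mbc / mb = m * (1 - (m * mb / (mab * mbc))⁻¹) := by field_simp
    _ ≤ _ := by
      apply mul_le_mul_of_nonneg_left _ hm.le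
      linarith

/-- The inequality `log x ≥ 1 - 1/x` is strict except at `x = 1`. For `m = 0` the hypothesis says
that the quotient vanishes, and `mb = 0` forces `mab = 0`. -/
lemma ssa_pointwise_eq {m mb mab mbc : ℝ} (hm : 0 ≤ m) (h1 : m ≤ mab) (h2 : m ≤ mbc)
    (h3 : mab ≤ mb)
    (h : m - mab * mbc / mb = m * (Real.log m + Real.log mb - Real.log mab - Real.log mbc)) :
    m * mb = mab * mbc := by
  rcases hm.eq_or_lt with rfl | hm
  · simp only [zero_sub, zero_mul, neg_eq_zero, div_eq_zero_iff] at h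
    rcases h with h | h
    · simp [h]
    · have : mab = 0 := le_antisymm (h ▸ h3) h1
      simp [this]
  have hab := hm.trans_le h1
  have hbc := hm.trans_le h2
  have hb := hab.trans_le h3
  have key := eq_one_of_log_eq (x := m * mb / (mab * mbc)) (by positivity) (by
    rw [Real.log_div (by positivity) (by positivity), Real.log_mul hm.ne' hb.ne',
      Real.log_mul hab.ne' hbc.ne']
    apply mul_left_cancel₀ hm.ne'
    calc _ = m * (Real.log m + Real.log mb - Real.log mab - Real.log mbc) := by ring
      _ = m - mab * mbc / mb := h.symm
      _ = _ := by field_simp)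
  rwa [div_eq_one_iff_eq (by positivity)] at key

/-- The joint law and its conditionally independent version `p(a,b) p(b,c) / p(b)` both have total
mass one. Hence the pointwise lower bounds add up to zero. -/
lemma sum_ssa (μ : Measure X) [IsProbabilityMeasure μ] {f : X → A} {g : X → B} {h : X → C}
    (hf : Measurable f) (hg : Measurable g) (hh : Measurable h) :
    ∑ p : A × B × C, (μ.real ((fun x => (f x, g x, h x)) ⁻¹' {p}) -
      μ.real ((fun x => (f x, g x)) ⁻¹' {(p.1, p.2.1)}) *
      μ.real ((fun x => (g x, h x)) ⁻¹' {p.2}) / μ.real (g ⁻¹' {p.2.1})) = 0 := by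
  have e1 : ∀ b, ∑ a, μ.real ((fun x => (f x, g x)) ⁻¹' {(a, b)}) = μ.real (g ⁻¹' {b}) := by
    intro b
    rw [measureReal_eq_sum_fiber μ hf (g ⁻¹' {b})]
    refine Finset.sum_congr rfl fun a _ => ?_
    congr 1; ext x; simp [and_comm]
  have e2 : ∀ b, ∑ c, μ.real ((fun x => (g x, h x)) ⁻¹' {(b, c)}) = μ.real (g ⁻¹' {b}) := by
    intro b
    rw [measureReal_eq_sum_fiber μ hh (g ⁻¹' {b})]
    refine Finset.sum_congr rfl fun a _ => ?_
    congr 1; ext x; simp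
  rw [Finset.sum_sub_distrib, sub_eq_zero]
  rw [show ∑ p : A × B × C, μ.real ((fun x => (f x, g x, h x)) ⁻¹' {p}) = 1 by
    have := measureReal_eq_sum_fiber μ (hf.prodMk (hg.prodMk hh)) Set.univ
    simpa using this.symm]
  rw [Fintype.sum_prod_type, Finset.sum_comm]
  rw [Fintype.sum_prod_type]
  symm
  calc _ = ∑ b, μ.real (g ⁻¹' {b}) := ?_
    _ = 1 := by
      have := measureReal_eq_sum_fiber μ hg Set.univ
      simpa using this.symm
  refine Finset.sum_congr rfl fun b _ => ?_
  simp only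
  have : ∀ c, ∑ a, μ.real ((fun x => (f x, g x)) ⁻¹' {(a, b)}) *
      μ.real ((fun x => (g x, h x)) ⁻¹' {(b, c)}) / μ.real (g ⁻¹' {b}) =
      μ.real (g ⁻¹' {b}) * μ.real ((fun x => (g x, h x)) ⁻¹' {(b, c)}) / μ.real (g ⁻¹' {b}) := by
    intro c
    rw [← Finset.sum_div, ← Finset.sum_mul, e1]
  simp only [this]
  rw [← Finset.sum_div, ← Finset.mul_sum, e2]
  -- Values `b` of probability zero are covered by `0 * 0 / 0 = 0`.
  exact mul_self_div_self _

lemma negEntropy_ssa_eq (μ : Measure X) [IsProbabilityMeasure μ] {f : X → A} {g : X → B}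
    {h : X → C} (hf : Measurable f) (hg : Measurable g) (hh : Measurable h) :
    negEntropy μ (fun x => (f x, g x, h x)) + negEntropy μ g
      - negEntropy μ (fun x => (f x, g x)) - negEntropy μ (fun x => (g x, h x))
    = ∑ p : A × B × C, μ.real ((fun x => (f x, g x, h x)) ⁻¹' {p}) *
      (Real.log (μ.real ((fun x => (f x, g x, h x)) ⁻¹' {p})) + Real.log (μ.real (g ⁻¹' {p.2.1}))
      - Real.log (μ.real ((fun x => (f x, g x)) ⁻¹' {(p.1, p.2.1)}))
      - Real.log (μ.real ((fun x => (g x, h x)) ⁻¹' {p.2}))) := by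
  have hm := hf.prodMk (hg.prodMk hh)
  rw [← integral_comp_of_finite μ hm (fun p =>
    Real.log (μ.real ((fun x => (f x, g x, h x)) ⁻¹' {p})) + Real.log (μ.real (g ⁻¹' {p.2.1}))
      - Real.log (μ.real ((fun x => (f x, g x)) ⁻¹' {(p.1, p.2.1)}))
      - Real.log (μ.real ((fun x => (g x, h x)) ⁻¹' {p.2})))]
  unfold negEntropy
  rw [integral_sub, integral_sub, integral_add]
  · exact integrable_comp_of_finite μ hm
      (fun p => Real.log (μ.real ((fun x => (f x, g x, h x)) ⁻¹' {p})))
  · exact integrable_comp_of_finite μ hm (fun p => Real.log (μ.real (g ⁻¹' {p.2.1})))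
  · exact integrable_comp_of_finite μ hm
      (fun p => Real.log (μ.real ((fun x => (f x, g x, h x)) ⁻¹' {p})) +
        Real.log (μ.real (g ⁻¹' {p.2.1})))
  · exact integrable_comp_of_finite μ hm
      (fun p => Real.log (μ.real ((fun x => (f x, g x)) ⁻¹' {(p.1, p.2.1)})))
  · exact integrable_comp_of_finite μ hm
      (fun p => Real.log (μ.real ((fun x => (f x, g x, h x)) ⁻¹' {p})) +
        Real.log (μ.real (g ⁻¹' {p.2.1}))
        - Real.log (μ.real ((fun x => (f x, g x)) ⁻¹' {(p.1, p.2.1)})))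
  · exact integrable_comp_of_finite μ hm
      (fun p => Real.log (μ.real ((fun x => (g x, h x)) ⁻¹' {p.2})))

/-- Strong subadditivity of the entropy. -/
lemma negEntropy_ssa (μ : Measure X) [IsProbabilityMeasure μ] {f : X → A} {g : X → B}
    {h : X → C} (hf : Measurable f) (hg : Measurable g) (hh : Measurable h) :
    negEntropy μ (fun x => (f x, g x)) + negEntropy μ (fun x => (g x, h x)) ≤
      negEntropy μ (fun x => (f x, g x, h x)) + negEntropy μ g := by
  have h1 := negEntropy_ssa_eq μ hf hg hh
  have h2 := sum_ssa μ hf hg hh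
  have h3 := Finset.sum_le_sum (s := Finset.univ) fun (p : A × B × C) _ =>
    ssa_pointwise (measureReal_nonneg (μ := μ) (s := (fun x => (f x, g x, h x)) ⁻¹' {p}))
      (ssa_bounds μ f g h p).1 (ssa_bounds μ f g h p).2.1 (ssa_bounds μ f g h p).2.2
  rw [h2, ← h1] at h3
  linarith

/-- Equality in the strong subadditivity of the entropy means conditional independence. -/
lemma measureReal_mul_eq_of_negEntropy_eq (μ : Measure X) [IsProbabilityMeasure μ] {f : X → A}
    {g : X → B} {h : X → C} (hf : Measurable f) (hg : Measurable g) (hh : Measurable h)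
    (heq : negEntropy μ (fun x => (f x, g x)) + negEntropy μ (fun x => (g x, h x)) =
      negEntropy μ (fun x => (f x, g x, h x)) + negEntropy μ g) (p : A × B × C) :
    μ.real ((fun x => (f x, g x, h x)) ⁻¹' {p}) * μ.real (g ⁻¹' {p.2.1}) =
      μ.real ((fun x => (f x, g x)) ⁻¹' {(p.1, p.2.1)}) *
        μ.real ((fun x => (g x, h x)) ⁻¹' {p.2}) := by
  have h1 := negEntropy_ssa_eq μ hf hg hh
  have h2 := sum_ssa μ hf hg hh
  have hle := fun (p : A × B × C) (_ : p ∈ Finset.univ) =>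
    ssa_pointwise (measureReal_nonneg (μ := μ) (s := (fun x => (f x, g x, h x)) ⁻¹' {p}))
      (ssa_bounds μ f g h p).1 (ssa_bounds μ f g h p).2.1 (ssa_bounds μ f g h p).2.2
  -- The lower bounds sum to zero, and by `heq` so do the terms; therefore each term equals its
  -- bound.
  have h4 := (Finset.sum_eq_sum_iff_of_le hle).1 (by rw [h2, ← h1]; linarith) p (Finset.mem_univ _)
  exact ssa_pointwise_eq measureReal_nonneg
    (ssa_bounds μ f g h p).1 (ssa_bounds μ f g h p).2.1 (ssa_bounds μ f g h p).2.2 h4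

end SSA

/-- Gibbs' inequality. -/
lemma integral_log_le_negEntropy {F : Type*} [Fintype F] [MeasurableSpace F]
    [DiscreteMeasurableSpace F] (μ μ' : Measure X) [IsProbabilityMeasure μ]
    [IsProbabilityMeasure μ'] {f : X → F} (hf : Measurable f)
    (hpos : ∀ y, μ'.real (f ⁻¹' {y}) ≠ 0 → μ.real (f ⁻¹' {y}) ≠ 0) :
    ∫ x, Real.log (μ.real (f ⁻¹' {f x})) ∂μ' ≤ negEntropy μ' f := by
  unfold negEntropy
  rw [integral_comp_of_finite μ' hf (fun y => Real.log (μ.real (f ⁻¹' {y}))),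
    integral_comp_of_finite μ' hf (fun y => Real.log (μ'.real (f ⁻¹' {y})))]
  have h1 : ∑ y, μ.real (f ⁻¹' {y}) = 1 := by
    simpa using (measureReal_eq_sum_fiber μ hf Set.univ).symm
  have h2 : ∑ y, μ'.real (f ⁻¹' {y}) = 1 := by
    simpa using (measureReal_eq_sum_fiber μ' hf Set.univ).symm
  have h3 : ∑ y, (μ'.real (f ⁻¹' {y}) * Real.log (μ.real (f ⁻¹' {y})) + μ'.real (f ⁻¹' {y})) ≤
      ∑ y, (μ'.real (f ⁻¹' {y}) * Real.log (μ'.real (f ⁻¹' {y})) + μ.real (f ⁻¹' {y})) := by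
    refine Finset.sum_le_sum fun y _ => ?_
    set a := μ.real (f ⁻¹' {y}) with ha
    set b := μ'.real (f ⁻¹' {y}) with hb
    have ha0 : 0 ≤ a := measureReal_nonneg
    have hb0 : 0 ≤ b := measureReal_nonneg
    by_cases hb' : b = 0
    · simp [hb', ha0]
    -- Absolute continuity is used here: with `Real.log 0 = 0` the inequality would fail without it.
    have hapos : 0 < a := ha0.lt_of_ne' (hpos y hb')
    have hbpos : 0 < b := hb0.lt_of_ne' hb'
    have := Real.log_le_sub_one_of_pos (div_pos hapos hbpos)
    rw [Real.log_div hapos.ne' hbpos.ne'] at this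
    have h4 := mul_le_mul_of_nonneg_left this hb0
    have h5 : b * (a / b - 1) = a - b := by field_simp
    rw [h5] at h4
    linarith
  rw [Finset.sum_add_distrib, Finset.sum_add_distrib, h1, h2] at h3
  linarith

end Entropy

/-! ### Stationary processes on the edges of a finite graph -/

section Paths

variable {X E S : Type*}

/-- The sequence of letters read along the orbit of `x`. -/
def orbitWord (T : X → X) (e : X → E) (x : X) (i : ℕ) : E := e (T^[i] x)

/-- The event that the first `n` letters are those of `w`. -/
def wordEvent (T : X → X) (e : X → E) (n : ℕ) (w : ℕ → E) : Set X :=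
  {x | ∀ i < n, orbitWord T e x i = w i}

/-- `w 0, …, w (n - 1)` is a path in the graph with edges `E`, vertices `S`, sources `src` and
targets `tgt`. -/
def IsPath (src tgt : E → S) (n : ℕ) (w : ℕ → E) : Prop :=
  ∀ i, i + 1 < n → tgt (w i) = src (w (i + 1))

/-- The concatenation of the first `n` letters of `w` with `w'`. -/
def glue (n : ℕ) (w w' : ℕ → E) (i : ℕ) : E := if i < n then w i else w' (i - n)

lemma glue_of_lt {n i : ℕ} (h : i < n) (w w' : ℕ → E) : glue n w w' i = w i := if_pos h

lemma glue_add (n i : ℕ) (w w' : ℕ → E) : glue n w w' (n + i) = w' i := by simp [glue]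

/-- `w 0, …, w (n - 1)` is a path from `s` to `t` all of whose edges have the property `good`. -/
structure Connects (src tgt : E → S) (good : E → Prop) (n : ℕ) (s t : S) (w : ℕ → E) : Prop where
  pos : 0 < n
  path : IsPath src tgt n w
  start : src (w 0) = s
  finish : tgt (w (n - 1)) = t
  good : ∀ i < n, good (w i)

variable {src tgt : E → S} {good : E → Prop}

lemma Connects.glue {n n' : ℕ} {s t u : S} {w w' : ℕ → E}
    (h : Connects src tgt good n s t w) (h' : Connects src tgt good n' t u w') :
    Connects src tgt good (n + n') s u (glue n w w') where
  pos := by have := h.pos; omega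
  path i hi := by
    rcases lt_trichotomy (i + 1) n with h1 | h1 | h1
    · rw [glue_of_lt (by omega), glue_of_lt h1, h.path i h1]
    · rw [glue_of_lt (by omega), show i + 1 = n + 0 by omega, glue_add, h'.start, ← h.finish]
      congr 2; omega
    · obtain ⟨q, rfl⟩ : ∃ q, i = n + q := ⟨i - n, by omega⟩
      rw [glue_add, add_assoc, glue_add]
      exact h'.path q (by omega)
  start := by rw [glue_of_lt h.pos, h.start]
  finish := by
    have := h'.pos
    rw [show n + n' - 1 = n + (n' - 1) by omega, glue_add, h'.finish]
  good i hi := by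
    by_cases h1 : i < n
    · rw [glue_of_lt h1]; exact h.good i h1
    · obtain ⟨q, rfl⟩ : ∃ q, i = n + q := ⟨i - n, by omega⟩
      rw [glue_add]; exact h'.good q (by omega)

lemma Connects.left {n n' : ℕ} {s u : S} {w : ℕ → E}
    (h : Connects src tgt good (n + n') s u w) (hn : 0 < n) :
    Connects src tgt good n s (tgt (w (n - 1))) w where
  pos := hn
  path i hi := h.path i (by omega)
  start := h.start
  finish := rfl
  good i hi := h.good i (by omega)

lemma Connects.right {n n' : ℕ} {s u : S} {w : ℕ → E}
    (h : Connects src tgt good (n + n') s u w) (hn : 0 < n) (hn' : 0 < n') :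
    Connects src tgt good n' (tgt (w (n - 1))) u (fun i => w (n + i)) where
  pos := hn'
  path i hi := h.path (n + i) (by omega)
  start := by rw [h.path (n - 1) (by omega)]; congr 2; omega
  finish := by rw [← h.finish]; congr 2; omega
  good i hi := h.good _ (by omega)

/-- There is a good path of length `n` from `s` to `t`. -/
def Reach (src tgt : E → S) (good : E → Prop) (n : ℕ) (s t : S) : Prop :=
  ∃ w, Connects src tgt good n s t w

lemma reach_add {n n' : ℕ} (hn : 0 < n) (hn' : 0 < n') {s u : S} :
    Reach src tgt good (n + n') s u ↔
      ∃ t, Reach src tgt good n s t ∧ Reach src tgt good n' t u :=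
  ⟨fun ⟨_, h⟩ => ⟨_, ⟨_, h.left hn⟩, ⟨_, h.right hn hn'⟩⟩,
    fun ⟨_, ⟨_, h⟩, ⟨_, h'⟩⟩ => ⟨_, h.glue h'⟩⟩

lemma Connects.exists_loop {m : ℕ} {s : S} {w : ℕ → E} (h : Connects src tgt good m s s w)
    {j : ℕ} (hj : 0 < j) : ∃ w', Connects src tgt good (m * j) s s w' ∧ w' 0 = w 0 := by
  induction j, hj using Nat.le_induction with
  | base => exact ⟨w, by simpa using h, rfl⟩
  | succ j hj ih =>
    obtain ⟨w', h', h0⟩ := ih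
    refine ⟨GibbsMarkov.glue m w w', ?_, ?_⟩
    · rw [show m * (j + 1) = m + m * j by ring]
      exact h.glue h'
    · rw [glue_of_lt h.pos]

/-- There are finitely many relations on `S`, and by `reach_add` a coincidence between two lengths
propagates to all later ones. So reachability is eventually periodic in the length. At the resulting
`N` it is in particular transitive. -/
lemma exists_reach_periodic [Finite S] (src tgt : E → S) (good : E → Prop) :
    ∃ N, 0 < N ∧ ∀ j, 0 < j → Reach src tgt good (N * j) = Reach src tgt good N := by
  obtain ⟨a, b, hne, hab⟩ := Finite.exists_ne_map_eq_of_infinite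
    (fun n : ℕ => Reach src tgt good (n + 1))
  obtain ⟨i, p, hi, hp, hip⟩ : ∃ i p, 0 < i ∧ 0 < p ∧
      Reach src tgt good (i + p) = Reach src tgt good i := by
    rcases lt_or_gt_of_ne hne with h | h
    · exact ⟨a + 1, b - a, by omega, by omega, by
        rw [show a + 1 + (b - a) = b + 1 by omega]; exact hab.symm⟩
    · exact ⟨b + 1, a - b, by omega, by omega, by
        rw [show b + 1 + (a - b) = a + 1 by omega]; exact hab⟩
  have h1 : ∀ n, i ≤ n → Reach src tgt good (n + p) = Reach src tgt good n := by
    intro n hn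
    rcases hn.eq_or_lt with rfl | hn
    · exact hip
    obtain ⟨m, rfl⟩ : ∃ m, n = i + m := ⟨n - i, by omega⟩
    ext s u
    rw [show i + m + p = (i + p) + m by ring, reach_add (by omega) (by omega), hip,
      ← reach_add hi (by omega)]
  have h2 : ∀ c n, i ≤ n → Reach src tgt good (n + p * c) = Reach src tgt good n := by
    intro c
    induction c with
    | zero => simp
    | succ c ih =>
      intro n hn
      rw [show n + p * (c + 1) = (n + p * c) + p by ring, h1 _ (by omega), ih n hn]
  -- The length `p * i` is a multiple of the period `p` and is at least `i`, hence past the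
  -- preperiod.
  refine ⟨p * i, Nat.mul_pos hp hi, fun j hj => ?_⟩
  obtain ⟨j, rfl⟩ : ∃ j', j = j' + 1 := ⟨j - 1, by omega⟩
  rw [show p * i * (j + 1) = p * i + p * (i * j) by ring]
  exact h2 _ _ (Nat.le_mul_of_pos_left i hp)

end Paths

/-! ### Recurrence: charged paths and symmetry of reachability -/

section PathProcess

variable {X E S : Type*} [MeasurableSpace X] [MeasurableSpace E]

/-- A stationary process of edges of a finite graph whose finite-dimensional distributions have,
given the endpoints, relative weights that are products of one-edge weights `f i`. -/
structure IsPathGibbs (ν : Measure X) (T : X → X) (e : X → E) (src tgt : E → S)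
    (f : ℕ → E → ℝ) : Prop where
  mp : MeasurePreserving T ν ν
  meas : Measurable e
  tgt_eq : ∀ x, tgt (e x) = src (e (T x))
  weight_pos : ∀ i y, ν.real (e ⁻¹' {y}) ≠ 0 → 0 < f i y
  swap : ∀ n w w', 0 < n → IsPath src tgt n w → IsPath src tgt n w' →
    src (w 0) = src (w' 0) → tgt (w (n - 1)) = tgt (w' (n - 1)) →
    ν.real (wordEvent T e n w) * ∏ i ∈ Finset.range n, f i (w' i) =
      ν.real (wordEvent T e n w') * ∏ i ∈ Finset.range n, f i (w i)

variable {ν : Measure X} {T : X → X} {e : X → E} {src tgt : E → S} {f : ℕ → E → ℝ}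

lemma isPath_orbitWord (htgt : ∀ x, tgt (e x) = src (e (T x))) (n : ℕ) (x : X) :
    IsPath src tgt n (orbitWord T e x) := fun i _ => by
  unfold orbitWord
  rw [htgt, ← Function.iterate_succ_apply' T]

lemma orbitWord_iterate (x : X) (a i : ℕ) :
    orbitWord T e (T^[a] x) i = orbitWord T e x (a + i) := by
  unfold orbitWord
  rw [← Function.iterate_add_apply, add_comm]

lemma measurable_orbitWord (hT : Measurable T) (he : Measurable e) (i : ℕ) :
    Measurable fun x => orbitWord T e x i := he.comp (hT.iterate i)

lemma measurableSet_wordEvent [DiscreteMeasurableSpace E] (hT : Measurable T) (he : Measurable e)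
    (n : ℕ) (w : ℕ → E) : MeasurableSet (wordEvent T e n w) := by
  have : wordEvent T e n w = ⋂ i ∈ Finset.range n, (fun x => orbitWord T e x i) ⁻¹' {w i} := by
    ext x; simp [wordEvent]
  rw [this]
  exact Finset.measurableSet_biInter _ fun i _ =>
    measurable_orbitWord hT he i (MeasurableSet.of_discrete)

/-- Every cylinder around `x` has positive probability. -/
def IsTypical (ν : Measure X) (T : X → X) (e : X → E) (x : X) : Prop :=
  ∀ n, ν.real (wordEvent T e n (orbitWord T e x)) ≠ 0

lemma wordEvent_congr {n : ℕ} {w w' : ℕ → E} (h : ∀ i < n, w i = w' i) :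
    wordEvent T e n w = wordEvent T e n w' := by
  ext x
  exact forall₂_congr fun i hi => by rw [h i hi]

lemma ae_isTypical [Finite E] [IsFiniteMeasure ν] : ∀ᵐ x ∂ν, IsTypical ν T e x := by
  unfold IsTypical
  rw [ae_all_iff]
  intro n
  have h : ∀ᵐ x ∂ν, ∀ y : Fin n → E, ν {z | ∀ i : Fin n, orbitWord T e z i = y i} = 0 →
      x ∉ {z | ∀ i : Fin n, orbitWord T e z i = y i} := by
    rw [ae_all_iff]
    intro y
    by_cases h0 : ν {z | ∀ i : Fin n, orbitWord T e z i = y i} = 0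
    · filter_upwards [measure_eq_zero_iff_ae_notMem.1 h0] with x hx _ using hx
    · exact ae_of_all _ fun x h => absurd h h0
  filter_upwards [h] with x hx h0
  refine hx (fun i => orbitWord T e x i) ?_ (fun i => rfl)
  rw [measureReal_eq_zero_iff] at h0
  refine measure_mono_null (fun z hz i hi => hz ⟨i, hi⟩) h0

lemma exists_isTypical [Finite E] [IsFiniteMeasure ν] {D : Set X} (hD : ν D ≠ 0) :
    ∃ x ∈ D, IsTypical ν T e x := by
  obtain ⟨x, hx, hx'⟩ := Set.not_subset.1
    (fun hsub : D ⊆ {x | ¬ IsTypical ν T e x} => hD (measure_mono_null hsub ae_isTypical))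
  exact ⟨x, hx, not_not.1 hx'⟩

namespace IsPathGibbs

variable [Finite E] [DiscreteMeasurableSpace E] [IsFiniteMeasure ν]
  (H : IsPathGibbs ν T e src tgt f)
include H

lemma measureReal_edge_of_mem {n : ℕ} {w : ℕ → E} (h : ν.real (wordEvent T e n w) ≠ 0) {i : ℕ}
    (hi : i < n) : ν.real (e ⁻¹' {w i}) ≠ 0 := by
  have h1 : ν.real (T^[i] ⁻¹' (e ⁻¹' {w i})) = ν.real (e ⁻¹' {w i}) :=
    (H.mp.iterate i).measureReal_preimage (H.meas MeasurableSet.of_discrete).nullMeasurableSet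
  rw [← h1]
  intro h0
  exact h (measureReal_mono_null (fun x hx => hx i hi) h0)

lemma connects_of_isTypical {x : X} (hx : IsTypical ν T e x) (a : ℕ) {n : ℕ} (hn : 0 < n) :
    Connects src tgt (fun y => ν.real (e ⁻¹' {y}) ≠ 0) n (src (orbitWord T e x a))
      (src (orbitWord T e x (a + n))) (fun i => orbitWord T e x (a + i)) where
  pos := hn
  path i hi := isPath_orbitWord H.tgt_eq (a + i + 2) x (a + i) (by omega)
  start := rfl
  finish := by
    rw [isPath_orbitWord (src := src) H.tgt_eq (a + n + 1) x (a + (n - 1)) (by omega)]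
    congr 2; omega
  good i hi := H.measureReal_edge_of_mem (hx (a + i + 1)) (by omega)

lemma weight_prod_pos {n : ℕ} {s t : S} {w : ℕ → E}
    (h : Connects src tgt (fun y => ν.real (e ⁻¹' {y}) ≠ 0) n s t w) (a : ℕ) :
    0 < ∏ i ∈ Finset.range n, f (a + i) (w i) :=
  Finset.prod_pos fun i hi => H.weight_pos _ _ (h.good i (Finset.mem_range.1 hi))

lemma swap_connects {n : ℕ} {s t : S} {w w' : ℕ → E} {good : E → Prop}
    (h : Connects src tgt good n s t w) (h' : Connects src tgt good n s t w') :
    ν.real (wordEvent T e n w) * ∏ i ∈ Finset.range n, f i (w' i) =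
      ν.real (wordEvent T e n w') * ∏ i ∈ Finset.range n, f i (w i) :=
  H.swap n w w' h.pos h.path h'.path (h.start.trans h'.start.symm) (h.finish.trans h'.finish.symm)

lemma measureReal_ne_zero_of_connects {n : ℕ} {s t : S} {w w' : ℕ → E}
    (h : Connects src tgt (fun y => ν.real (e ⁻¹' {y}) ≠ 0) n s t w)
    (h' : Connects src tgt (fun y => ν.real (e ⁻¹' {y}) ≠ 0) n s t w')
    (h0 : ν.real (wordEvent T e n w) ≠ 0) : ν.real (wordEvent T e n w') ≠ 0 := by
  have h1 := H.swap_connects h h'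
  have h2 := H.weight_prod_pos h' 0
  simp only [zero_add] at h2
  intro h3
  rw [h3, zero_mul] at h1
  exact (mul_ne_zero h0 h2.ne') h1

/-- Poincaré recurrence for words. -/
lemma exists_recurrent {n : ℕ} {w : ℕ → E} (h0 : ν.real (wordEvent T e n w) ≠ 0) (M : ℕ) :
    ∃ j, n < j ∧ ∃ x, IsTypical ν T e x ∧ x ∈ wordEvent T e n w ∧
      T^[M * j] x ∈ wordEvent T e n w := by
  -- Recurrence is applied to `T^[M]`, so that the return time is a multiple of `M`.
  obtain ⟨j, hj, h1⟩ := (H.mp.iterate M).conservative.exists_gt_measure_inter_ne_zero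
    (measurableSet_wordEvent H.mp.measurable H.meas n w).nullMeasurableSet
    (fun h => h0 (by simp [measureReal_def, h])) n
  obtain ⟨x, ⟨hx1, hx2⟩, hx⟩ := exists_isTypical (T := T) (e := e) h1
  refine ⟨j, hj, x, hx, hx1, ?_⟩
  rwa [Set.mem_preimage, ← Function.iterate_mul] at hx2

lemma wordEvent_one_ne_zero {y : E} (hy : ν.real (e ⁻¹' {y}) ≠ 0) (w : ℕ → E) (hw : w 0 = y) :
    ν.real (wordEvent T e 1 w) ≠ 0 := by
  convert hy using 2
  ext x
  simp [wordEvent, orbitWord, hw]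

/-- Every edge of positive probability starts a loop. -/
lemma exists_loop {y : E} (hy : ν.real (e ⁻¹' {y}) ≠ 0) :
    ∃ m v, Connects src tgt (fun y => ν.real (e ⁻¹' {y}) ≠ 0) m (src y) (src y) v ∧ v 0 = y := by
  obtain ⟨j, hj, x, hx, hx1, hx2⟩ :=
    H.exists_recurrent (H.wordEvent_one_ne_zero hy (fun _ => y) rfl) 1
  have h := H.connects_of_isTypical hx 0 (n := j) (by omega)
  have e1 : orbitWord T e x 0 = y := hx1 0 one_pos
  have e2 : orbitWord T e x j = y := by
    have := hx2 0 one_pos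
    rwa [orbitWord_iterate, one_mul, add_zero] at this
  simp only [zero_add, e1, e2] at h
  exact ⟨j, _, h, e1⟩

/-- Every path of edges of positive probability has positive probability. -/
lemma measureReal_wordEvent_ne_zero {n : ℕ} {s t : S} {w : ℕ → E}
    (h : Connects src tgt (fun y => ν.real (e ⁻¹' {y}) ≠ 0) n s t w) :
    ν.real (wordEvent T e n w) ≠ 0 := by
  have hn := h.pos
  induction n, hn using Nat.le_induction generalizing t with
  | base => exact H.wordEvent_one_ne_zero (h.good 0 one_pos) w rfl
  | succ n hn ih =>
    have hl := h.left (n := n) (n' := 1) hn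
    have hP := ih hl
    obtain ⟨m, v, hv, hv0⟩ := H.exists_loop (h.good n (by omega))
    -- The return time is a multiple of the loop length `m`. Thus the old path followed by `j` turns
    -- of the loop through the new edge has the same length and endpoints as a charged orbit
    -- segment, and `swap` makes it charged too.
    obtain ⟨j, hj, x, hx, hx1, hx2⟩ := H.exists_recurrent hP m
    have hend : tgt (w (n - 1)) = src (w n) := by
      have := h.path (n - 1) (by omega)
      rwa [show n - 1 + 1 = n by omega] at this
    obtain ⟨v', hv', hv'0⟩ := hv.exists_loop (j := j) (by omega)
    have hc := hl.glue (hend ▸ hv')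
    have e1 : src (orbitWord T e x 0) = s := by
      rw [hx1 0 (by omega)]; exact h.start
    have e2 : src (orbitWord T e x (n + m * j)) = src (w n) := by
      have h1 := hx2 (n - 1) (by omega)
      rw [orbitWord_iterate] at h1
      rw [show n + m * j = m * j + (n - 1) + 1 by omega,
        ← isPath_orbitWord (src := src) H.tgt_eq (m * j + (n - 1) + 2) x _ (by omega), h1, hend]
    have ho := H.connects_of_isTypical hx 0 (n := n + m * j) (by omega)
    simp only [zero_add, e1, e2] at ho
    have := H.measureReal_ne_zero_of_connects ho (hend ▸ hc) (hx _)
    intro h0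
    have hm := hv'.pos
    -- The loop starts with the new edge, so the glued path begins with the `n + 1` letters of `w`.
    refine this (measureReal_mono_null (s₂ := wordEvent T e (n + 1) w) ?_ h0)
    intro z hz i hi
    rw [hz i (by omega)]
    by_cases hin : i < n
    · rw [glue_of_lt hin]
    · obtain rfl : i = n := by omega
      have := glue_add i 0 w v'
      rw [add_zero] at this
      rw [this, hv'0, hv0]

/-- A path from `s` to `t` is charged, hence recurs after `N * j` steps. The orbit then returns from
`t` to `s` in `N * (j - 1)` steps, which may be replaced by `N`. -/
lemma reach_symm {N : ℕ}
    (hN : ∀ j, 0 < j → Reach src tgt (fun y => ν.real (e ⁻¹' {y}) ≠ 0) (N * j) =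
      Reach src tgt (fun y => ν.real (e ⁻¹' {y}) ≠ 0) N) {s t : S}
    (h : Reach src tgt (fun y => ν.real (e ⁻¹' {y}) ≠ 0) N s t) :
    Reach src tgt (fun y => ν.real (e ⁻¹' {y}) ≠ 0) N t s := by
  obtain ⟨w, hw⟩ := h
  have hpos := hw.pos
  obtain ⟨j, hj, x, hx, hx1, hx2⟩ := H.exists_recurrent (H.measureReal_wordEvent_ne_zero hw) N
  rw [← hN (j - 1) (by omega)]
  have h1 := H.connects_of_isTypical hx N (n := N * (j - 1)) (Nat.mul_pos hpos (by omega))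
  have e1 : src (orbitWord T e x N) = t := by
    rw [show N = N - 1 + 1 by omega,
      ← isPath_orbitWord (src := src) H.tgt_eq (N + 1) x _ (by omega), hx1 _ (by omega), hw.finish]
  have e2 : src (orbitWord T e x (N + N * (j - 1))) = s := by
    have := hx2 0 hpos
    rw [orbitWord_iterate] at this
    rw [show N + N * (j - 1) = N * j + 0 by
      obtain ⟨q, rfl⟩ : ∃ q, j = q + 1 := ⟨j - 1, by omega⟩
      simp; ring, this, hw.start]
  rw [e1, e2] at h1
  exact ⟨_, h1⟩

end IsPathGibbs

end PathProcess

/-! ### Uniform comparison of paths with different starting vertices -/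

section PathProcess

variable {X E S : Type*} [MeasurableSpace X] [MeasurableSpace E]
variable {ν : Measure X} {T : X → X} {e : X → E} {src tgt : E → S} {f : ℕ → E → ℝ}

lemma wordEvent_glue (n n' : ℕ) (w w' : ℕ → E) :
    wordEvent T e (n + n') (glue n w w') =
      wordEvent T e n w ∩ T^[n] ⁻¹' wordEvent T e n' w' := by
  ext x
  simp only [wordEvent, Set.mem_ofPred_eq, Set.mem_inter_iff, Set.mem_preimage]
  constructor
  · intro h
    refine ⟨fun i hi => ?_, fun i hi => ?_⟩
    · rw [h i (by omega), glue_of_lt hi]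
    · rw [orbitWord_iterate, h _ (by omega), glue_add]
  · rintro ⟨h1, h2⟩ i hi
    by_cases hin : i < n
    · rw [h1 i hin, glue_of_lt hin]
    · obtain ⟨q, rfl⟩ : ∃ q, i = n + q := ⟨i - n, by omega⟩
      rw [glue_add, ← h2 q (by omega), orbitWord_iterate]

lemma prod_glue (n n' : ℕ) (w w' : ℕ → E) :
    ∏ i ∈ Finset.range (n + n'), f i (glue n w w' i) =
      (∏ i ∈ Finset.range n, f i (w i)) * ∏ i ∈ Finset.range n', f (n + i) (w' i) := by
  rw [Finset.prod_range_add]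
  congr 1
  · exact Finset.prod_congr rfl fun i hi => by rw [glue_of_lt (Finset.mem_range.1 hi)]
  · exact Finset.prod_congr rfl fun i _ => by rw [glue_add]

/-- The first `n` letters along the orbit. -/
def orbitPrefix (T : X → X) (e : X → E) (n : ℕ) (x : X) (i : Fin n) : E := orbitWord T e x i

lemma measurable_orbitPrefix (hT : Measurable T) (he : Measurable e) (n : ℕ) :
    Measurable (orbitPrefix T e n) :=
  measurable_pi_lambda _ fun i => measurable_orbitWord hT he i

lemma orbitPrefix_preimage (n : ℕ) (x : X) :
    orbitPrefix T e n ⁻¹' {orbitPrefix T e n x} = wordEvent T e n (orbitWord T e x) := by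
  ext z
  simp only [Set.mem_preimage, Set.mem_singleton_iff, funext_iff, orbitPrefix, wordEvent,
    Set.mem_ofPred_eq]
  exact ⟨fun h i hi => h ⟨i, hi⟩, fun h i => h i i.2⟩

namespace IsPathGibbs

variable [Fintype E] [DiscreteMeasurableSpace E] [IsProbabilityMeasure ν]
  (H : IsPathGibbs ν T e src tgt f)
include H

lemma exists_weight_ratio_bound (N : ℕ) :
    ∃ B : ℝ, 0 < B ∧ ∀ s s' t t' w w',
      Connects src tgt (fun y => ν.real (e ⁻¹' {y}) ≠ 0) N s t w →
      Connects src tgt (fun y => ν.real (e ⁻¹' {y}) ≠ 0) N s' t' w' →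
      ∏ i ∈ Finset.range N, f i (w i) ≤ B * ∏ i ∈ Finset.range N, f i (w' i) := by
  obtain ⟨B₁, hB₁⟩ := (Set.finite_range fun p : (Fin N → E) × (Fin N → E) =>
    (∏ i : Fin N, f i (p.1 i)) / ∏ i : Fin N, f i (p.2 i)).bddAbove
  -- There are finitely many pairs of words of length `N`; the maximum with `1` only ensures
  -- positivity.
  refine ⟨max B₁ 1, by positivity, fun s s' t t' w w' h h' => ?_⟩
  have h2 := H.weight_prod_pos h' 0
  simp only [zero_add] at h2
  rw [← div_le_iff₀ h2]
  refine le_trans (hB₁ ⟨(fun i => w i, fun i => w' i), ?_⟩) (le_max_left _ _)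
  simp only
  rw [Finset.prod_range, Finset.prod_range]

/-- By stationarity `w` may be read from time `N` on, which is why the weights are `f (N + i)`. Each
charged prefix of length `N` leading to `s` can be replaced by a path of length `N` from the same
vertex to `s'`. Then `swap` applies to the prolonged paths, and the two prefixes have comparable
weights. -/
lemma exists_bound_mul {N : ℕ}
    (hN : ∀ j, 0 < j → Reach src tgt (fun y => ν.real (e ⁻¹' {y}) ≠ 0) (N * j) =
      Reach src tgt (fun y => ν.real (e ⁻¹' {y}) ≠ 0) N) :
    ∃ K : ℝ, 0 < K ∧ ∀ j, 0 < j → ∀ s s' t w w',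
      Connects src tgt (fun y => ν.real (e ⁻¹' {y}) ≠ 0) (N * j) s t w →
      Connects src tgt (fun y => ν.real (e ⁻¹' {y}) ≠ 0) (N * j) s' t w' →
      ν.real (wordEvent T e (N * j) w) * ∏ i ∈ Finset.range (N * j), f (N + i) (w' i) ≤
        K * (ν.real (wordEvent T e (N * j) w') *
          ∏ i ∈ Finset.range (N * j), f (N + i) (w i)) := by
  obtain ⟨B, hB, hratio⟩ := H.exists_weight_ratio_bound N
  have hE : Nonempty X := nonempty_of_isProbabilityMeasure ν
  have hE' : Nonempty E := hE.map e
  -- The number of prefixes times the bound for the ratio of two prefix weights; neither depends on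
  -- `j`.
  refine ⟨Fintype.card (Fin N → E) * B, by positivity, fun j hj s s' t w w' h h' => ?_⟩
  set n := N * j with hn
  have hNpos : 0 < N := Nat.pos_of_mul_pos_right h.pos
  have hFw := H.weight_prod_pos h N
  have hFw' := H.weight_prod_pos h' N
  set F := ∏ i ∈ Finset.range n, f (N + i) (w i) with hF
  set F' := ∏ i ∈ Finset.range n, f (N + i) (w' i) with hF'
  have e1 : ν.real (wordEvent T e n w) = ν.real (T^[N] ⁻¹' wordEvent T e n w) :=
    ((H.mp.iterate N).measureReal_preimage
      (measurableSet_wordEvent H.mp.measurable H.meas n w).nullMeasurableSet).symm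
  have e2 : ν.real (wordEvent T e n w') = ν.real (T^[N] ⁻¹' wordEvent T e n w') :=
    ((H.mp.iterate N).measureReal_preimage
      (measurableSet_wordEvent H.mp.measurable H.meas n w').nullMeasurableSet).symm
  rw [e1, measureReal_eq_sum_fiber ν (measurable_orbitPrefix H.mp.measurable H.meas N),
    Finset.sum_mul]
  have key : ∀ y : Fin N → E,
      ν.real (T^[N] ⁻¹' wordEvent T e n w ∩ orbitPrefix T e N ⁻¹' {y}) * F' ≤
        B * (ν.real (wordEvent T e n w') * F) := by
    intro y
    by_cases h0 : ν.real (T^[N] ⁻¹' wordEvent T e n w ∩ orbitPrefix T e N ⁻¹' {y}) = 0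
    · rw [h0, zero_mul]
      exact mul_nonneg hB.le (mul_nonneg measureReal_nonneg hFw.le)
    have h1 : ν (T^[N] ⁻¹' wordEvent T e n w ∩ orbitPrefix T e N ⁻¹' {y}) ≠ 0 := fun h =>
      h0 (by simp [measureReal_def, h])
    obtain ⟨x, ⟨hx1, rfl⟩, hx⟩ := exists_isTypical (T := T) (e := e) h1
    rw [orbitPrefix_preimage, Set.inter_comm, ← wordEvent_glue]
    have hcx := H.connects_of_isTypical hx 0 hNpos
    simp only [zero_add] at hcx
    have hs : src (orbitWord T e x N) = s := by
      have := hx1 0 h.pos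
      rw [orbitWord_iterate, add_zero] at this
      rw [this, h.start]
    rw [hs] at hcx
    set u := src (orbitWord T e x 0)
    have hst : Reach src tgt (fun y => ν.real (e ⁻¹' {y}) ≠ 0) N s t := hN j hj ▸ ⟨w, h⟩
    have hst' : Reach src tgt (fun y => ν.real (e ⁻¹' {y}) ≠ 0) N s' t := hN j hj ▸ ⟨w', h'⟩
    -- The route is `u → s → t → s'`, the last part by symmetry; its `3 * N` steps reduce to `N`.
    have hus' : Reach src tgt (fun y => ν.real (e ⁻¹' {y}) ≠ 0) N u s' := by
      have h2 : Reach src tgt (fun y => ν.real (e ⁻¹' {y}) ≠ 0) (N + (N + N)) u s' :=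
        (reach_add hNpos (by omega)).2 ⟨s, ⟨_, hcx⟩,
          (reach_add hNpos hNpos).2 ⟨t, hst, H.reach_symm hN hst'⟩⟩
      rw [show N + (N + N) = N * 3 by ring, hN 3 (by norm_num)] at h2
      exact h2
    obtain ⟨x', hx'⟩ := hus'
    have hsw := H.swap_connects (hcx.glue h) (hx'.glue h')
    rw [prod_glue, prod_glue] at hsw
    have hb := hratio _ _ _ _ _ _ hcx hx'
    have hFx' := H.weight_prod_pos hx' 0
    have hFx := H.weight_prod_pos hcx 0
    simp only [zero_add] at hFx' hFx
    have hle : ν.real (wordEvent T e (N + n) (glue N x' w')) ≤ ν.real (wordEvent T e n w') := by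
      rw [wordEvent_glue, e2]
      exact measureReal_mono Set.inter_subset_right
    refine le_of_mul_le_mul_right ?_ hFx'
    calc ν.real (wordEvent T e (N + n) (glue N (orbitWord T e x) w)) * F' *
          ∏ i ∈ Finset.range N, f i (x' i)
        = ν.real (wordEvent T e (N + n) (glue N x' w')) *
          ((∏ i ∈ Finset.range N, f i (orbitWord T e x i)) * F) := by rw [← hsw]; ring
      _ ≤ ν.real (wordEvent T e n w') *
          ((B * ∏ i ∈ Finset.range N, f i (x' i)) * F) := by
        gcongr
      _ = _ := by ring
  calc _ ≤ ∑ _y : Fin N → E, B * (ν.real (wordEvent T e n w') * F) :=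
        Finset.sum_le_sum fun y _ => key y
    _ = _ := by rw [Finset.sum_const, Finset.card_univ, nsmul_eq_mul]; ring

/-- Up to a bounded error, the logarithm of the probability of a path is a sum of functions of its
edges and of its final vertex. -/
lemma exists_log_bound {N : ℕ}
    (hN : ∀ j, 0 < j → Reach src tgt (fun y => ν.real (e ⁻¹' {y}) ≠ 0) (N * j) =
      Reach src tgt (fun y => ν.real (e ⁻¹' {y}) ≠ 0) N) :
    ∃ C : ℝ, ∀ j, 0 < j → ∃ β : S → ℝ, ∀ s t w,
      Connects src tgt (fun y => ν.real (e ⁻¹' {y}) ≠ 0) (N * j) s t w →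
      |Real.log (ν.real (wordEvent T e (N * j) w)) -
        (∑ i ∈ Finset.range (N * j), Real.log (f (N + i) (w i)) + β t)| ≤ C := by
  classical
  obtain ⟨K, hK, hb⟩ := H.exists_bound_mul hN
  refine ⟨Real.log K, fun j hj => ?_⟩
  have hβ : ∀ t, ∃ b : ℝ, ∀ s w,
      Connects src tgt (fun y => ν.real (e ⁻¹' {y}) ≠ 0) (N * j) s t w →
      |Real.log (ν.real (wordEvent T e (N * j) w)) -
        (∑ i ∈ Finset.range (N * j), Real.log (f (N + i) (w i)) + b)| ≤ Real.log K := by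
    intro t
    by_cases hex : ∃ s' w', Connects src tgt (fun y => ν.real (e ⁻¹' {y}) ≠ 0) (N * j) s' t w'
    swap
    · exact ⟨0, fun s w h => absurd ⟨s, w, h⟩ hex⟩
    obtain ⟨s', w', h'⟩ := hex
    have key : ∀ s s' w w', Connects src tgt (fun y => ν.real (e ⁻¹' {y}) ≠ 0) (N * j) s t w →
        Connects src tgt (fun y => ν.real (e ⁻¹' {y}) ≠ 0) (N * j) s' t w' →
        Real.log (ν.real (wordEvent T e (N * j) w)) +
            ∑ i ∈ Finset.range (N * j), Real.log (f (N + i) (w' i)) ≤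
          Real.log K + Real.log (ν.real (wordEvent T e (N * j) w')) +
            ∑ i ∈ Finset.range (N * j), Real.log (f (N + i) (w i)) := by
      intro s s' w w' h h'
      have h1 := hb j hj s s' t w w' h h'
      have p1 : 0 < ν.real (wordEvent T e (N * j) w) :=
        measureReal_nonneg.lt_of_ne' (H.measureReal_wordEvent_ne_zero h)
      have p2 : 0 < ν.real (wordEvent T e (N * j) w') :=
        measureReal_nonneg.lt_of_ne' (H.measureReal_wordEvent_ne_zero h')
      have q1 := H.weight_prod_pos h N
      have q2 := H.weight_prod_pos h' N
      have h2 := Real.log_le_log (mul_pos p1 q2) h1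
      rw [Real.log_mul p1.ne' q2.ne', Real.log_mul hK.ne' (mul_pos p2 q1).ne',
        Real.log_mul p2.ne' q1.ne',
        Real.log_prod fun i hi => (H.weight_pos _ _ (h.good i (Finset.mem_range.1 hi))).ne',
        Real.log_prod fun i hi => (H.weight_pos _ _ (h'.good i (Finset.mem_range.1 hi))).ne'] at h2
      linarith
    -- The value of `β` at `t` is read off one reference path ending at `t`.
    refine ⟨Real.log (ν.real (wordEvent T e (N * j) w')) -
      ∑ i ∈ Finset.range (N * j), Real.log (f (N + i) (w' i)), fun s w h => ?_⟩
    have h1 := key _ _ _ _ h h'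
    have h2 := key _ _ _ _ h' h
    rw [abs_le]
    constructor <;> linarith
  choose β hβ using hβ
  exact ⟨β, fun s t w h => hβ t s w h⟩

end IsPathGibbs

end PathProcess

/-- A convex sequence that lies, along a subsequence, below its initial tangent up to a constant
is affine. -/
lemma affine_of_convex_of_le {h : ℕ → ℝ} {C : ℝ} {N : ℕ} (hN : 0 < N)
    (hconv : ∀ m, h (m + 1) + h (m + 1) ≤ h (m + 2) + h m)
    (hle : ∀ j, 0 < j → h (N * j) ≤ C + (h 0 + (N * j : ℕ) * (h 1 - h 0))) (m : ℕ) :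
    h (m + 1) + h (m + 1) = h (m + 2) + h m := by
  by_contra hne
  have hlt := lt_of_le_of_ne (hconv m) hne
  have hmono : Monotone fun n => h (n + 1) - h n :=
    monotone_nat_of_le_succ fun n => by have := hconv n; linarith
  set d := h 1 - h 0
  set ε := h (m + 2) + h m - (h (m + 1) + h (m + 1)) with hε
  have hεpos : 0 < ε := by linarith
  have hd : ∀ n, d ≤ h (n + 1) - h n := fun n => hmono (Nat.zero_le n)
  have h1 : ∀ n, h 0 + n * d ≤ h n := by
    intro n
    induction n with
    | zero => simp
    | succ n ih => have := hd n; push_cast; linarith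
  -- A strict gap `ε` at `m` raises every later increment to at least `d + ε`.
  have h2 : ∀ q : ℕ, h 0 + ((m + 1 + q : ℕ) : ℝ) * d + q * ε ≤ h (m + 1 + q) := by
    intro q
    induction q with
    | zero => simpa using h1 (m + 1)
    | succ q ih =>
      have e1 : h (m + 1 + 1) - h (m + 1) ≤ h (m + 1 + q + 1) - h (m + 1 + q) :=
        hmono (Nat.le_add_right (m + 1) q)
      have e2 := hd m
      have e3 : h (m + 1 + 1) = h (m + 2) := rfl
      have e4 : m + 1 + (q + 1) = m + 1 + q + 1 := rfl
      rw [e4]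
      push_cast at ih ⊢
      rw [e3] at e1
      linarith
  -- With `j = m + 1 + q` one has `N * j ≥ m + 1 + q`, and the accumulated excess over the tangent
  -- is larger than `C`.
  obtain ⟨q, hq⟩ := exists_nat_gt (C / ε)
  rw [div_lt_iff₀ hεpos] at hq
  have h3 := hle (m + 1 + q) (by omega)
  obtain ⟨r, hr⟩ : ∃ r, N * (m + 1 + q) = m + 1 + (q + r) := by
    have := Nat.le_mul_of_pos_left (m + 1 + q) hN
    exact ⟨N * (m + 1 + q) - (m + 1 + q), by omega⟩
  have h4 := h2 (q + r)
  rw [hr] at h3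
  have : (q : ℝ) * ε ≤ ((q + r : ℕ) : ℝ) * ε := by
    apply mul_le_mul_of_nonneg_right _ hεpos.le
    push_cast
    have : (0 : ℝ) ≤ r := by positivity
    linarith
  linarith

/-! ### Convexity of block entropies and the Markov property -/

section PathProcess

variable {X E S : Type*} [MeasurableSpace X] [MeasurableSpace E]
variable {ν : Measure X} {T : X → X} {e : X → E} {src tgt : E → S} {f : ℕ → E → ℝ}

/-- The initial vertex together with the first `n` edges along the orbit. -/
def pathPrefix (T : X → X) (e : X → E) (src : E → S) (n : ℕ) (x : X) : S × (Fin n → E) :=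
  (src (e x), orbitPrefix T e n x)

lemma orbitPrefix_eq_iff {n : ℕ} {x y : X} : orbitPrefix T e n x = orbitPrefix T e n y ↔
    ∀ i < n, orbitWord T e x i = orbitWord T e y i := by
  simp only [funext_iff, orbitPrefix]
  exact ⟨fun h i hi => h ⟨i, hi⟩, fun h i => h i i.2⟩

lemma pathPrefix_eq_iff {n : ℕ} {x y : X} : pathPrefix T e src n x = pathPrefix T e src n y ↔
    src (e x) = src (e y) ∧ ∀ i < n, orbitWord T e x i = orbitWord T e y i := by
  rw [pathPrefix, pathPrefix, Prod.mk.injEq, orbitPrefix_eq_iff]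

lemma pathPrefix_eq_iff_of_pos {n : ℕ} (hn : 0 < n) {x y : X} :
    pathPrefix T e src n x = pathPrefix T e src n y ↔
      orbitPrefix T e n x = orbitPrefix T e n y := by
  rw [pathPrefix_eq_iff, orbitPrefix_eq_iff, and_iff_right_iff_imp]
  exact fun h => congrArg src (h 0 hn)

lemma forall_lt_succ_orbitWord {n : ℕ} {x : X} {p : ℕ → E → Prop} :
    (∀ i < n + 1, p i (orbitWord T e x i)) ↔
      p 0 (e x) ∧ ∀ i < n, p (i + 1) (orbitWord T e (T x) i) := by
  constructor
  · exact fun h => ⟨h 0 (by omega), fun i hi => h (i + 1) (by omega)⟩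
  · rintro ⟨h0, h⟩ i hi
    cases i with
    | zero => exact h0
    | succ i => exact h i (by omega)

namespace IsPathGibbs

variable [Fintype E] [DiscreteMeasurableSpace E] [IsProbabilityMeasure ν]
  [Fintype S] [MeasurableSpace S] [DiscreteMeasurableSpace S]
  (H : IsPathGibbs ν T e src tgt f)
include H

lemma measurable_pathPrefix (n : ℕ) : Measurable (pathPrefix T e src n) :=
  ((measurable_of_finite src).comp H.meas).prodMk
    (measurable_orbitPrefix H.mp.measurable H.meas n)

lemma prefix_eq_iff₁ (m : ℕ) (x y : X) :
    ((e x, pathPrefix T e src m (T x)) = (e y, pathPrefix T e src m (T y))) ↔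
      pathPrefix T e src (m + 1) x = pathPrefix T e src (m + 1) y := by
  rw [Prod.mk.injEq, pathPrefix_eq_iff, pathPrefix_eq_iff,
    forall_lt_succ_orbitWord (p := fun i z => z = orbitWord T e y i), ← H.tgt_eq, ← H.tgt_eq]
  exact ⟨fun h => ⟨congrArg src h.1, h.1, h.2.2⟩, fun h => ⟨h.2.1, congrArg tgt h.2.1, h.2.2⟩⟩

lemma prefix_eq_iff₂ (m : ℕ) (x y : X) :
    ((pathPrefix T e src m (T x), orbitWord T e x (m + 1)) =
      (pathPrefix T e src m (T y), orbitWord T e y (m + 1))) ↔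
      pathPrefix T e src (m + 1) (T x) = pathPrefix T e src (m + 1) (T y) := by
  rw [Prod.mk.injEq, pathPrefix_eq_iff, pathPrefix_eq_iff, Nat.forall_lt_succ_right, and_assoc]
  rfl

lemma prefix_eq_iff₃ (m : ℕ) (x y : X) :
    ((e x, pathPrefix T e src m (T x), orbitWord T e x (m + 1)) =
      (e y, pathPrefix T e src m (T y), orbitWord T e y (m + 1))) ↔
      pathPrefix T e src (m + 2) x = pathPrefix T e src (m + 2) y := by
  rw [Prod.mk.injEq, H.prefix_eq_iff₂, ← H.prefix_eq_iff₁ (m + 1)]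
  exact Prod.mk_inj.symm

/-- Strong subadditivity for the first edge, the last edge and the `m` edges in between;
stationarity identifies the two overlapping blocks. For `m = 0` the middle block is the common
vertex, which is why `pathPrefix` records the initial vertex. -/
lemma negEntropy_convex (m : ℕ) :
    negEntropy ν (pathPrefix T e src (m + 1)) + negEntropy ν (pathPrefix T e src (m + 1)) ≤
      negEntropy ν (pathPrefix T e src (m + 2)) + negEntropy ν (pathPrefix T e src m) := by
  have := negEntropy_ssa ν H.meas ((H.measurable_pathPrefix m).comp H.mp.measurable)
    (measurable_orbitWord H.mp.measurable H.meas (m + 1))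
  simp only [Function.comp_def] at this
  rwa [negEntropy_congr ν (H.prefix_eq_iff₁ m), negEntropy_congr ν (H.prefix_eq_iff₂ m),
    negEntropy_congr ν (H.prefix_eq_iff₃ m), negEntropy_comp ν H.mp (H.measurable_pathPrefix m),
    negEntropy_comp ν H.mp (H.measurable_pathPrefix (m + 1))] at this

/-- Equality in strong subadditivity makes the first and the last edge independent given the block
between them, which for `m = 0` is the vertex they share. -/
lemma measureReal_mul_of_negEntropy_eq {m : ℕ}
    (heq : negEntropy ν (pathPrefix T e src (m + 1)) + negEntropy ν (pathPrefix T e src (m + 1)) =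
      negEntropy ν (pathPrefix T e src (m + 2)) + negEntropy ν (pathPrefix T e src m))
    {w : ℕ → E} (hw : IsPath src tgt (m + 2) w) :
    ν.real (wordEvent T e (m + 2) w) *
      ν.real {x | src (e x) = src (w 1) ∧ ∀ i < m, orbitWord T e x i = w (i + 1)} =
    ν.real (wordEvent T e (m + 1) w) * ν.real (wordEvent T e (m + 1) fun i => w (i + 1)) := by
  have hmg := (H.measurable_pathPrefix m).comp H.mp.measurable
  have hmh := measurable_orbitWord H.mp.measurable H.meas (m + 1)
  have key := measureReal_mul_eq_of_negEntropy_eq ν H.meas hmg hmh (by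
    simp only [Function.comp_def]
    rwa [negEntropy_congr ν (H.prefix_eq_iff₁ m), negEntropy_congr ν (H.prefix_eq_iff₂ m),
      negEntropy_congr ν (H.prefix_eq_iff₃ m), negEntropy_comp ν H.mp (H.measurable_pathPrefix m),
      negEntropy_comp ν H.mp (H.measurable_pathPrefix (m + 1))])
    (w 0, (src (w 1), fun i => w (i + 1)), w (m + 1))
  have h01 : tgt (w 0) = src (w 1) := hw 0 (by omega)
  have a1 : ∀ x, pathPrefix T e src m x = (src (w 1), fun i : Fin m => w (i + 1)) ↔
      src (e x) = src (w 1) ∧ ∀ i < m, orbitWord T e x i = w (i + 1) := by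
    intro x
    rw [pathPrefix, Prod.mk.injEq, funext_iff]
    exact and_congr_right fun _ => ⟨fun h i hi => h ⟨i, hi⟩, fun h i => h i i.2⟩
  have b1 : (fun x => (e x, (pathPrefix T e src m ∘ T) x, orbitWord T e x (m + 1))) ⁻¹'
      {(w 0, (src (w 1), fun i : Fin m => w (i + 1)), w (m + 1))} = wordEvent T e (m + 2) w := by
    ext x
    simp only [Set.mem_preimage, Set.mem_singleton_iff, Prod.mk.injEq, Function.comp_apply, a1,
      wordEvent, Set.mem_ofPred_eq]
    rw [forall_lt_succ_orbitWord (p := fun i z => z = w i), Nat.forall_lt_succ_right, ← H.tgt_eq]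
    refine and_congr_right fun h0 => ?_
    rw [h0, and_iff_right h01]
    rfl
  have b2 : (fun x => (e x, (pathPrefix T e src m ∘ T) x)) ⁻¹'
      {(w 0, (src (w 1), fun i : Fin m => w (i + 1)))} = wordEvent T e (m + 1) w := by
    ext x
    simp only [Set.mem_preimage, Set.mem_singleton_iff, Prod.mk.injEq, Function.comp_apply, a1,
      wordEvent, Set.mem_ofPred_eq]
    rw [forall_lt_succ_orbitWord (p := fun i z => z = w i), ← H.tgt_eq]
    refine and_congr_right fun h0 => ?_
    rw [h0, and_iff_right h01]
  have b3 : (fun x => ((pathPrefix T e src m ∘ T) x, orbitWord T e x (m + 1))) ⁻¹'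
      {((src (w 1), fun i : Fin m => w (i + 1)), w (m + 1))} =
      T ⁻¹' wordEvent T e (m + 1) fun i => w (i + 1) := by
    ext x
    simp only [Set.mem_preimage, Set.mem_singleton_iff, Prod.mk.injEq, Function.comp_apply, a1,
      wordEvent, Set.mem_ofPred_eq]
    rw [and_assoc]
    constructor
    · rintro ⟨-, h2, h3⟩
      rw [Nat.forall_lt_succ_right]
      exact ⟨h2, h3⟩
    · intro h
      refine ⟨congrArg src (h 0 (by omega)), fun i hi => h i (by omega), h m (by omega)⟩
  have b4 : (pathPrefix T e src m ∘ T) ⁻¹' {(src (w 1), fun i : Fin m => w (i + 1))} =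
      T ⁻¹' {x | src (e x) = src (w 1) ∧ ∀ i < m, orbitWord T e x i = w (i + 1)} := by
    ext x
    simp only [Set.mem_preimage, Set.mem_singleton_iff, Function.comp_apply, a1, Set.mem_ofPred_eq]
  simp only at key
  rw [b1, b2, b3, b4, H.mp.measureReal_preimage
      (measurableSet_wordEvent H.mp.measurable H.meas _ _).nullMeasurableSet,
    H.mp.measureReal_preimage] at key
  · exact key
  · have : {x | src (e x) = src (w 1) ∧ ∀ i < m, orbitWord T e x i = w (i + 1)} =
      pathPrefix T e src m ⁻¹' {(src (w 1), fun i : Fin m => w (i + 1))} := by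
      ext x
      simp only [Set.mem_preimage, Set.mem_singleton_iff, a1, Set.mem_ofPred_eq]
    rw [this]
    exact (H.measurable_pathPrefix m MeasurableSet.of_discrete).nullMeasurableSet

/-- Each application of conditional independence drops the oldest edge of the past, until only the
current vertex is left. One divides by the probability of the middle block; if it vanishes, both
sides do. -/
lemma markov_step
    (heq : ∀ m, negEntropy ν (pathPrefix T e src (m + 1)) +
        negEntropy ν (pathPrefix T e src (m + 1)) =
      negEntropy ν (pathPrefix T e src (m + 2)) + negEntropy ν (pathPrefix T e src m))
    (n : ℕ) {w : ℕ → E} (hw : IsPath src tgt (n + 2) w) :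
    ν.real (wordEvent T e (n + 2) w) * ν.real {x | src (e x) = src (w (n + 1))} =
      ν.real (wordEvent T e (n + 1) w) * ν.real (e ⁻¹' {w (n + 1)}) := by
  induction n generalizing w with
  | zero =>
    have := H.measureReal_mul_of_negEntropy_eq (heq 0) hw
    have h1 : wordEvent T e (0 + 1) (fun i => w (i + 1)) = e ⁻¹' {w 1} := by
      ext x
      simp [wordEvent, orbitWord]
    rw [h1] at this
    simpa using this
  | succ n ih =>
    have h1 := H.measureReal_mul_of_negEntropy_eq (heq (n + 1)) hw
    have h2 := ih (w := fun i => w (i + 1)) (fun i hi => hw (i + 1) (by omega))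
    have h3 : {x | src (e x) = src (w 1) ∧ ∀ i < n + 1, orbitWord T e x i = w (i + 1)} =
        wordEvent T e (n + 1) fun i => w (i + 1) := by
      ext x
      exact and_iff_right_of_imp fun h => congrArg src (h 0 (by omega))
    rw [h3] at h1
    by_cases h0 : ν.real (wordEvent T e (n + 1) fun i => w (i + 1)) = 0
    · have h0' : ν.real (T ⁻¹' wordEvent T e (n + 1) fun i => w (i + 1)) = 0 := by
        rwa [H.mp.measureReal_preimage
          (measurableSet_wordEvent H.mp.measurable H.meas _ _).nullMeasurableSet]
      have hsub : ∀ {q}, n + 2 ≤ q → wordEvent T e q w ⊆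
          T ⁻¹' wordEvent T e (n + 1) fun i => w (i + 1) :=
        fun hq x hx i hi => hx (i + 1) (by omega)
      have e1 : ν.real (wordEvent T e (n + 1 + 2) w) = 0 :=
        measureReal_mono_null (hsub (by omega)) h0'
      have e2 : ν.real (wordEvent T e (n + 1 + 1) w) = 0 :=
        measureReal_mono_null (hsub (by omega)) h0'
      rw [e1, e2, zero_mul, zero_mul]
    · apply mul_right_cancel₀ h0
      calc _ = (ν.real (wordEvent T e (n + 1 + 2) w) *
            ν.real (wordEvent T e (n + 1) fun i => w (i + 1))) *
            ν.real {x | src (e x) = src (w (n + 1 + 1))} := by ring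
        _ = ν.real (wordEvent T e (n + 1 + 1) w) *
            (ν.real (wordEvent T e (n + 2) fun i => w (i + 1)) *
            ν.real {x | src (e x) = src (w (n + 1 + 1))}) := by rw [h1]; ring
        _ = _ := by rw [h2]; ring

end IsPathGibbs

end PathProcess

/-! ### Comparison with the Markov process with the same edge distribution -/

section PathProcess

variable {X E S : Type*} [MeasurableSpace X] [MeasurableSpace E]
variable {ν : Measure X} {T : X → X} {e : X → E} {src tgt : E → S} {f : ℕ → E → ℝ}

namespace IsPathGibbs

variable [Fintype E] [DiscreteMeasurableSpace E] [IsProbabilityMeasure ν]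
  [Fintype S] [MeasurableSpace S] [DiscreteMeasurableSpace S]
  (H : IsPathGibbs ν T e src tgt f)

/-- For a stationary process the mean of a one-edge function depends only on the edge distribution;
this makes energies under `μ` and `ν` coincide. -/
lemma integral_orbitWord {μ ν : Measure X} [IsProbabilityMeasure μ] [IsProbabilityMeasure ν]
    (hμ : MeasurePreserving T μ μ) (he : Measurable e)
    (hedge : ∀ y, μ.real (e ⁻¹' {y}) = ν.real (e ⁻¹' {y})) (φ : E → ℝ) (i : ℕ) :
    ∫ x, φ (orbitWord T e x i) ∂μ = ∫ x, φ (e x) ∂ν := by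
  rw [integral_comp_of_finite μ (measurable_orbitWord hμ.measurable he i),
    integral_comp_of_finite ν he]
  refine Finset.sum_congr rfl fun y _ => ?_
  rw [← hedge, ← (hμ.iterate i).measureReal_preimage
    (he MeasurableSet.of_discrete).nullMeasurableSet]
  rfl

lemma integrable_orbitWord {μ : Measure X} [IsProbabilityMeasure μ]
    (hμ : MeasurePreserving T μ μ) (he : Measurable e) (φ : E → ℝ) (i : ℕ) :
    Integrable (fun x => φ (orbitWord T e x i)) μ :=
  integrable_comp_of_finite μ (measurable_orbitWord hμ.measurable he i) φ

include H

lemma ae_good {μ : Measure X} [IsProbabilityMeasure μ] (hμ : MeasurePreserving T μ μ)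
    (hedge : ∀ y, μ.real (e ⁻¹' {y}) = ν.real (e ⁻¹' {y})) :
    ∀ᵐ x ∂μ, ∀ i, ν.real (e ⁻¹' {orbitWord T e x i}) ≠ 0 := by
  filter_upwards [ae_isTypical (ν := μ) (T := T) (e := e)] with x hx i
  rw [← hedge, ← (hμ.iterate i).measureReal_preimage
    (H.meas MeasurableSet.of_discrete).nullMeasurableSet]
  intro h0
  refine hx (i + 1) (measureReal_mono_null ?_ h0)
  intro z hz
  exact hz i (by omega)

lemma connects_of_good {x : X} (hx : ∀ i, ν.real (e ⁻¹' {orbitWord T e x i}) ≠ 0) {n : ℕ}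
    (hn : 0 < n) :
    Connects src tgt (fun y => ν.real (e ⁻¹' {y}) ≠ 0) n (src (orbitWord T e x 0))
      (src (orbitWord T e x n)) (orbitWord T e x) where
  pos := hn
  path := isPath_orbitWord H.tgt_eq n x
  start := rfl
  finish := by
    rw [isPath_orbitWord (src := src) H.tgt_eq (n + 1) x (n - 1) (by omega)]
    congr 2; omega
  good i _ := hx i

/-- The function `L` of the energy and last vertex has equal means under `μ` and `ν` and differs
from `P = log ν(path)` by at most `C` almost everywhere for both. Thus `∫ P ∂ν ≤ ∫ P ∂μ + 2 * C`,
and Gibbs' inequality bounds `∫ P ∂μ`. -/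
lemma negEntropy_le {N a : ℕ} {C : ℝ} {μ : Measure X} [IsProbabilityMeasure μ]
    (hμ : MeasurePreserving T μ μ)
    (hedge : ∀ y, μ.real (e ⁻¹' {y}) = ν.real (e ⁻¹' {y})) (hN : 0 < N) (β : S → ℝ)
    (hβ : ∀ s t w, Connects src tgt (fun y => ν.real (e ⁻¹' {y}) ≠ 0) N s t w →
      |Real.log (ν.real (wordEvent T e N w)) -
        (∑ i ∈ Finset.range N, Real.log (f (a + i) (w i)) + β t)| ≤ C) :
    negEntropy ν (pathPrefix T e src N) ≤ 2 * C + negEntropy μ (pathPrefix T e src N) := by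
  have hprefix : Measurable (orbitPrefix T e N) :=
    measurable_orbitPrefix H.mp.measurable H.meas N
  set L : X → ℝ := fun x =>
    ∑ i ∈ Finset.range N, Real.log (f (a + i) (orbitWord T e x i)) + β (src (orbitWord T e x N)) with hL
  have hLint : ∀ {κ : Measure X} [IsProbabilityMeasure κ], MeasurePreserving T κ κ →
      Integrable L κ := fun hκ =>
    (integrable_finsetSum _ fun i _ => integrable_orbitWord hκ H.meas
      (fun y => Real.log (f (a + i) y)) i).add (integrable_orbitWord hκ H.meas (fun y => β (src y)) N)
  have hLeq : ∀ {κ : Measure X} [IsProbabilityMeasure κ], MeasurePreserving T κ κ →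
      (∀ y, κ.real (e ⁻¹' {y}) = ν.real (e ⁻¹' {y})) → ∫ x, L x ∂κ =
        ∑ i ∈ Finset.range N, ∫ x, Real.log (f (a + i) (e x)) ∂ν + ∫ x, β (src (e x)) ∂ν := by
    intro κ _ hκ hk
    rw [hL, integral_add, integral_finsetSum]
    · congr 1
      · exact Finset.sum_congr rfl fun i _ =>
          integral_orbitWord hκ H.meas hk (fun y => Real.log (f (a + i) y)) i
      · exact integral_orbitWord hκ H.meas hk (fun y => β (src y)) N
    · exact fun i _ => integrable_orbitWord hκ H.meas (fun y => Real.log (f (a + i) y)) i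
    · exact integrable_finsetSum _ fun i _ => integrable_orbitWord hκ H.meas
        (fun y => Real.log (f (a + i) y)) i
    · exact integrable_orbitWord hκ H.meas (fun y => β (src y)) N
  set P : X → ℝ := fun x => Real.log (ν.real (orbitPrefix T e N ⁻¹' {orbitPrefix T e N x})) with hP
  have hPint : ∀ {κ : Measure X} [IsProbabilityMeasure κ], Integrable P κ := fun {κ} _ =>
    integrable_comp_of_finite κ hprefix
      (fun y => Real.log (ν.real (orbitPrefix T e N ⁻¹' {y})))
  have hPL : ∀ {κ : Measure X} [IsProbabilityMeasure κ], MeasurePreserving T κ κ →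
      (∀ y, κ.real (e ⁻¹' {y}) = ν.real (e ⁻¹' {y})) → ∀ᵐ x ∂κ, |P x - L x| ≤ C := by
    intro κ _ hκ hk
    filter_upwards [H.ae_good hκ hk] with x hx
    rw [hP, hL]
    simp only [orbitPrefix_preimage]
    exact hβ _ _ _ (H.connects_of_good hx hN)
  have e1 : negEntropy ν (pathPrefix T e src N) = ∫ x, P x ∂ν :=
    negEntropy_congr ν fun x y => pathPrefix_eq_iff_of_pos hN
  have e2 : negEntropy μ (pathPrefix T e src N) = negEntropy μ (orbitPrefix T e N) :=
    negEntropy_congr μ fun x y => pathPrefix_eq_iff_of_pos hN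
  have i1 : ∫ x, P x ∂ν ≤ ∫ x, (L x + C) ∂ν := by
    refine integral_mono_ae hPint ((hLint H.mp).add (integrable_const C)) ?_
    filter_upwards [hPL H.mp fun _ => rfl] with x hx
    have := (abs_le.1 hx).2
    linarith
  have i2 : ∫ x, L x ∂μ ≤ ∫ x, (P x + C) ∂μ := by
    refine integral_mono_ae (hLint hμ) (hPint.add (integrable_const C)) ?_
    filter_upwards [hPL hμ hedge] with x hx
    have := (abs_le.1 hx).1
    linarith
  rw [integral_add (hLint H.mp) (integrable_const C)] at i1
  rw [integral_add hPint (integrable_const C)] at i2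
  rw [hLeq H.mp fun _ => rfl] at i1
  rw [hLeq hμ hedge] at i2
  simp only [integral_const, probReal_univ, one_smul] at i1 i2
  -- Absolute continuity: `μ`-almost every path uses only edges charged by `ν`, and all such paths
  -- are charged by `ν`.
  have i3 : ∫ x, P x ∂μ ≤ negEntropy μ (orbitPrefix T e N) := by
    refine integral_log_le_negEntropy ν μ hprefix fun y hy => ?_
    have hy' : μ (orbitPrefix T e N ⁻¹' {y}) ≠ 0 := fun h => hy (by simp [measureReal_def, h])
    obtain ⟨x, hx1, hx2⟩ := Set.not_subset.1 (fun hsub :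
      orbitPrefix T e N ⁻¹' {y} ⊆ {x | ¬ ∀ i, ν.real (e ⁻¹' {orbitWord T e x i}) ≠ 0} =>
        hy' (measure_mono_null hsub (H.ae_good hμ hedge)))
    obtain rfl : orbitPrefix T e N x = y := hx1
    rw [orbitPrefix_preimage]
    exact H.measureReal_wordEvent_ne_zero (H.connects_of_good (not_not.1 hx2) hN)
  linarith

/-- Chain rule: the logarithm of the product splits into one-edge terms. The first edge contributes
`h 1` and each transition `h 1 - h 0`. -/
lemma negEntropy_markov {μ : Measure X} [IsProbabilityMeasure μ]
    (hμ : MeasurePreserving T μ μ)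
    (hedge : ∀ y, μ.real (e ⁻¹' {y}) = ν.real (e ⁻¹' {y}))
    (hmarkov : ∀ n w, IsPath src tgt (n + 1) w → μ.real (wordEvent T e (n + 1) w) =
      ν.real (e ⁻¹' {w 0}) * ∏ i ∈ Finset.range n,
        (ν.real (e ⁻¹' {w (i + 1)}) / ν.real {x | src (e x) = src (w (i + 1))})) (n : ℕ) :
    negEntropy μ (pathPrefix T e src (n + 1)) = negEntropy ν (pathPrefix T e src 0) +
      (n + 1 : ℕ) * (negEntropy ν (pathPrefix T e src 1) - negEntropy ν (pathPrefix T e src 0)) := by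
  set q : E → ℝ := fun y => Real.log (ν.real (e ⁻¹' {y})) with hq
  set p : E → ℝ := fun y => Real.log (ν.real {x | src (e x) = src y}) with hp
  have h0 : negEntropy ν (pathPrefix T e src 0) = ∫ x, p (e x) ∂ν := by
    rw [negEntropy_congr (f' := fun x => src (e x)) ν fun x y => by simp [pathPrefix_eq_iff]]
    rfl
  have h1 : negEntropy ν (pathPrefix T e src 1) = ∫ x, q (e x) ∂ν := by
    rw [negEntropy_congr (f' := e) ν fun x y => by
      rw [pathPrefix_eq_iff_of_pos one_pos, orbitPrefix_eq_iff]
      simp [orbitWord]]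
    rfl
  have h2 : negEntropy μ (pathPrefix T e src (n + 1)) = ∫ x, (q (orbitWord T e x 0) +
      ∑ i ∈ Finset.range n, (q (orbitWord T e x (i + 1)) - p (orbitWord T e x (i + 1)))) ∂μ := by
    rw [negEntropy_congr (f' := orbitPrefix T e (n + 1)) μ fun x y =>
      pathPrefix_eq_iff_of_pos (Nat.succ_pos n)]
    refine integral_congr_ae ?_
    filter_upwards [H.ae_good hμ hedge] with x hx
    have hp0 : ∀ i, ν.real {z | src (e z) = src (orbitWord T e x i)} ≠ 0 := by
      intro i h
      refine hx i (measureReal_mono_null ?_ h)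
      intro z hz
      exact congrArg src hz
    rw [orbitPrefix_preimage, hmarkov n _ (isPath_orbitWord H.tgt_eq _ _), Real.log_mul (hx 0)
      (Finset.prod_ne_zero_iff.2 fun i _ => div_ne_zero (hx _) (hp0 _)),
      Real.log_prod fun i _ => div_ne_zero (hx _) (hp0 _)]
    congr 1
    exact Finset.sum_congr rfl fun i _ => Real.log_div (hx _) (hp0 _)
  rw [h2, h0, h1, integral_add, integral_finsetSum, integral_orbitWord hμ H.meas hedge]
  · have : ∀ i, ∫ x, (q (orbitWord T e x (i + 1)) - p (orbitWord T e x (i + 1))) ∂μ =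
        ∫ x, q (e x) ∂ν - ∫ x, p (e x) ∂ν := by
      intro i
      rw [integral_sub (integrable_orbitWord hμ H.meas q _) (integrable_orbitWord hμ H.meas p _),
        integral_orbitWord hμ H.meas hedge, integral_orbitWord hμ H.meas hedge]
    simp only [this, Finset.sum_const, Finset.card_range, nsmul_eq_mul]
    push_cast
    ring
  · exact fun i _ => (integrable_orbitWord hμ H.meas q _).sub (integrable_orbitWord hμ H.meas p _)
  · exact integrable_orbitWord hμ H.meas q 0
  · exact integrable_finsetSum _ fun i _ =>
      (integrable_orbitWord hμ H.meas q _).sub (integrable_orbitWord hμ H.meas p _)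

/-- A stationary process on the edges of a finite graph with nearest-neighbour Gibbs conditional
distributions is the stationary Markov process with the same edge distribution. -/
theorem eq_markov {μ : Measure X} [IsProbabilityMeasure μ]
    (hμ : MeasurePreserving T μ μ)
    (hedge : ∀ y, μ.real (e ⁻¹' {y}) = ν.real (e ⁻¹' {y}))
    (hmarkov : ∀ n w, IsPath src tgt (n + 1) w → μ.real (wordEvent T e (n + 1) w) =
      ν.real (e ⁻¹' {w 0}) * ∏ i ∈ Finset.range n,
        (ν.real (e ⁻¹' {w (i + 1)}) / ν.real {x | src (e x) = src (w (i + 1))})) (n : ℕ)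
    (w : ℕ → E) (hw : IsPath src tgt (n + 1) w) :
    ν.real (wordEvent T e (n + 1) w) = μ.real (wordEvent T e (n + 1) w) := by
  obtain ⟨N, hN0, hN⟩ := exists_reach_periodic src tgt (fun y => ν.real (e ⁻¹' {y}) ≠ 0)
  obtain ⟨C, hC⟩ := H.exists_log_bound hN
  -- Along the multiples of `N`, the block entropies of `ν` lie below those of `μ`, which form the
  -- tangent, up to `2 * C`.
  have heq := affine_of_convex_of_le (h := fun n => negEntropy ν (pathPrefix T e src n))
    (C := 2 * C) hN0 H.negEntropy_convex fun j hj => by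
      obtain ⟨β, hβ⟩ := hC j hj
      have hpos : 0 < N * j := Nat.mul_pos hN0 hj
      have h1 := H.negEntropy_le hμ hedge hpos β hβ
      obtain ⟨m, hm⟩ : ∃ m, N * j = m + 1 := ⟨N * j - 1, by omega⟩
      rw [hm] at h1 ⊢
      rw [H.negEntropy_markov hμ hedge hmarkov m] at h1
      exact h1
  induction n with
  | zero =>
    have h1 := hmarkov 0 w hw
    rw [h1]
    simp only [Finset.range_zero, Finset.prod_empty, mul_one]
    congr 1
    ext x
    simp [wordEvent, orbitWord]
  | succ n ih =>
    have h1 := H.markov_step heq n hw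
    have h2 := hmarkov (n + 1) w hw
    have hw' : IsPath src tgt (n + 1) w := fun i hi => hw i (by omega)
    rw [Finset.prod_range_succ, ← mul_assoc, ← hmarkov n w hw', ← ih hw'] at h2
    rw [h2]
    -- For a vertex of probability zero the transition is `0` by division by zero, and the path is
    -- not charged either.
    by_cases h0 : ν.real {x | src (e x) = src (w (n + 1))} = 0
    · rw [h0, div_zero, mul_zero]
      have h3 : ν.real (T^[n + 1] ⁻¹' {x | src (e x) = src (w (n + 1))}) = 0 := by
        rw [(H.mp.iterate (n + 1)).measureReal_preimage]
        · exact h0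
        · exact (((measurable_of_finite src).comp H.meas)
            (MeasurableSet.of_discrete (s := {src (w (n + 1))}))).nullMeasurableSet
      refine measureReal_mono_null ?_ h3
      intro x hx
      exact congrArg src (hx (n + 1) (by omega))
    · rw [← mul_div_assoc, eq_div_iff h0]
      exact h1

end IsPathGibbs

end PathProcess

section

/-! ### Existence and uniqueness of the Markov extension -/

/-- The configurations that agree with `η` on `J`. -/
def cylinderAt {ι Ω : Type*} (J : Finset ι) (η : ι → Ω) : Set (ι → Ω) := {ξ | ∀ i ∈ J, ξ i = η i}

section Cylinder

variable {ι Ω : Type*} [MeasurableSpace Ω] [DiscreteMeasurableSpace Ω]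

lemma measurableSet_cylinderAt (J : Finset ι) (η : ι → Ω) : MeasurableSet (cylinderAt J η) := by
  have : cylinderAt J η = ⋂ i ∈ J, (fun ξ => ξ i) ⁻¹' {η i} := by ext; simp [cylinderAt]
  rw [this]
  exact Finset.measurableSet_biInter _ fun i _ => measurable_pi_apply i MeasurableSet.of_discrete

/-- Marginals on a finite set are determined by singletons and project to smaller sets, so a cofinal
family suffices; uniqueness of projective limits concludes. -/
lemma ext_of_cylinderAt [Finite Ω] {μ ν : Measure (ι → Ω)} [IsFiniteMeasure μ]
    [IsFiniteMeasure ν]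
    (h : ∀ J : Finset ι, ∃ J', J ⊆ J' ∧ ∀ η, μ (cylinderAt J' η) = ν (cylinderAt J' η)) :
    μ = ν := by
  have hJ : ∀ J : Finset ι,
      μ.map (J.restrict (π := fun _ => Ω)) = ν.map (J.restrict (π := fun _ => Ω)) := by
    intro J
    obtain ⟨J', hJJ', hcyl⟩ := h J
    have h1 :
        μ.map (J'.restrict (π := fun _ => Ω)) = ν.map (J'.restrict (π := fun _ => Ω)) := by
      refine Measure.ext_of_singleton fun y => ?_
      rw [Measure.map_apply J'.measurable_restrict MeasurableSet.of_discrete,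
        Measure.map_apply J'.measurable_restrict MeasurableSet.of_discrete]
      by_cases hy : ∃ η : ι → Ω, J'.restrict η = y
      · obtain ⟨η, rfl⟩ := hy
        convert hcyl η using 2 <;>
        · ext ξ
          simp [cylinderAt, funext_iff]
      · have : J'.restrict (π := fun _ => Ω) ⁻¹' {y} = (∅ : Set (ι → Ω)) := by
          ext η
          simp only [Set.mem_preimage, Set.mem_singleton_iff, Set.mem_empty_iff_false, iff_false]
          exact fun h => hy ⟨η, h⟩
        rw [this, measure_empty, measure_empty]
    have h2 := congrArg (Measure.map (Finset.restrict₂ (π := fun _ => Ω) hJJ')) h1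
    rwa [Measure.map_map (Finset.measurable_restrict₂ _) (Finset.measurable_restrict _),
      Measure.map_map (Finset.measurable_restrict₂ _) (Finset.measurable_restrict _),
      Finset.restrict₂_comp_restrict] at h2
  have hμ : IsProjectiveLimit (α := fun _ : ι => Ω) μ
      fun J => ν.map (J.restrict (π := fun _ => Ω)) := hJ
  exact hμ.unique fun J => rfl

end Cylinder

variable {Ω : Type*} {k : ℕ}

lemma init_window_succ (η : ℤ → Ω) (a : ℤ) :
    Fin.init (window k η (a + 1)) = Fin.tail (window k η a) := by
  ext j
  simp only [Fin.init, Fin.tail, window, Fin.val_castSucc, Fin.val_succ]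
  congr 1
  push_cast
  ring

lemma window_congr {η ξ : ℤ → Ω} {a : ℤ} (h : ∀ i ∈ Finset.Icc a (a + k), ξ i = η i) :
    window k ξ a = window k η a := by
  ext j
  refine h _ ?_
  rw [Finset.mem_Icc]
  have := j.is_lt
  constructor <;> omega

lemma init_window_congr {η ξ : ℤ → Ω} {a : ℤ} (h : ∀ i ∈ Finset.Ico a (a + k), ξ i = η i) :
    Fin.init (window k ξ a) = Fin.init (window k η a) := by
  ext j
  refine h _ ?_
  rw [Finset.mem_Ico]
  have := j.is_lt
  simp only [Fin.val_castSucc]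
  constructor <;> omega

lemma window_shift (η : ℤ → Ω) (t a : ℤ) : window k (shift t η) a = window k η (a + t) := by
  ext j
  simp only [window, shift]
  congr 1
  ring

variable [MeasurableSpace Ω]

/-- The probability of the configuration `η` on `{a, …, a + k + n}` under the Markov extension. -/
def chainWeight (m : Measure (Fin (k + 1) → Ω)) (n : ℕ) (η : ℤ → Ω) (a : ℤ) : ℝ≥0∞ :=
  m {window k η a} * ∏ i ∈ Finset.range n, condLast m (window k η (a + i + 1))

lemma chainWeight_succ (m : Measure (Fin (k + 1) → Ω)) (n : ℕ) (η : ℤ → Ω) (a : ℤ) :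
    chainWeight m (n + 1) η a = chainWeight m n η a * condLast m (window k η (a + n + 1)) := by
  rw [chainWeight, chainWeight, Finset.prod_range_succ, mul_assoc]

lemma chainWeight_shift (m : Measure (Fin (k + 1) → Ω)) (n : ℕ) (η : ℤ → Ω) (a t : ℤ) :
    chainWeight m n (shift t η) a = chainWeight m n η (a + t) := by
  unfold chainWeight
  simp only [window_shift]
  congr 1
  refine Finset.prod_congr rfl fun i _ => ?_
  congr 2
  ring

lemma IsMarkovExtension.measure_cylinderAt {m : Measure (Fin (k + 1) → Ω)} {μ : Measure (ℤ → Ω)}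
    (h : IsMarkovExtension m μ) (a : ℤ) (n : ℕ) (η : ℤ → Ω) :
    μ (cylinderAt (Finset.Icc a (a + k + n)) η) = chainWeight m n η a :=
  h.apply_cylinder a n η

lemma exists_interval_supset (k : ℕ) (J : Finset ℤ) :
    ∃ (a : ℤ) (n : ℕ), J ⊆ Finset.Icc a (a + k + n) := by
  obtain ⟨b, hb⟩ := (J.image fun i => i.natAbs).bddAbove
  refine ⟨-b, 2 * b, fun i hi => ?_⟩
  have := hb (Finset.mem_coe.2 (Finset.mem_image_of_mem (fun i : ℤ => i.natAbs) hi))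
  rw [Finset.mem_Icc]
  omega

variable [Fintype Ω] [DiscreteMeasurableSpace Ω]

lemma ext_of_interval {μ ν : Measure (ℤ → Ω)} [IsFiniteMeasure μ] [IsFiniteMeasure ν]
    (h : ∀ (a : ℤ) (n : ℕ) (η : ℤ → Ω), μ (cylinderAt (Finset.Icc a (a + k + n)) η) =
      ν (cylinderAt (Finset.Icc a (a + k + n)) η)) : μ = ν :=
  ext_of_cylinderAt fun J => by
    obtain ⟨a, n, hJ⟩ := exists_interval_supset k J
    exact ⟨_, hJ, h a n⟩

lemma IsMarkovExtension.unique {m : Measure (Fin (k + 1) → Ω)} {μ ν : Measure (ℤ → Ω)}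
    (hμ : IsMarkovExtension m μ) (hν : IsMarkovExtension m ν) : μ = ν := by
  have := hμ.isProbabilityMeasure
  have := hν.isProbabilityMeasure
  exact ext_of_interval fun a n η => by rw [hμ.measure_cylinderAt, hν.measure_cylinderAt]

/-- LTI for the sites `{0, …, k - 1}` and the translation by one. The construction of the extension
uses LTI only in this form. -/
lemma IsLTI.measure_tail {m : Measure (Fin (k + 1) → Ω)} (h : IsLTI m) (z : Fin k → Ω) :
    m {ξ | Fin.tail ξ = z} = m {ξ | Fin.init ξ = z} := by
  classical
  set A : Finset (Fin (k + 1)) := Finset.univ.image Fin.castSucc with hA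
  have hmem : ∀ j : Fin k, j.castSucc ∈ A := fun j => Finset.mem_image_of_mem _ (Finset.mem_univ j)
  have hlt : ∀ i : A, (i : Fin (k + 1)).val < k := by
    rintro ⟨i, hi⟩
    obtain ⟨j, -, rfl⟩ := Finset.mem_image.1 hi
    exact j.is_lt
  have key := h A 1 (fun i => ⟨(i : Fin (k + 1)).val + 1, by have := hlt i; omega⟩) fun i => rfl
  have key2 := congrArg (fun κ => κ {η : A → Ω | ∀ j : Fin k, η ⟨j.castSucc, hmem j⟩ = z j}) key
  rw [Measure.map_apply (by fun_prop) MeasurableSet.of_discrete,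
    Measure.map_apply (by fun_prop) MeasurableSet.of_discrete] at key2
  convert key2 using 2
  · ext ξ
    simp only [Set.mem_ofPred_eq, Set.mem_preimage, funext_iff]
    rfl
  · ext ξ
    simp only [Set.mem_ofPred_eq, Set.mem_preimage, funext_iff]
    rfl

lemma sum_measure_snoc (m : Measure (Fin (k + 1) → Ω)) (z : Fin k → Ω) :
    ∑ x, m {(Fin.snoc z x : Fin (k + 1) → Ω)} = m {ξ | Fin.init ξ = z} := by
  rw [← measure_biUnion_finset (s := Finset.univ)
    (f := fun x => {(Fin.snoc z x : Fin (k + 1) → Ω)})]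
  · congr 1
    ext ξ
    simp only [Finset.mem_univ, Set.iUnion_true, Set.mem_iUnion, Set.mem_singleton_iff,
      Set.mem_ofPred_eq]
    constructor
    · rintro ⟨x, rfl⟩
      exact Fin.init_snoc (α := fun _ => Ω) x z
    · rintro rfl
      exact ⟨ξ (Fin.last k), (Fin.snoc_init_self (α := fun _ => Ω) ξ).symm⟩
  · intro x _ y _ hxy
    simp only [Function.onFun, Set.disjoint_singleton]
    intro h
    have := congrFun h (Fin.last k)
    simp only [Fin.snoc_last] at this
    exact hxy this
  · exact fun _ _ => MeasurableSet.of_discrete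

lemma sum_measure_cons (m : Measure (Fin (k + 1) → Ω)) (z : Fin k → Ω) :
    ∑ x, m {(Fin.cons x z : Fin (k + 1) → Ω)} = m {ξ | Fin.tail ξ = z} := by
  rw [← measure_biUnion_finset (s := Finset.univ)
    (f := fun x => {(Fin.cons x z : Fin (k + 1) → Ω)})]
  · congr 1
    ext ξ
    simp only [Finset.mem_univ, Set.iUnion_true, Set.mem_iUnion, Set.mem_singleton_iff,
      Set.mem_ofPred_eq]
    constructor
    · rintro ⟨x, rfl⟩
      exact Fin.tail_cons (α := fun _ => Ω) x z
    · rintro rfl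
      exact ⟨ξ 0, (Fin.cons_self_tail (α := fun _ => Ω) ξ).symm⟩
  · intro x _ y _ hxy
    simp only [Function.onFun, Set.disjoint_singleton]
    intro h
    have := congrFun h 0
    simp only [Fin.cons_zero] at this
    exact hxy this
  · exact fun _ _ => MeasurableSet.of_discrete

lemma measure_init_ne_zero_of_condLast {m : Measure (Fin (k + 1) → Ω)} {ζ : Fin (k + 1) → Ω}
    (h : m {ζ} ≠ 0) : m {η | Fin.init η = Fin.init ζ} ≠ 0 := fun h0 =>
  h (measure_mono_null (by rintro _ rfl; rfl) h0)

lemma measure_singleton_of_condLast {m : Measure (Fin (k + 1) → Ω)} {ζ : Fin (k + 1) → Ω}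
    (h : condLast m ζ ≠ 0) : m {ζ} ≠ 0 := fun h0 => h (by rw [condLast, h0, ENNReal.zero_div])

lemma measure_mul_condLast (m : Measure (Fin (k + 1) → Ω)) [IsFiniteMeasure m]
    (ζ : Fin (k + 1) → Ω) : m {η | Fin.init η = Fin.init ζ} * condLast m ζ = m {ζ} := by
  by_cases h0 : m {η | Fin.init η = Fin.init ζ} = 0
  · rw [h0, zero_mul]
    by_contra h
    exact measure_init_ne_zero_of_condLast (Ne.symm h) h0
  · exact ENNReal.mul_div_cancel h0 (measure_ne_top _ _)

/-- The last window has positive mass, hence so does its tail; by LTI this is the mass of the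
condition for the next letter. So along charged words `condLast` is never the default value. -/
lemma IsLTI.measure_init_ne_zero {m : Measure (Fin (k + 1) → Ω)} (h : IsLTI m) {n : ℕ}
    {η : ℤ → Ω} {a : ℤ} (h0 : chainWeight m n η a ≠ 0) :
    m {ξ | Fin.init ξ = Fin.init (window k η (a + n + 1))} ≠ 0 := by
  have h1 : m {window k η (a + n)} ≠ 0 := by
    cases n with
    | zero =>
      have := left_ne_zero_of_mul h0
      simpa using this
    | succ n =>
      rw [chainWeight_succ] at h0
      have := measure_singleton_of_condLast (right_ne_zero_of_mul h0)
      push_cast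
      rwa [← add_assoc]
  rw [init_window_succ, ← h.measure_tail]
  exact fun h2 => h1 (measure_mono_null (by rintro _ rfl; rfl) h2)

/-- Summation of the chain weight over the first letter. -/
lemma IsLTI.sum_chainWeight {m : Measure (Fin (k + 1) → Ω)} [IsFiniteMeasure m] (h : IsLTI m)
    (n : ℕ) (η : ℤ → Ω) (a : ℤ) :
    ∑ x, chainWeight m (n + 1) (Function.update η a x) a = chainWeight m n η (a + 1) := by
  have hw : ∀ (x : Ω) (b : ℤ), a < b → window k (Function.update η a x) b = window k η b :=
    fun x b hb => window_congr fun i hi => by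
      rw [Finset.mem_Icc] at hi
      exact Function.update_of_ne (by omega) _ _
  have hcons : ∀ x, window k (Function.update η a x) a = Fin.cons x (Fin.tail (window k η a)) := by
    intro x
    ext j
    refine Fin.cases ?_ (fun j => ?_) j
    · simp [window]
    · simp only [Fin.cons_succ, Fin.tail, window, Fin.val_succ]
      exact Function.update_of_ne (by push_cast; omega) _ _
  have hprod : ∀ x, chainWeight m (n + 1) (Function.update η a x) a =
      m {(Fin.cons x (Fin.tail (window k η a)) : Fin (k + 1) → Ω)} *
        (condLast m (window k η (a + 1)) *
        ∏ i ∈ Finset.range n, condLast m (window k η (a + 1 + i + 1))) := by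
    intro x
    unfold chainWeight
    rw [hcons, Finset.prod_range_succ', mul_comm (∏ _ ∈ _, _)]
    congr 2
    · rw [hw x _ (by push_cast; omega)]
      simp
    · refine Finset.prod_congr rfl fun i _ => ?_
      rw [hw x _ (by push_cast; omega)]
      congr 2
      push_cast
      ring
  simp only [hprod]
  -- The sum over the first letter leaves the mass of the tail; LTI turns it into the mass of the
  -- initial part of the next window, and the first transition completes it to the mass of that
  -- window.
  rw [← Finset.sum_mul, sum_measure_cons, h.measure_tail, ← init_window_succ, ← mul_assoc,
    measure_mul_condLast]
  rfl

end

/-! ### Construction of the Markov extension and its invariance -/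

section

variable {Ω : Type*} {k : ℕ} [Fintype Ω] [MeasurableSpace Ω] [DiscreteMeasurableSpace Ω]

lemma measurable_window (a : ℤ) : Measurable fun η : ℤ → Ω => window k η a :=
  measurable_pi_lambda _ fun _ => measurable_pi_apply _

lemma measurable_shift (t : ℤ) : Measurable (shift t : (ℤ → Ω) → ℤ → Ω) :=
  measurable_pi_lambda _ fun _ => measurable_pi_apply _

open Classical in
/-- The transition probability to `x` after the first `k` letters of `ζ`, completed by the point
mass at `x₀` where the conditional probability is not defined. -/
def transition (m : Measure (Fin (k + 1) → Ω)) (x₀ x : Ω) (ζ : Fin (k + 1) → Ω) : ℝ≥0∞ :=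
  if m {η | Fin.init η = Fin.init ζ} = 0 then (if x = x₀ then 1 else 0)
  else condLast m (Fin.snoc (α := fun _ => Ω) (Fin.init ζ) x)

lemma sum_transition (m : Measure (Fin (k + 1) → Ω)) [IsFiniteMeasure m] (x₀ : Ω)
    (ζ : Fin (k + 1) → Ω) : ∑ x, transition m x₀ x ζ = 1 := by
  unfold transition
  split_ifs with h
  · rw [Finset.sum_eq_single x₀ (fun x _ hx => if_neg hx)
      fun h => absurd (Finset.mem_univ _) h, if_pos rfl]
  · simp only [condLast, Fin.init_snoc, div_eq_mul_inv]
    rw [← Finset.sum_mul, sum_measure_snoc]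
    exact ENNReal.mul_inv_cancel h (measure_ne_top _ _)

/-- Prolongation of a measure with prescribed cylinder probabilities by one letter. -/
lemma exists_prolongation {m : Measure (Fin (k + 1) → Ω)} [IsFiniteMeasure m] (hm : IsLTI m)
    {n : ℕ} {ρ : Measure (ℤ → Ω)} [IsProbabilityMeasure ρ]
    (hρ : ∀ n' ≤ n, ∀ η, ρ (cylinderAt (Finset.Icc 0 (0 + k + n')) η) = chainWeight m n' η 0) :
    ∃ ρ' : Measure (ℤ → Ω), IsProbabilityMeasure ρ' ∧
      ∀ n' ≤ n + 1, ∀ η, ρ' (cylinderAt (Finset.Icc 0 (0 + k + n')) η) = chainWeight m n' η 0 := by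
  classical
  obtain ⟨η₀⟩ : Nonempty (ℤ → Ω) := nonempty_of_isProbabilityMeasure ρ
  set x₀ := η₀ 0
  set b : ℤ := 0 + n + 1 with hb
  have hc : ∀ x, Measurable fun η : ℤ → Ω => transition m x₀ x (window k η b) := fun x =>
    (measurable_of_finite (transition m x₀ x)).comp (measurable_window b)
  have hu : ∀ x, Measurable fun η : ℤ → Ω => Function.update η (b + k) x := fun x =>
    measurable_update_left
  -- The letter at site `b + k = n + k + 1` is redrawn from the transition given the `k` letters
  -- before it.
  set ρ' : Measure (ℤ → Ω) := ∑ x, (ρ.withDensity fun η => transition m x₀ x (window k η b)).map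
    fun η => Function.update η (b + k) x with hρ'
  have happ : ∀ s, MeasurableSet s → ρ' s =
      ∑ x, ∫⁻ η in (fun η => Function.update η (b + k) x) ⁻¹' s,
        transition m x₀ x (window k η b) ∂ρ := by
    intro s hs
    rw [hρ', Measure.finsetSum_apply]
    refine Finset.sum_congr rfl fun x _ => ?_
    rw [Measure.map_apply (hu x) hs, withDensity_apply _ (hu x hs)]
  -- Transitions sum to one, so events that do not involve the redrawn site keep their probability.
  have hinv : ∀ s, MeasurableSet s →
      (∀ x, (fun η => Function.update η (b + k) x) ⁻¹' s = s) → ρ' s = ρ s := by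
    intro s hs hsx
    rw [happ s hs]
    simp only [hsx]
    rw [← lintegral_finsetSum _ fun x _ => hc x]
    simp [sum_transition]
  refine ⟨ρ', ⟨by rw [hinv _ MeasurableSet.univ fun x => Set.preimage_univ, measure_univ]⟩,
    fun n' hn' η => ?_⟩
  rcases Nat.lt_or_ge n n' with hlt | hle
  · obtain rfl : n' = n + 1 := by omega
    have hset : ∀ x, (fun η => Function.update η (b + k) x) ⁻¹'
        cylinderAt (Finset.Icc 0 (0 + k + ((n + 1 : ℕ) : ℤ))) η =
        if x = η (b + k) then cylinderAt (Finset.Icc 0 (0 + k + (n : ℤ))) η else ∅ := by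
      intro x
      ext ξ
      split_ifs with hx
      · constructor
        · intro h i hi
          rw [Finset.mem_Icc] at hi
          have : Function.update ξ (b + k) x i = η i :=
            h i (by rw [Finset.mem_Icc]; push_cast; omega)
          rwa [Function.update_of_ne (by omega)] at this
        · intro h i hi
          rw [Finset.mem_Icc] at hi
          push_cast at hi
          by_cases hib : i = b + k
          · subst hib
            simp [hx]
          · change Function.update ξ (b + k) x i = η i
            rw [Function.update_of_ne hib]
            exact h i (by rw [Finset.mem_Icc]; omega)
      · simp only [Set.mem_empty_iff_false, iff_false]
        intro h
        have := h (b + k) (by rw [Finset.mem_Icc]; push_cast; omega)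
        exact hx (by simpa using this)
    rw [happ _ (measurableSet_cylinderAt _ _), Finset.sum_eq_single (η (b + k))]
    · rw [hset, if_pos rfl, chainWeight_succ, ← hρ n le_rfl η]
      have hconst : ∀ ξ ∈ cylinderAt (Finset.Icc 0 (0 + k + (n : ℤ))) η,
          transition m x₀ (η (b + k)) (window k ξ b) =
            transition m x₀ (η (b + k)) (window k η b) := by
        intro ξ hξ
        have : Fin.init (window k ξ b) = Fin.init (window k η b) :=
          init_window_congr fun i hi => hξ i (by
            rw [Finset.mem_Ico] at hi; rw [Finset.mem_Icc]; omega)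
        unfold transition
        rw [this]
      rw [setLIntegral_congr_fun (measurableSet_cylinderAt _ _) hconst, setLIntegral_const,
        mul_comm]
      -- The completed transition is the true one on charged cylinders; on the others both sides
      -- vanish.
      by_cases h0 : ρ (cylinderAt (Finset.Icc 0 (0 + k + (n : ℤ))) η) = 0
      · rw [h0, zero_mul, zero_mul]
      · rw [hρ n le_rfl η] at h0
        have hw : Fin.snoc (α := fun _ => Ω) (Fin.init (window k η b)) (η (b + k)) =
            window k η b := by
          have h1 : η (b + k) = window k η b (Fin.last k) := by simp [window]
          rw [h1]
          exact Fin.snoc_init_self (α := fun _ => Ω) _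
        rw [transition, if_neg (hm.measure_init_ne_zero h0), hw]
    · intro x _ hx
      rw [hset, if_neg hx, Measure.restrict_empty, lintegral_zero_measure]
    · exact fun h => absurd (Finset.mem_univ _) h
  · rw [hinv _ (measurableSet_cylinderAt _ _), hρ n' hle η]
    intro x
    ext ξ
    refine forall₂_congr fun i hi => ?_
    rw [Finset.mem_Icc] at hi
    change Function.update ξ (b + k) x i = η i ↔ _
    rw [Function.update_of_ne (by omega)]

lemma exists_chain_right {m : Measure (Fin (k + 1) → Ω)} [IsProbabilityMeasure m] (hm : IsLTI m)
    (n : ℕ) : ∃ ρ : Measure (ℤ → Ω), IsProbabilityMeasure ρ ∧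
      ∀ n' ≤ n, ∀ η, ρ (cylinderAt (Finset.Icc 0 (0 + k + n')) η) = chainWeight m n' η 0 := by
  induction n with
  | zero =>
    -- The index is clamped to `{0, …, k}`; letters at the other sites are immaterial.
    set g : (Fin (k + 1) → Ω) → ℤ → Ω := fun ζ i => ζ ⟨min i.toNat k, by omega⟩ with hg
    have hgm : Measurable g := measurable_of_finite g
    refine ⟨m.map g, Measure.isProbabilityMeasure_map hgm.aemeasurable, fun n' hn' η => ?_⟩
    obtain rfl : n' = 0 := by omega
    rw [Measure.map_apply hgm (measurableSet_cylinderAt _ _), chainWeight, Finset.range_zero,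
      Finset.prod_empty, mul_one]
    congr 1
    ext ζ
    simp only [Set.mem_preimage, cylinderAt, Set.mem_ofPred_eq, Set.mem_singleton_iff, hg,
      Finset.mem_Icc]
    constructor
    · intro h
      ext j
      have hj := j.is_lt
      have h1 := h j (by push_cast; omega)
      rw [window, zero_add, ← h1]
      congr 1
      ext
      simp only [Int.toNat_natCast]
      omega
    · rintro rfl i hi
      simp only [window]
      congr 1
      push_cast at hi ⊢
      omega
  | succ n ih =>
    obtain ⟨ρ, hρ, h⟩ := ih
    exact exists_prolongation hm h

lemma sum_cylinderAt_update (ρ : Measure (ℤ → Ω)) (a : ℤ) (n : ℕ) (η : ℤ → Ω) :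
    ∑ x, ρ (cylinderAt (Finset.Icc a (a + k + ((n + 1 : ℕ) : ℤ))) (Function.update η a x)) =
      ρ (cylinderAt (Finset.Icc (a + 1) (a + 1 + k + n)) η) := by
  rw [← measure_biUnion_finset]
  · congr 1
    ext ξ
    simp only [Finset.mem_univ, Set.iUnion_true, Set.mem_iUnion]
    constructor
    · rintro ⟨x, hx⟩ i hi
      rw [Finset.mem_Icc] at hi
      rw [hx i (by rw [Finset.mem_Icc]; push_cast; omega), Function.update_of_ne (by omega)]
    · intro h
      refine ⟨ξ a, fun i hi => ?_⟩
      by_cases hia : i = a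
      · subst hia; simp
      · rw [Function.update_of_ne hia]
        rw [Finset.mem_Icc] at hi
        push_cast at hi
        exact h i (by rw [Finset.mem_Icc]; omega)
  · intro x _ y _ hxy
    refine Set.disjoint_left.2 fun ξ h1 h2 => hxy ?_
    have ha : a ∈ Finset.Icc a (a + k + ((n + 1 : ℕ) : ℤ)) := by
      rw [Finset.mem_Icc]; push_cast; omega
    have e1 := h1 a ha
    have e2 := h2 a ha
    rw [Function.update_self] at e1 e2
    exact e1.symm.trans e2
  · exact fun _ _ => measurableSet_cylinderAt _ _

/-- Advancing the left end by one sums out a letter, for the cylinders as for the chain weights.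
Each advance uses up one letter of the available range, hence `a + n ≤ L`. -/
lemma chain_left {m : Measure (Fin (k + 1) → Ω)} [IsFiniteMeasure m] (hm : IsLTI m) {L : ℕ}
    {ρ : Measure (ℤ → Ω)}
    (hρ : ∀ n ≤ L, ∀ η, ρ (cylinderAt (Finset.Icc 0 (0 + k + n)) η) = chainWeight m n η 0)
    (a : ℕ) : ∀ (n : ℕ) (η : ℤ → Ω), a + n ≤ L →
      ρ (cylinderAt (Finset.Icc a (a + k + n)) η) = chainWeight m n η a := by
  induction a with
  | zero =>
    intro n η hn
    exact hρ n (by omega) η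
  | succ a ih =>
    intro n η hn
    have h1 := sum_cylinderAt_update (k := k) ρ a n η
    push_cast at h1 ⊢
    rw [← h1, ← hm.sum_chainWeight]
    refine Finset.sum_congr rfl fun x _ => ?_
    have := ih (n + 1) (Function.update η a x) (by omega)
    push_cast at this
    exact this

lemma exists_chain {m : Measure (Fin (k + 1) → Ω)} [IsProbabilityMeasure m] (hm : IsLTI m)
    (N : ℕ) : ∃ ρ : Measure (ℤ → Ω), IsProbabilityMeasure ρ ∧
      ∀ (a : ℤ) (n : ℕ) (η : ℤ → Ω), -(N : ℤ) ≤ a → a + n ≤ N →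
        ρ (cylinderAt (Finset.Icc a (a + k + n)) η) = chainWeight m n η a := by
  obtain ⟨ρ, hρ, h⟩ := exists_chain_right hm (2 * N)
  refine ⟨ρ.map (shift N), Measure.isProbabilityMeasure_map (measurable_shift _).aemeasurable,
    fun a n η ha hn => ?_⟩
  obtain ⟨b, hb⟩ : ∃ b : ℕ, a + N = b := ⟨(a + N).toNat, by omega⟩
  rw [Measure.map_apply (measurable_shift _) (measurableSet_cylinderAt _ _)]
  have h1 := chain_left hm h b n (shift (-N) η) (by omega)
  rw [chainWeight_shift, show (b : ℤ) + -N = a by omega] at h1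
  rw [← h1]
  congr 1
  ext ξ
  simp only [cylinderAt, shift, Set.mem_preimage, Set.mem_ofPred_eq, Finset.mem_Icc]
  constructor
  · intro h i hi
    have := h (i + -N) (by omega)
    rwa [neg_add_cancel_right] at this
  · intro h i hi
    have := h (i + N) (by omega)
    rwa [add_neg_cancel_right] at this

/-- Probability measures on the compact space `ℤ → Ω` form a compact space, so the measures of
`exists_chain` have a limit along an ultrafilter. Cylinders are clopen, so their probabilities
converge, and each is eventually constant. -/
lemma exists_isMarkovExtension {m : Measure (Fin (k + 1) → Ω)} [IsProbabilityMeasure m]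
    (hm : IsLTI m) : ∃ μ : Measure (ℤ → Ω), IsMarkovExtension m μ := by
  choose ρ hρ h using fun N => exists_chain hm N
  let _ : TopologicalSpace Ω := ⊥
  have : DiscreteTopology Ω := ⟨rfl⟩
  have : BorelSpace Ω := ⟨by
    rw [borel_eq_top_of_discrete]
    exact eq_top_iff.2 fun s _ => MeasurableSet.of_discrete⟩
  set u : ℕ → ProbabilityMeasure (ℤ → Ω) := fun N => ⟨ρ N, hρ N⟩
  obtain ⟨μ, -, hμ⟩ := isCompact_univ.ultrafilter_le_nhds
    ((Filter.hyperfilter ℕ).map u) (by simp)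
  have hμ' : Filter.Tendsto u (Filter.hyperfilter ℕ) (nhds μ) := hμ
  refine ⟨μ, inferInstance, fun a n η => ?_⟩
  have hclopen : IsClopen (cylinderAt (Finset.Icc a (a + k + n)) η) := by
    have : cylinderAt (Finset.Icc a (a + k + n)) η =
        ⋂ i ∈ Finset.Icc a (a + k + n), (fun ξ : ℤ → Ω => ξ i) ⁻¹' {η i} := by
      ext; simp [cylinderAt]
    rw [this]
    exact isClopen_biInter_finset fun i _ => (isClopen_discrete _).preimage (continuous_apply i)
  have hlim := ProbabilityMeasure.tendsto_measure_of_null_frontier_of_tendsto' hμ'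
    (E := cylinderAt (Finset.Icc a (a + k + n)) η) (by simp [hclopen.frontier_eq])
  refine tendsto_nhds_unique hlim (tendsto_const_nhds.congr' ?_)
  refine Nat.hyperfilter_le_atTop ?_
  filter_upwards [Filter.eventually_ge_atTop (a.natAbs + (a + n).natAbs)] with N hN
  exact (h N a n η (by omega) (by omega)).symm

/-- The Markov extension is translation invariant. -/
lemma IsMarkovExtension.isTranslationInvariant {m : Measure (Fin (k + 1) → Ω)}
    {μ : Measure (ℤ → Ω)} (h : IsMarkovExtension m μ) : IsTranslationInvariant μ := by
  intro t
  have := h.isProbabilityMeasure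
  -- The translated measure has the same cylinder probabilities, hence is again a Markov extension.
  refine IsMarkovExtension.unique (m := m) ⟨Measure.isProbabilityMeasure_map
    (measurable_shift _).aemeasurable, fun a n η => ?_⟩ h
  have h1 := h.measure_cylinderAt (a + t) n (shift (-t) η)
  rw [chainWeight_shift, add_neg_cancel_right] at h1
  refine Eq.trans ?_ h1
  change (μ.map (shift t)) (cylinderAt (Finset.Icc a (a + k + n)) η) = _
  rw [Measure.map_apply (measurable_shift _) (measurableSet_cylinderAt _ η)]
  congr 1
  ext ξ
  simp only [cylinderAt, shift, Set.mem_preimage, Set.mem_ofPred_eq, Finset.mem_Icc]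
  constructor
  · intro h i hi
    have := h (i + -t) (by omega)
    rwa [neg_add_cancel_right] at this
  · intro h i hi
    have := h (i + t) (by omega)
    rwa [add_neg_cancel_right] at this

lemma IsMarkovExtension.marginal_eq {m : Measure (Fin (k + 1) → Ω)}
    {μ : Measure (ℤ → Ω)} (h : IsMarkovExtension m μ) : marginal k μ = m := by
  refine Measure.ext_of_singleton fun ζ => ?_
  rw [marginal, Measure.map_apply (measurable_window 0) MeasurableSet.of_discrete]
  set η : ℤ → Ω := fun i => ζ ⟨min i.toNat k, by omega⟩ with hη
  have hw : window k η 0 = ζ := by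
    ext j
    simp only [window, hη]
    congr 1
    ext
    have := j.is_lt
    simp only
    omega
  have h1 := h.measure_cylinderAt 0 0 η
  rw [chainWeight, Finset.range_zero, Finset.prod_empty, mul_one, hw] at h1
  rw [← h1]
  congr 1
  ext ξ
  simp only [Set.mem_preimage, Set.mem_singleton_iff]
  constructor
  · intro h i hi
    rw [Finset.mem_Icc] at hi
    obtain ⟨j, rfl⟩ : ∃ j : ℕ, i = j := ⟨i.toNat, by omega⟩
    have := congrFun (h.trans hw.symm) ⟨j, by push_cast at hi; omega⟩
    simpa [window] using this
  · intro h
    rw [← hw]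
    exact window_congr fun i hi => h i (by simpa using hi)

end

/-! ### Boltzmann weights as products -/

section Energy

variable {Ω : Type*} {Φ : Finset ℤ → (ℤ → Ω) → EReal} {k : ℕ}

/-- Without `⊥` no `exp (g i)` vanishes, which makes inversion in `ℝ≥0∞` multiplicative even in the
presence of `⊤`. -/
lemma exp_neg_sum {ι : Type*} (s : Finset ι) (g : ι → EReal) (hg : ∀ i ∈ s, g i ≠ ⊥) :
    EReal.exp (-∑ i ∈ s, g i) = ∏ i ∈ s, EReal.exp (-g i) := by
  classical
  induction s using Finset.induction_on with
  | empty => simp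
  | insert i s hi ih =>
    rw [Finset.sum_insert hi, Finset.prod_insert hi, ← ih fun j hj => hg j (by simp [hj]),
      EReal.exp_neg, EReal.exp_neg, EReal.exp_neg, EReal.exp_add, ENNReal.mul_inv]
    · left
      simpa using hg i (by simp)
    · right
      rw [Ne, EReal.exp_eq_zero_iff]
      have : ∀ t ⊆ s, ∑ j ∈ t, g j ≠ ⊥ := by
        intro t
        induction t using Finset.induction_on with
        | empty => simp
        | insert j t hj iht =>
          intro hsub
          rw [Finset.sum_insert hj, Ne, EReal.add_eq_bot_iff, not_or]
          exact ⟨hg j (by simp [hsub (Finset.mem_insert_self j t)]),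
            iht fun x hx => hsub (Finset.mem_insert_of_mem hx)⟩
      exact this s subset_rfl

lemma exp_neg_energy (hΦ : ∀ A η, Φ A η ≠ ⊥) {Λ : Finset ℤ} {F : Finset (Finset ℤ)} {η : ℤ → Ω}
    (hF : ∀ A, (A ∩ Λ).Nonempty → Φ A η ≠ 0 → A ∈ F) :
    EReal.exp (-energy Φ Λ η) = ∏ A ∈ F with (A ∩ Λ).Nonempty, EReal.exp (-Φ A η) := by
  rw [energy, finsum_eq_sum_of_support_subset (s := F), ← exp_neg_sum _ _ fun A _ => hΦ A η,
    Finset.sum_filter]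
  · congr 2
    refine Finset.sum_congr rfl fun A _ => ?_
    rw [finsum_eq_if]
  · intro A hA
    rw [Function.mem_support, finsum_eq_if] at hA
    split_ifs at hA with h
    · exact hF A h hA
    · exact absurd rfl hA

lemma exp_neg_energy_ne_top (hΦ : ∀ A η, Φ A η ≠ ⊥) {Λ : Finset ℤ} {F : Finset (Finset ℤ)}
    {η : ℤ → Ω} (hF : ∀ A, (A ∩ Λ).Nonempty → Φ A η ≠ 0 → A ∈ F) :
    EReal.exp (-energy Φ Λ η) ≠ ⊤ := by
  rw [exp_neg_energy hΦ hF]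
  exact ENNReal.prod_ne_top fun A _ => by simpa using hΦ A η

/-- A finite collection that contains all sets contributing to the energy in `Λ`. -/
lemma HasRangeAtMost.mem_powerset (hk : HasRangeAtMost k Φ) (Λ A : Finset ℤ) (η : ℤ → Ω)
    (hA : (A ∩ Λ).Nonempty) (h0 : Φ A η ≠ 0) :
    A ∈ (Λ.biUnion fun i => Finset.Icc (i - k) (i + k)).powerset := by
  obtain ⟨i, hi⟩ := hA
  rw [Finset.mem_inter] at hi
  rw [Finset.mem_powerset]
  intro j hj
  rw [Finset.mem_biUnion]
  refine ⟨i, hi.2, ?_⟩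
  rw [Finset.mem_Icc]
  by_contra hcon
  refine h0 (hk A ?_ η)
  by_cases h : (k : ℤ) < j - i
  · exact ⟨i, hi.1, j, hj, h⟩
  · exact ⟨j, hj, i, hi.1, by omega⟩

lemma IsInteraction.congr (hΦ : IsInteraction Φ) {A : Finset ℤ} {η ξ : ℤ → Ω}
    (h : ∀ i ∈ A, η i = ξ i) : Φ A η = Φ A ξ :=
  hΦ.dependsOn A fun i hi => h i hi

lemma energy_congr (hΦ : IsInteraction Φ) (hk : HasRangeAtMost k Φ) {Λ : Finset ℤ} {η ξ : ℤ → Ω}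
    (h : ∀ i ∈ Λ, ∀ j, i - k ≤ j → j ≤ i + k → η j = ξ j) : energy Φ Λ η = energy Φ Λ ξ := by
  refine finsum_congr fun A => finsum_congr_Prop rfl fun hA => ?_
  by_cases h0 : ∃ i ∈ A, ∃ j ∈ A, (k : ℤ) < j - i
  · rw [hk A h0, hk A h0]
  · obtain ⟨i, hi⟩ := hA
    rw [Finset.mem_inter] at hi
    refine hΦ.congr fun j hj => h i hi.2 j ?_ ?_
    · by_contra hc
      exact h0 ⟨j, hj, i, hi.1, by omega⟩
    · by_contra hc
      exact h0 ⟨i, hi.1, j, hj, by omega⟩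

lemma boltzmann_restrict (Λ : Finset ℤ) (η : ℤ → Ω) :
    boltzmann Φ Λ (Λ.restrict η) η = EReal.exp (-energy Φ Λ η) := by
  rw [boltzmann]
  congr 3
  ext i
  simp [Function.updateFinset]

lemma boltzmann_congr (hΦ : IsInteraction Φ) (hk : HasRangeAtMost k Φ) {Λ : Finset ℤ}
    {η ξ : ℤ → Ω} (ζ : Λ → Ω)
    (h : ∀ i ∈ Λ, ∀ j, i - k ≤ j → j ≤ i + k → j ∉ Λ → η j = ξ j) :
    boltzmann Φ Λ ζ η = boltzmann Φ Λ ζ ξ := by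
  rw [boltzmann, boltzmann, energy_congr hΦ hk]
  intro i hi j h1 h2
  by_cases hj : j ∈ Λ
  · simp [Function.updateFinset, hj]
  · simp [Function.updateFinset, hj, h i hi j h1 h2 hj]

lemma partitionFunction_congr [Fintype Ω] (hΦ : IsInteraction Φ) (hk : HasRangeAtMost k Φ)
    {Λ : Finset ℤ} {η ξ : ℤ → Ω}
    (h : ∀ i ∈ Λ, ∀ j, i - k ≤ j → j ≤ i + k → j ∉ Λ → η j = ξ j) :
    partitionFunction Φ Λ η = partitionFunction Φ Λ ξ :=
  Finset.sum_congr rfl fun ζ _ => boltzmann_congr hΦ hk ζ h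

lemma boltzmann_ne_top (hΦ : IsInteraction Φ) (hk : HasRangeAtMost k Φ) (Λ : Finset ℤ)
    (ζ : Λ → Ω) (η : ℤ → Ω) : boltzmann Φ Λ ζ η ≠ ⊤ :=
  exp_neg_energy_ne_top hΦ.ne_bot fun A => hk.mem_powerset Λ A _

lemma boltzmann_le_partitionFunction [Fintype Ω] (Λ : Finset ℤ) (ζ : Λ → Ω) (η : ℤ → Ω) :
    boltzmann Φ Λ ζ η ≤ partitionFunction Φ Λ η :=
  Finset.single_le_sum (f := fun ζ => boltzmann Φ Λ ζ η) (fun _ _ => zero_le) (Finset.mem_univ ζ)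

lemma partitionFunction_ne_top [Fintype Ω] (hΦ : IsInteraction Φ) (hk : HasRangeAtMost k Φ)
    (Λ : Finset ℤ) (η : ℤ → Ω) : partitionFunction Φ Λ η ≠ ⊤ :=
  ENNReal.sum_ne_top.2 fun ζ _ => boltzmann_ne_top hΦ hk Λ ζ η

end Energy

/-! ### Events outside a finite set -/

section Outside

variable {Ω : Type*} [MeasurableSpace Ω]

lemma cylinderEvents_eq_comap (Δ : Set ℤ) :
    cylinderEvents (X := fun _ : ℤ => Ω) Δ =
      MeasurableSpace.comap (Δ.domRestrict (π := fun _ => Ω)) MeasurableSpace.pi := by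
  simp only [cylinderEvents, MeasurableSpace.pi, MeasurableSpace.comap_iSup,
    MeasurableSpace.comap_comp, iSup_subtype]
  rfl

lemma measurable_of_congr_finset {Y : Type*} [MeasurableSpace Y] [Finite Ω]
    [DiscreteMeasurableSpace Ω] {g : (ℤ → Ω) → Y} (J : Finset ℤ) (Δ : Set ℤ)
    (hJ : ∀ i ∈ J, i ∈ Δ) (hg : ∀ η ξ, (∀ i ∈ J, η i = ξ i) → g η = g ξ) :
    Measurable[cylinderEvents (X := fun _ : ℤ => Ω) Δ] g := by
  classical
  rcases isEmpty_or_nonempty (ℤ → Ω) with hE | ⟨⟨η₀⟩⟩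
  · exact fun s _ => by
      rw [Set.eq_empty_of_isEmpty (g ⁻¹' s)]
      exact @MeasurableSet.empty _ (cylinderEvents Δ)
  have hrestrict : Measurable[cylinderEvents (X := fun _ : ℤ => Ω) Δ]
      (J.restrict (π := fun _ => Ω)) := by
    exact (@measurable_pi_iff _ _ _ (cylinderEvents Δ) _ _).2 fun i =>
      measurable_cylinderEvent_apply (hJ i i.2)
  have h2 : g = (fun y : J → Ω => g (Function.updateFinset η₀ J y)) ∘
      J.restrict (π := fun _ => Ω) := by
    ext η
    refine hg _ _ fun i hi => ?_
    simp [Function.updateFinset, hi]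
  rw [h2]
  exact @Measurable.comp _ _ _ (cylinderEvents Δ) _ _ _ _ (measurable_of_finite _) hrestrict

end Outside

/-! ### A criterion for Gibbs states -/

section Criterion

variable {Ω : Type*} [Fintype Ω] [MeasurableSpace Ω] [DiscreteMeasurableSpace Ω]
  {Φ : Finset ℤ → (ℤ → Ω) → EReal} {k : ℕ}

lemma ae_measure_cylinderAt_ne_zero (μ : Measure (ℤ → Ω)) (J : Finset ℤ) :
    ∀ᵐ η ∂μ, μ (cylinderAt J η) ≠ 0 := by
  have h : ∀ᵐ η ∂μ, ∀ y : J → Ω, μ {ξ | J.restrict ξ = y} = 0 → J.restrict η ≠ y := by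
    rw [ae_all_iff]
    intro y
    by_cases h0 : μ {ξ | J.restrict ξ = y} = 0
    · filter_upwards [measure_eq_zero_iff_ae_notMem.1 h0] with x hx _ using hx
    · exact ae_of_all _ fun x h => absurd h h0
  filter_upwards [h] with η hη h0
  refine hη (J.restrict η) ?_ rfl
  convert h0 using 2
  ext ξ
  simp [cylinderAt, funext_iff]

/-- The boundary neighbourhood of `Λ` of width `k`. -/
def neighbourhood (k : ℕ) (Λ : Finset ℤ) : Finset ℤ := Λ.biUnion fun i => Finset.Icc (i - k) (i + k)

lemma mem_neighbourhood {Λ : Finset ℤ} {j : ℤ} :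
    j ∈ neighbourhood k Λ ↔ ∃ i ∈ Λ, i - k ≤ j ∧ j ≤ i + k := by
  simp [neighbourhood]

lemma measurable_boltzmann_div (hΦ : IsInteraction Φ) (hk : HasRangeAtMost k Φ) (Λ : Finset ℤ)
    (ζ : Λ → Ω) : Measurable[cylinderEvents (X := fun _ : ℤ => Ω) ((Λ : Set ℤ)ᶜ)]
      fun η => boltzmann Φ Λ ζ η / partitionFunction Φ Λ η := by
  refine measurable_of_congr_finset (neighbourhood k Λ \ Λ) _ (fun i hi => by
    simpa using (Finset.mem_sdiff.1 hi).2) fun η ξ h => ?_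
  have h' : ∀ i ∈ Λ, ∀ j, i - k ≤ j → j ≤ i + k → j ∉ Λ → η j = ξ j := fun i hi j h1 h2 hj =>
    h j (Finset.mem_sdiff.2 ⟨mem_neighbourhood.2 ⟨i, hi, h1, h2⟩, hj⟩)
  rw [boltzmann_congr hΦ hk ζ h', partitionFunction_congr hΦ hk h']

lemma condProb_of_measure_eq (hΦ : IsInteraction Φ) (hk : HasRangeAtMost k Φ)
    {μ : Measure (ℤ → Ω)} [IsProbabilityMeasure μ] (Λ : Finset ℤ) (ζ : Λ → Ω)
    (h : ∀ B, MeasurableSet[cylinderEvents (X := fun _ : ℤ => Ω) ((Λ : Set ℤ)ᶜ)] B →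
      μ ({η : ℤ → Ω | Λ.restrict η = ζ} ∩ B) =
        ∫⁻ η in B, boltzmann Φ Λ ζ η / partitionFunction Φ Λ η ∂μ) :
    μ⟦{η : ℤ → Ω | Λ.restrict η = ζ} | cylinderEvents (X := fun _ : ℤ => Ω) ((Λ : Set ℤ)ᶜ)⟧
      =ᵐ[μ] fun η => (boltzmann Φ Λ ζ η / partitionFunction Φ Λ η).toReal := by
  have hle : cylinderEvents (X := fun _ : ℤ => Ω) ((Λ : Set ℤ)ᶜ) ≤ MeasurableSpace.pi :=
    cylinderEvents_le_pi
  have hE : MeasurableSet {η : ℤ → Ω | Λ.restrict η = ζ} :=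
    (Finset.measurable_restrict (X := fun _ => Ω) Λ) (MeasurableSet.of_discrete (s := {ζ}))
  have hg := measurable_boltzmann_div hΦ hk Λ ζ
  have hg1 : ∀ η, boltzmann Φ Λ ζ η / partitionFunction Φ Λ η ≤ 1 := fun η =>
    ENNReal.div_le_of_le_mul (by rw [one_mul]; exact boltzmann_le_partitionFunction Λ ζ η)
  have hgt : ∀ η, boltzmann Φ Λ ζ η / partitionFunction Φ Λ η ≠ ⊤ := fun η =>
    ((hg1 η).trans_lt ENNReal.one_lt_top).ne
  have hint : Integrable (fun η => (boltzmann Φ Λ ζ η / partitionFunction Φ Λ η).toReal) μ := by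
    refine Integrable.of_bound (C := 1) (hg.mono hle le_rfl).ennreal_toReal.aestronglyMeasurable
      (ae_of_all _ fun η => ?_)
    rw [Real.norm_of_nonneg ENNReal.toReal_nonneg]
    exact ENNReal.toReal_le_of_le_ofReal zero_le_one (by simpa using hg1 η)
  refine (ae_eq_condExp_of_forall_setIntegral_eq hle ?_ ?_ ?_ ?_).symm
  · exact (integrable_const (1 : ℝ)).indicator hE
  · exact fun s _ _ => hint.integrableOn
  · intro s hs _
    rw [integral_toReal (hg.mono hle le_rfl).aemeasurable
      (ae_of_all _ fun η => lt_top_iff_ne_top.2 (hgt η)), ← h s hs,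
      integral_indicator hE, Measure.restrict_restrict hE]
    simp [measureReal_def]
  · exact hg.ennreal_toReal.stronglyMeasurable.aestronglyMeasurable

/-- If cylinder probabilities are products of the Boltzmann weight in `Λ` with a function of the
outside configuration, the conditional probabilities in `Λ` are the Gibbs weights. -/
lemma gibbs_of_product (hΦ : IsInteraction Φ) (hk : HasRangeAtMost k Φ)
    {μ : Measure (ℤ → Ω)} [IsProbabilityMeasure μ] (Λ : Finset ℤ)
    (h : ∀ J : Finset ℤ, ∃ J', J ⊆ J' ∧ ∃ G : (ℤ → Ω) → ℝ≥0∞,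
      (∀ η ξ, (∀ i, i ∉ Λ → η i = ξ i) → G η = G ξ) ∧
      ∀ η, μ (cylinderAt J' η) = EReal.exp (-energy Φ Λ η) * G η) :
    (∀ᵐ η ∂μ, partitionFunction Φ Λ η ≠ 0) ∧
    ∀ ζ : Λ → Ω,
      μ⟦{η : ℤ → Ω | Λ.restrict η = ζ} | cylinderEvents (X := fun _ : ℤ => Ω) ((Λ : Set ℤ)ᶜ)⟧
      =ᵐ[μ] fun η => (boltzmann Φ Λ ζ η / partitionFunction Φ Λ η).toReal := by
  classical
  refine ⟨?_, fun ζ => condProb_of_measure_eq hΦ hk Λ ζ fun B hB => ?_⟩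
  · obtain ⟨J', -, G, -, hG⟩ := h ∅
    -- Almost every `η` lies in a charged cylinder, so its own Boltzmann weight is a positive term
    -- of the partition function.
    filter_upwards [ae_measure_cylinderAt_ne_zero μ J'] with η hη hZ
    rw [hG, ← boltzmann_restrict] at hη
    exact hη (by
      rw [le_antisymm ((boltzmann_le_partitionFunction Λ _ η).trans_eq hZ) zero_le, zero_mul])
  have hle : cylinderEvents (X := fun _ : ℤ => Ω) ((Λ : Set ℤ)ᶜ) ≤ MeasurableSpace.pi :=
    cylinderEvents_le_pi
  have hE : MeasurableSet {η : ℤ → Ω | Λ.restrict η = ζ} :=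
    (Finset.measurable_restrict (X := fun _ => Ω) Λ) (MeasurableSet.of_discrete (s := {ζ}))
  have hg := measurable_boltzmann_div hΦ hk Λ ζ
  have hg1 : ∀ η, boltzmann Φ Λ ζ η / partitionFunction Φ Λ η ≤ 1 := fun η =>
    ENNReal.div_le_of_le_mul (by rw [one_mul]; exact boltzmann_le_partitionFunction Λ ζ η)
  set R : (ℤ → Ω) → (((Λ : Set ℤ)ᶜ : Set ℤ) → Ω) := ((Λ : Set ℤ)ᶜ).domRestrict with hR
  have hRm : Measurable R := measurable_pi_lambda _ fun _ => measurable_pi_apply _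
  have hfin : IsFiniteMeasure
      (μ.withDensity fun η => boltzmann Φ Λ ζ η / partitionFunction Φ Λ η) := by
    refine isFiniteMeasure_withDensity ?_
    refine ((lintegral_mono hg1).trans_lt ?_).ne
    simp
  -- The DLR equation tested on all outside events is an equality of two finite measures on the
  -- outside configurations, which can be checked on cylinders.
  have key : (μ.restrict {η : ℤ → Ω | Λ.restrict η = ζ}).map R =
      (μ.withDensity fun η => boltzmann Φ Λ ζ η / partitionFunction Φ Λ η).map R := by
    have := Measure.isFiniteMeasure_map (μ.restrict {η : ℤ → Ω | Λ.restrict η = ζ}) R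
    have := Measure.isFiniteMeasure_map
      (μ.withDensity fun η => boltzmann Φ Λ ζ η / partitionFunction Φ Λ η) R
    refine ext_of_cylinderAt fun J => ?_
    -- Since `J'` contains the `k`-neighbourhood of `Λ`, the Gibbs weights are constant on the
    -- outside cylinder; since it contains `Λ`, this cylinder splits into cylinders on `J'`.
    obtain ⟨J', hJJ', G, hGout, hG⟩ := h (J.map (Function.Embedding.subtype _) ∪ Λ ∪
      neighbourhood k Λ)
    refine ⟨J'.subtype _, fun i hi => ?_, fun η => ?_⟩
    · rw [Finset.mem_subtype]
      exact hJJ' (Finset.mem_union_left _ (Finset.mem_union_left _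
        (Finset.mem_map_of_mem (Function.Embedding.subtype _) hi)))
    set ηt : ℤ → Ω := fun i => if hi : i ∈ Λ then ζ ⟨i, hi⟩ else η ⟨i, by simpa using hi⟩ with hηt
    have hin : ∀ i (hi : i ∈ Λ), ηt i = ζ ⟨i, hi⟩ := fun i hi => dif_pos hi
    have hout : ∀ i (hi : i ∉ Λ), ηt i = η ⟨i, by simpa using hi⟩ := fun i hi => dif_neg hi
    have hcyl : ∀ ξ : ℤ → Ω, ξ ∈ R ⁻¹' cylinderAt (J'.subtype _) η ↔
        ∀ i ∈ J', i ∉ Λ → ξ i = ηt i := by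
      intro ξ
      simp only [Set.mem_preimage, cylinderAt, Set.mem_ofPred_eq, Finset.mem_subtype]
      constructor
      · intro h i hi hiΛ
        rw [hout i hiΛ]
        exact h ⟨i, by simpa using hiΛ⟩ hi
      · intro h i hi
        have hiΛ : (i : ℤ) ∉ Λ := fun h => i.2 h
        rw [hR, Set.domRestrict_apply, h i hi hiΛ, hout _ hiΛ]
    have hmeas : MeasurableSet (cylinderAt (J'.subtype _) η) := measurableSet_cylinderAt _ _
    have hΛJ : Λ ⊆ J' := fun i hi => hJJ' (by simp [hi])
    have hNJ : neighbourhood k Λ ⊆ J' := fun i hi => hJJ' (by simp [hi])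
    have hupd : ∀ ζ' : Λ → Ω, R ⁻¹' cylinderAt (J'.subtype _) η ∩ Λ.restrict ⁻¹' {ζ'} =
        cylinderAt J' (Function.updateFinset ηt Λ ζ') := by
      intro ζ'
      ext ξ
      rw [Set.mem_inter_iff, hcyl]
      simp only [Set.mem_preimage, Set.mem_singleton_iff, funext_iff, Finset.restrict, cylinderAt,
        Set.mem_ofPred_eq]
      constructor
      · rintro ⟨h1, h2⟩ i hi
        by_cases hiΛ : i ∈ Λ
        · simpa [Function.updateFinset, hiΛ] using h2 ⟨i, hiΛ⟩
        · simpa [Function.updateFinset, hiΛ] using h1 i hi hiΛ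
      · intro h1
        refine ⟨fun i hi hiΛ => ?_, fun i => ?_⟩
        · simpa [Function.updateFinset, hiΛ] using h1 i hi
        · simpa [Function.updateFinset] using h1 i (hΛJ i.2)
    have hGu : ∀ ζ' : Λ → Ω, G (Function.updateFinset ηt Λ ζ') = G ηt := fun ζ' =>
      hGout _ _ fun i hi => by simp [Function.updateFinset, hi]
    have hmu : ∀ ζ' : Λ → Ω, μ (R ⁻¹' cylinderAt (J'.subtype _) η ∩ Λ.restrict ⁻¹' {ζ'}) =
        boltzmann Φ Λ ζ' ηt * G ηt := by
      intro ζ'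
      rw [hupd, hG, hGu]
      rfl
    have htot : μ (R ⁻¹' cylinderAt (J'.subtype _) η) = partitionFunction Φ Λ ηt * G ηt := by
      have h1 : μ (R ⁻¹' cylinderAt (J'.subtype _) η) = ∑ ζ' : Λ → Ω,
          μ (R ⁻¹' cylinderAt (J'.subtype _) η ∩ Λ.restrict ⁻¹' {ζ'}) := by
        have := sum_measure_preimage_singleton
          (μ := μ.restrict (R ⁻¹' cylinderAt (J'.subtype _) η)) (Finset.univ : Finset (Λ → Ω))
          (f := Λ.restrict) fun y _ => (Finset.measurable_restrict (X := fun _ => Ω) Λ)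
            (MeasurableSet.of_discrete (s := {y}))
        simp only [Finset.coe_univ, Set.preimage_univ, Measure.restrict_apply_univ] at this
        rw [← this]
        refine Finset.sum_congr rfl fun y _ => ?_
        rw [Measure.restrict_apply ((Finset.measurable_restrict (X := fun _ => Ω) Λ)
            (MeasurableSet.of_discrete (s := {y}))),
          Set.inter_comm]
      rw [h1, partitionFunction, Finset.sum_mul]
      exact Finset.sum_congr rfl fun ζ' _ => hmu ζ'
    rw [Measure.map_apply hRm hmeas, Measure.map_apply hRm hmeas,
      Measure.restrict_apply (hRm hmeas), withDensity_apply _ (hRm hmeas)]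
    have hconst : ∀ ξ ∈ R ⁻¹' cylinderAt (J'.subtype _) η,
        boltzmann Φ Λ ζ ξ / partitionFunction Φ Λ ξ =
          boltzmann Φ Λ ζ ηt / partitionFunction Φ Λ ηt := by
      intro ξ hξ
      have h' : ∀ i ∈ Λ, ∀ j, i - k ≤ j → j ≤ i + k → j ∉ Λ → ξ j = ηt j :=
        fun i hi j h1 h2 hj =>
          (hcyl ξ).1 hξ j (hNJ (mem_neighbourhood.2 ⟨i, hi, h1, h2⟩)) hj
      rw [boltzmann_congr hΦ hk ζ h', partitionFunction_congr hΦ hk h']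
    rw [setLIntegral_congr_fun (hRm hmeas) hconst, setLIntegral_const, htot]
    refine (hmu ζ).trans ?_
    by_cases hZ : partitionFunction Φ Λ ηt = 0
    · have := le_antisymm ((boltzmann_le_partitionFunction Λ ζ ηt).trans_eq hZ) zero_le
      simp [this, hZ]
    · rw [← mul_assoc, ENNReal.div_mul_cancel hZ (partitionFunction_ne_top hΦ hk Λ ηt)]
  rw [cylinderEvents_eq_comap] at hB
  obtain ⟨B', hB', rfl⟩ := hB
  have h1 := congrArg (fun κ => κ B') key
  rw [Measure.map_apply hRm hB', Measure.map_apply hRm hB', Measure.restrict_apply (hRm hB'),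
    withDensity_apply _ (hRm hB')] at h1
  rw [Set.inter_comm]
  exact h1

end Criterion

section

/-! ### The Markov extension is a Gibbs state -/

section WindowInteraction

variable {Ω : Type*} {k : ℕ} {φ : (Fin (k + 1) → Ω) → EReal}

lemma interval_injective (k : ℕ) : Function.Injective fun i : ℤ => Finset.Icc i (i + k) := by
  intro i j h
  have h1 : i ∈ Finset.Icc j (j + k) := by
    have : Finset.Icc i (i + k) = Finset.Icc j (j + k) := h
    rw [← this, Finset.mem_Icc]; omega
  have h2 : j ∈ Finset.Icc i (i + k) := by
    have : Finset.Icc i (i + k) = Finset.Icc j (j + k) := h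
    rw [this, Finset.mem_Icc]; omega
  rw [Finset.mem_Icc] at h1 h2
  omega

lemma windowInteraction_interval (i : ℤ) (η : ℤ → Ω) :
    windowInteraction φ (Finset.Icc i (i + k)) η = φ (window k η i) := by
  have h : ∃ j : ℤ, Finset.Icc i (i + k) = Finset.Icc j (j + k) := ⟨i, rfl⟩
  rw [windowInteraction, dif_pos h]
  congr 2
  exact (interval_injective k h.choose_spec).symm

lemma windowInteraction_of_ne {A : Finset ℤ} (h : ∀ i : ℤ, A ≠ Finset.Icc i (i + k))
    (η : ℤ → Ω) : windowInteraction φ A η = 0 := by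
  rw [windowInteraction, dif_neg]
  exact fun ⟨i, hi⟩ => h i hi

lemma isInteraction_windowInteraction (hφ : ∀ ζ, φ ζ ≠ ⊥) :
    IsInteraction (windowInteraction φ) where
  dependsOn A η ξ h := by
    by_cases hA : ∃ i : ℤ, A = Finset.Icc i (i + k)
    · obtain ⟨i, rfl⟩ := hA
      rw [windowInteraction_interval, windowInteraction_interval, window_congr fun j hj => h j hj]
    · push Not at hA
      rw [windowInteraction_of_ne hA, windowInteraction_of_ne hA]
  ne_bot A η := by
    by_cases hA : ∃ i : ℤ, A = Finset.Icc i (i + k)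
    · obtain ⟨i, rfl⟩ := hA
      rw [windowInteraction_interval]
      exact hφ _
    · push Not at hA
      rw [windowInteraction_of_ne hA]
      exact EReal.zero_ne_bot

lemma hasRangeAtMost_windowInteraction : HasRangeAtMost k (windowInteraction φ) := by
  rintro A ⟨i, hi, j, hj, hij⟩ η
  refine windowInteraction_of_ne ?_ η
  rintro l rfl
  rw [Finset.mem_Icc] at hi hj
  omega

lemma isTIInteraction_windowInteraction : IsTIInteraction (windowInteraction φ) := by
  intro A t η
  have hmap : ∀ i : ℤ, (Finset.Icc i (i + k)).map (addRightEmbedding t) =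
      Finset.Icc (i + t) (i + t + k) := by
    intro i
    ext j
    simp only [Finset.mem_map, Finset.mem_Icc, addRightEmbedding_apply]
    constructor
    · rintro ⟨l, hl, rfl⟩
      omega
    · intro h
      exact ⟨j - t, by omega, by omega⟩
  by_cases hA : ∃ i : ℤ, A = Finset.Icc i (i + k)
  · obtain ⟨i, rfl⟩ := hA
    rw [hmap, windowInteraction_interval, windowInteraction_interval, window_shift]
  · push Not at hA
    rw [windowInteraction_of_ne hA, windowInteraction_of_ne]
    intro i hi
    refine hA (i - t) (Finset.map_injective (addRightEmbedding t) ?_)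
    rw [hmap, hi, sub_add_cancel]

end WindowInteraction

variable {Ω : Type*} {k : ℕ} [Fintype Ω] [MeasurableSpace Ω] [DiscreteMeasurableSpace Ω]

lemma condLast_le_one (m : Measure (Fin (k + 1) → Ω)) (ζ : Fin (k + 1) → Ω) :
    condLast m ζ ≤ 1 := by
  refine ENNReal.div_le_of_le_mul ?_
  rw [one_mul]
  exact measure_mono (by rintro _ rfl; rfl)

lemma markovPotential_ne_bot (m : Measure (Fin (k + 1) → Ω)) (ζ : Fin (k + 1) → Ω) :
    markovPotential m ζ ≠ ⊥ := by
  rw [markovPotential, Ne, EReal.neg_eq_bot_iff, ENNReal.log_eq_top_iff]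
  exact ((condLast_le_one m ζ).trans_lt ENNReal.one_lt_top).ne

lemma exp_neg_markovPotential (m : Measure (Fin (k + 1) → Ω)) (ζ : Fin (k + 1) → Ω) :
    EReal.exp (-markovPotential m ζ) = condLast m ζ := by
  rw [markovPotential, neg_neg, ENNReal.exp_log]

/-- The Boltzmann weight of the Markov interaction is the product of the transition probabilities
over the windows that meet `Λ`. -/
lemma exp_neg_energy_markov (m : Measure (Fin (k + 1) → Ω)) {Λ : Finset ℤ} {a : ℤ} {n : ℕ}
    (hΛ : Λ ⊆ Finset.Icc (a + k + 1) (a + n)) (η : ℤ → Ω) :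
    EReal.exp (-energy (windowInteraction (markovPotential m)) Λ η) =
      ∏ i ∈ Finset.range n with (Finset.Icc (a + (i : ℕ) + 1) (a + (i : ℕ) + 1 + k) ∩ Λ).Nonempty,
        condLast m (window k η (a + i + 1)) := by
  have hinj : Function.Injective fun i : ℕ => Finset.Icc (a + (i : ℤ) + 1) (a + i + 1 + k) := by
    intro i j h
    have := interval_injective k h
    omega
  rw [exp_neg_energy (F := (Finset.range n).image
    fun i : ℕ => Finset.Icc (a + (i : ℤ) + 1) (a + i + 1 + k))
    (isInteraction_windowInteraction (markovPotential_ne_bot m)).ne_bot, Finset.filter_image,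
    Finset.prod_image hinj.injOn]
  · refine Finset.prod_congr rfl fun i _ => ?_
    rw [windowInteraction_interval, exp_neg_markovPotential]
  · intro A hA h0
    by_cases hA' : ∃ i : ℤ, A = Finset.Icc i (i + k)
    · obtain ⟨i, rfl⟩ := hA'
      obtain ⟨j, hj⟩ := hA
      rw [Finset.mem_inter] at hj
      have h1 := hΛ hj.2
      rw [Finset.mem_Icc] at h1
      have h2 := hj.1
      rw [Finset.mem_Icc] at h2
      rw [Finset.mem_image]
      refine ⟨(i - a - 1).toNat, ?_, ?_⟩
      · rw [Finset.mem_range]; omega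
      · rw [show a + ((i - a - 1).toNat : ℤ) + 1 = i by omega]
    · push Not at hA'
      exact absurd (windowInteraction_of_ne hA' η) h0

/-- On a long interval the chain weight splits into the transitions whose window meets `Λ`, which
form the Boltzmann weight, and a factor that does not depend on the letters in `Λ`. -/
lemma IsMarkovExtension.isGibbsState {m : Measure (Fin (k + 1) → Ω)} {μ : Measure (ℤ → Ω)}
    (h : IsMarkovExtension m μ) : IsGibbsState (windowInteraction (markovPotential m)) μ := by
  have := h.isProbabilityMeasure
  have key := fun Λ => gibbs_of_product (μ := μ)
    (isInteraction_windowInteraction (markovPotential_ne_bot m))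
    hasRangeAtMost_windowInteraction Λ fun J => ?_
  · exact ⟨h.isProbabilityMeasure, fun Λ => (key Λ).1, fun Λ => (key Λ).2⟩
  obtain ⟨b, hb⟩ : ∃ b : ℕ, ∀ i ∈ J ∪ Λ, i.natAbs ≤ b := by
    obtain ⟨b, hb⟩ := ((J ∪ Λ).image fun i => i.natAbs).bddAbove
    exact ⟨b, fun i hi => hb (Finset.mem_coe.2 (Finset.mem_image_of_mem _ hi))⟩
  -- The initial window ends at `-b - 1`, to the left of `Λ`, and the last window starts at `a + n =
  -- b`. So all windows meeting `Λ` occur as transitions.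
  set a : ℤ := -(b : ℤ) - k - 1 with ha
  set n : ℕ := 2 * b + k + 1 with hn
  refine ⟨Finset.Icc a (a + k + n), fun i hi => ?_, fun η => m {window k η a} *
    ∏ i ∈ Finset.range n with
      ¬(Finset.Icc (a + (i : ℕ) + 1) (a + (i : ℕ) + 1 + k) ∩ Λ).Nonempty,
        condLast m (window k η (a + i + 1)), fun η ξ hηξ => ?_, fun η => ?_⟩
  · have := hb i (Finset.mem_union_left _ hi)
    rw [Finset.mem_Icc]
    omega
  · have h1 : window k η a = window k ξ a := window_congr fun i hi => hηξ i fun hiΛ => by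
      have := hb i (Finset.mem_union_right _ hiΛ)
      rw [Finset.mem_Icc] at hi
      omega
    simp only
    rw [h1]
    congr 1
    refine Finset.prod_congr rfl fun i hi => ?_
    rw [Finset.mem_filter, Finset.not_nonempty_iff_eq_empty] at hi
    congr 1
    refine window_congr fun j hj => hηξ j fun hjΛ => ?_
    have : j ∈ (∅ : Finset ℤ) := hi.2 ▸ Finset.mem_inter.2 ⟨hj, hjΛ⟩
    simp at this
  · rw [h.measure_cylinderAt, exp_neg_energy_markov (a := a) (n := n) m (fun i hi => ?_), chainWeight,
      mul_left_comm, Finset.prod_filter_mul_prod_filter_not]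
    have := hb i (Finset.mem_union_right _ hi)
    rw [Finset.mem_Icc]
    omega

end

section

/-! ### Translation invariant Gibbs states are Markov -/

/-! ### Configurations as paths of windows -/

section Windows

variable {Ω : Type*} {k : ℕ}

lemma iterate_shift_one (i : ℕ) (η : ℤ → Ω) : (shift 1)^[i] η = shift i η := by
  induction i with
  | zero => ext j; simp [shift]
  | succ i ih =>
    rw [Function.iterate_succ_apply', ih]
    ext j
    simp only [shift]
    congr 1
    push_cast
    ring

lemma orbitWord_window (η : ℤ → Ω) (i : ℕ) :
    orbitWord (shift 1) (fun η => window k η 0) η i = window k η i := by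
  rw [orbitWord, iterate_shift_one, window_shift, zero_add]

/-- Consecutive windows of a path overlap in `k` letters, so each further edge only adds its last
letter. -/
lemma exists_config_of_isPath {n : ℕ} {w : ℕ → Fin (k + 1) → Ω}
    (hw : IsPath (Fin.init (α := fun _ => Ω)) (Fin.tail (α := fun _ => Ω)) n w) :
    ∃ η : ℤ → Ω, ∀ i < n, window k η i = w i := by
  induction n with
  | zero => exact ⟨fun _ => w 0 0, fun i hi => absurd hi (Nat.not_lt_zero i)⟩
  | succ n ih =>
    rcases Nat.eq_zero_or_pos n with rfl | hn
    · refine ⟨fun j => w 0 ⟨min j.toNat k, by omega⟩, fun i hi => ?_⟩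
      obtain rfl : i = 0 := by omega
      ext j
      simp only [window]
      congr 1
      ext
      have := j.is_lt
      simp only
      omega
    obtain ⟨η, hη⟩ := ih fun i hi => hw i (by omega)
    have hold : ∀ i < n, window k (Function.update η (n + k) (w n (Fin.last k))) i =
        window k η i := fun i hi => window_congr fun j hj => by
      rw [Finset.mem_Icc] at hj
      exact Function.update_of_ne (by omega) _ _
    refine ⟨Function.update η (n + k) (w n (Fin.last k)), fun i hi => ?_⟩
    rcases Nat.lt_succ_iff_lt_or_eq.1 hi with hi | rfl
    · rw [hold i hi, hη i hi]
    obtain ⟨q, rfl⟩ : ∃ q, i = q + 1 := ⟨i - 1, by omega⟩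
    set ξ := Function.update η ((q + 1 : ℕ) + k) (w (q + 1) (Fin.last k))
    have h1 : Fin.init (window k ξ ((q + 1 : ℕ) : ℤ)) = Fin.init (w (q + 1)) := by
      push_cast
      rw [init_window_succ, hold q (by omega), hη q (by omega), hw q (by omega)]
    have h2 : window k ξ ((q + 1 : ℕ) : ℤ) (Fin.last k) = w (q + 1) (Fin.last k) := by
      simp [window, ξ]
    rw [← Fin.snoc_init_self (α := fun _ => Ω) (window k ξ ((q + 1 : ℕ) : ℤ)), h1, h2]
    exact Fin.snoc_init_self (α := fun _ => Ω) _

/-- The windows starting at `0, …, n - 1` cover the sites `0, …, n + k - 1`. For `n = 0` the word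
event is everything, whereas the cylinder still prescribes `k` sites. -/
lemma wordEvent_window {n : ℕ} (hn : 0 < n) (η : ℤ → Ω) :
    wordEvent (shift 1) (fun η => window k η 0) n (fun i => window k η i) =
      cylinderAt (Finset.Ico 0 ((n : ℤ) + k)) η := by
  ext ξ
  simp only [wordEvent, orbitWord_window, Set.mem_ofPred_eq, cylinderAt, Finset.mem_Ico]
  constructor
  · intro h j hj
    by_cases hjn : j < n
    · have := congrFun (h j.toNat (by omega)) 0
      simp only [window, Fin.val_zero] at this
      rwa [show (j.toNat : ℤ) + ((0 : ℕ) : ℤ) = j by omega] at this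
    · have := congrFun (h (n - 1) (by omega)) ⟨(j - n + 1).toNat, by omega⟩
      simp only [window] at this
      rwa [show ((n - 1 : ℕ) : ℤ) + ((j - n + 1).toNat : ℤ) = j by omega] at this
  · intro h i hi
    exact window_congr fun j hj => h j (by rw [Finset.mem_Icc] at hj; omega)

end Windows

/-! ### Grouping the interaction by leftmost points -/

section SiteWeight

variable {Ω : Type*} {k : ℕ} {Φ : Finset ℤ → (ℤ → Ω) → EReal}

/-- The sets of diameter at most `k` with leftmost point `i`. -/
def setsFrom (k : ℕ) (i : ℤ) : Finset (Finset ℤ) :=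
  {A ∈ (Finset.Icc i (i + k)).powerset | i ∈ A}

lemma mem_setsFrom {i : ℤ} {A : Finset ℤ} :
    A ∈ setsFrom k i ↔ A ⊆ Finset.Icc i (i + k) ∧ i ∈ A := by
  simp [setsFrom]

/-- The Boltzmann weight of all sets with leftmost point `i`. -/
def siteWeight (Φ : Finset ℤ → (ℤ → Ω) → EReal) (i : ℤ) (x : Fin (k + 1) → Ω) : ℝ≥0∞ :=
  ∏ A ∈ setsFrom k i, EReal.exp (-Φ A fun j => x ⟨min (j - i).toNat k, by omega⟩)

lemma extend_window (η : ℤ → Ω) {i j : ℤ} (hj : j ∈ Finset.Icc i (i + k)) :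
    window k η i ⟨min (j - i).toNat k, by omega⟩ = η j := by
  rw [Finset.mem_Icc] at hj
  simp only [window]
  congr 1
  push_cast
  omega

lemma siteWeight_window (hΦ : IsInteraction Φ) (η : ℤ → Ω) (i : ℤ) :
    siteWeight Φ i (window k η i) = ∏ A ∈ setsFrom k i, EReal.exp (-Φ A η) := by
  refine Finset.prod_congr rfl fun A hA => ?_
  rw [hΦ.congr fun j hj => extend_window η ((mem_setsFrom.1 hA).1 hj)]

lemma siteWeight_ne_top (hΦ : IsInteraction Φ) (i : ℤ) (x : Fin (k + 1) → Ω) :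
    siteWeight Φ i x ≠ ⊤ :=
  ENNReal.prod_ne_top fun A _ => by simpa using hΦ.ne_bot A _

/-- A set of diameter at most `k` that meets `[k, n)` has its leftmost point in `[0, n)`, so the
product contains the full Boltzmann weight of that volume. The other factor does not see the sites
in `[k, n)`. -/
lemma prod_siteWeight (hΦ : IsInteraction Φ) (hk : HasRangeAtMost k Φ) (n : ℕ) (η : ℤ → Ω) :
    ∏ i ∈ Finset.range n, siteWeight Φ (i : ℤ) (window k η i) =
      EReal.exp (-energy Φ (Finset.Ico (k : ℤ) n) η) *
        ∏ A ∈ (Finset.range n).biUnion (fun i => setsFrom k i) with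
          ¬(A ∩ Finset.Ico (k : ℤ) n).Nonempty, EReal.exp (-Φ A η) := by
  rw [exp_neg_energy hΦ.ne_bot (F := (Finset.range n).biUnion fun i => setsFrom k i),
    Finset.prod_filter_mul_prod_filter_not, Finset.prod_biUnion]
  · exact Finset.prod_congr rfl fun i _ => siteWeight_window hΦ η i
  · intro i _ j _ hij
    refine Finset.disjoint_left.2 fun A hA hA' => hij ?_
    rw [mem_setsFrom] at hA hA'
    have h1 := hA.1 hA'.2
    have h2 := hA'.1 hA.2
    rw [Finset.mem_Icc] at h1 h2
    omega
  · intro A hA h0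
    have hA' : A.Nonempty := hA.mono Finset.inter_subset_left
    obtain ⟨l, hl⟩ := hA
    rw [Finset.mem_inter, Finset.mem_Ico] at hl
    have hmin := A.min'_mem hA'
    have hmax : ∀ j ∈ A, j - A.min' hA' ≤ k := fun j hj => by
      by_contra hcon
      exact h0 (hk A ⟨_, hmin, j, hj, not_le.1 hcon⟩ η)
    have h1 := hmax l hl.1
    have h2 := A.min'_le l hl.1
    refine Finset.mem_biUnion.2 ⟨(A.min' hA').toNat, Finset.mem_range.2 (by omega), ?_⟩
    rw [Int.toNat_of_nonneg (by omega), mem_setsFrom]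
    refine ⟨fun j hj => ?_, hmin⟩
    have h3 := hmax j hj
    have h4 := A.min'_le j hj
    rw [Finset.mem_Icc]
    omega

end SiteWeight

/-! ### From DLR equations to path processes -/

variable {Ω : Type*} {k : ℕ} [Fintype Ω] [MeasurableSpace Ω] [DiscreteMeasurableSpace Ω]
  {Φ : Finset ℤ → (ℤ → Ω) → EReal} {ν : Measure (ℤ → Ω)}

lemma IsGibbsState.measure_inter (h : IsGibbsState Φ ν) (hΦ : IsInteraction Φ)
    (hk : HasRangeAtMost k Φ) (Λ : Finset ℤ) (ζ : Λ → Ω) {B : Set (ℤ → Ω)}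
    (hB : MeasurableSet[cylinderEvents (X := fun _ : ℤ => Ω) ((Λ : Set ℤ)ᶜ)] B) :
    ν ({η : ℤ → Ω | Λ.restrict η = ζ} ∩ B) =
      ∫⁻ η in B, boltzmann Φ Λ ζ η / partitionFunction Φ Λ η ∂ν := by
  have := h.isProbabilityMeasure
  have hle : cylinderEvents (X := fun _ : ℤ => Ω) ((Λ : Set ℤ)ᶜ) ≤ MeasurableSpace.pi :=
    cylinderEvents_le_pi
  have hE : MeasurableSet {η : ℤ → Ω | Λ.restrict η = ζ} :=
    (Finset.measurable_restrict (X := fun _ => Ω) Λ) (MeasurableSet.of_discrete (s := {ζ}))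
  have hg := (measurable_boltzmann_div hΦ hk Λ ζ).mono hle le_rfl
  have hg1 : ∀ η, boltzmann Φ Λ ζ η / partitionFunction Φ Λ η ≤ 1 := fun η =>
    ENNReal.div_le_of_le_mul (by rw [one_mul]; exact boltzmann_le_partitionFunction Λ ζ η)
  have h1 := setIntegral_condExp hle (μ := ν) (s := B)
    ((integrable_const (1 : ℝ)).indicator hE) hB
  rw [setIntegral_congr_ae (hle _ hB) ((h.condProb Λ ζ).mono fun η hη _ => hη),
    integral_toReal hg.aemeasurable
      (ae_of_all _ fun η => (hg1 η).trans_lt ENNReal.one_lt_top),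
    integral_indicator hE, Measure.restrict_restrict hE] at h1
  simp only [integral_const, smul_eq_mul, mul_one, measureReal_def, Measure.restrict_apply_univ]
    at h1
  refine ((ENNReal.toReal_eq_toReal_iff' ?_ (measure_ne_top _ _)).1 h1).symm
  refine ((setLIntegral_mono measurable_const fun η _ => hg1 η).trans_lt ?_).ne
  rw [setLIntegral_const, one_mul]
  exact measure_lt_top _ _

/-- Hard constraints are almost surely satisfied. -/
lemma IsGibbsState.interaction_ne_top (h : IsGibbsState Φ ν) (hΦ : IsInteraction Φ)
    (hk : HasRangeAtMost k Φ) {A : Finset ℤ} (hA : A.Nonempty) {η : ℤ → Ω}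
    (hpos : ν (cylinderAt A η) ≠ 0) : Φ A η ≠ ⊤ := by
  intro htop
  apply hpos
  have h1 := h.measure_inter hΦ hk A (A.restrict η) MeasurableSet.univ
  rw [Set.inter_univ] at h1
  have h2 : {ξ : ℤ → Ω | A.restrict ξ = A.restrict η} = cylinderAt A η := by
    ext ξ
    simp [cylinderAt, funext_iff]
  rw [← h2, h1]
  -- In the volume `A` itself the factor `exp (-∞) = 0` of the set `A` occurs for every boundary
  -- condition.
  have h3 : ∀ ξ, boltzmann Φ A (A.restrict η) ξ = 0 := by
    intro ξ
    rw [boltzmann, exp_neg_energy hΦ.ne_bot (F := insert A _) fun A' hA' h0 =>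
      Finset.mem_insert_of_mem (hk.mem_powerset A A' _ hA' h0)]
    refine Finset.prod_eq_zero (i := A) ?_ ?_
    · simp [hA]
    · rw [hΦ.congr (ξ := η) fun i hi => by simp [Function.updateFinset, hi], htop]
      simp
  simp [h3]

/-- The probability of a configuration on `{0, …, n + k - 1}`, given its first and its last `k`
letters, is proportional to the product of the site weights. -/
lemma IsGibbsState.swap (h : IsGibbsState Φ ν) (hΦ : IsInteraction Φ)
    (hk : HasRangeAtMost k Φ) (n : ℕ) {η ξ : ℤ → Ω}
    (hηξ : ∀ i, i ∉ Finset.Ico (k : ℤ) n → η i = ξ i) :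
    ν (cylinderAt (Finset.Ico 0 ((n : ℤ) + k)) η) *
        ∏ i ∈ Finset.range n, siteWeight Φ (i : ℤ) (window k ξ i) =
      ν (cylinderAt (Finset.Ico 0 ((n : ℤ) + k)) ξ) *
        ∏ i ∈ Finset.range n, siteWeight Φ (i : ℤ) (window k η i) := by
  set Λ : Finset ℤ := Finset.Ico (k : ℤ) n with hΛ
  set B := cylinderAt (Finset.Ico 0 ((n : ℤ) + k) \ Λ) η with hBdef
  have hBξ : B = cylinderAt (Finset.Ico 0 ((n : ℤ) + k) \ Λ) ξ := by
    ext z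
    exact forall₂_congr fun i hi => by rw [hηξ i (Finset.mem_sdiff.1 hi).2]
  have hB : MeasurableSet[cylinderEvents (X := fun _ : ℤ => Ω) ((Λ : Set ℤ)ᶜ)] B := by
    have : B = ⋂ i ∈ Finset.Ico 0 ((n : ℤ) + k) \ Λ, (fun z => z i) ⁻¹' {η i} := by
      ext; simp [B, cylinderAt]
    rw [this]
    refine Finset.measurableSet_biInter _ fun i hi => ?_
    exact measurable_cylinderEvent_apply (by simpa using (Finset.mem_sdiff.1 hi).2)
      (MeasurableSet.of_discrete (s := {η i}))
  -- The event `B` fixes every site outside `Λ` that interacts with `Λ`, so the conditional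
  -- probability is constant on it.
  have hmain : ∀ z : ℤ → Ω, B = cylinderAt (Finset.Ico 0 ((n : ℤ) + k) \ Λ) z →
      ν (cylinderAt (Finset.Ico 0 ((n : ℤ) + k)) z) =
        EReal.exp (-energy Φ Λ z) / partitionFunction Φ Λ z * ν B := by
    intro z hz
    have h1 := h.measure_inter hΦ hk Λ (Λ.restrict z) hB
    have h2 : {x : ℤ → Ω | Λ.restrict x = Λ.restrict z} ∩ B =
        cylinderAt (Finset.Ico 0 ((n : ℤ) + k)) z := by
      rw [hz]
      ext x
      simp only [Set.mem_inter_iff, Set.mem_ofPred_eq, funext_iff, Finset.restrict, cylinderAt]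
      constructor
      · rintro ⟨h3, h4⟩ i hi
        by_cases hiΛ : i ∈ Λ
        · exact h3 ⟨i, hiΛ⟩
        · exact h4 i (Finset.mem_sdiff.2 ⟨hi, hiΛ⟩)
      · intro h3
        refine ⟨fun i => h3 i ?_, fun i hi => h3 i (Finset.mem_sdiff.1 hi).1⟩
        have := Finset.mem_Ico.1 i.2
        exact Finset.mem_Ico.2 ⟨by omega, by omega⟩
    rw [h2] at h1
    rw [h1]
    have hconst : ∀ x ∈ B, boltzmann Φ Λ (Λ.restrict z) x / partitionFunction Φ Λ x =
        EReal.exp (-energy Φ Λ z) / partitionFunction Φ Λ z := by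
      intro x hx
      rw [hz] at hx
      have h' : ∀ i ∈ Λ, ∀ j, i - k ≤ j → j ≤ i + k → j ∉ Λ → x j = z j := by
        intro i hi j h3 h4 hj
        refine hx j (Finset.mem_sdiff.2 ⟨?_, hj⟩)
        rw [hΛ, Finset.mem_Ico] at hi
        rw [Finset.mem_Ico]
        omega
      rw [boltzmann_congr hΦ hk _ h', partitionFunction_congr hΦ hk h', boltzmann_restrict]
    have hBm : MeasurableSet B := cylinderEvents_le_pi _ hB
    rw [setLIntegral_congr_fun hBm hconst, setLIntegral_const]
  have hZ : partitionFunction Φ Λ ξ = partitionFunction Φ Λ η :=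
    partitionFunction_congr hΦ hk fun _ _ j _ _ hj => (hηξ j hj).symm
  have hrest : ∏ A ∈ (Finset.range n).biUnion (fun i => setsFrom k i) with
      ¬(A ∩ Λ).Nonempty, EReal.exp (-Φ A η) =
      ∏ A ∈ (Finset.range n).biUnion (fun i => setsFrom k i) with
      ¬(A ∩ Λ).Nonempty, EReal.exp (-Φ A ξ) := by
    refine Finset.prod_congr rfl fun A hA => ?_
    rw [hΦ.congr fun i hi => hηξ i fun hiΛ =>
      (Finset.mem_filter.1 hA).2 ⟨i, Finset.mem_inter.2 ⟨hi, hiΛ⟩⟩]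
  rw [prod_siteWeight hΦ hk, prod_siteWeight hΦ hk, hmain η rfl, hmain ξ hBξ, hZ, hrest]
  simp only [div_eq_mul_inv]
  ring

lemma IsTranslationInvariant.measurePreserving (h : IsTranslationInvariant ν) (t : ℤ) :
    MeasurePreserving (shift t) ν ν := ⟨measurable_shift t, h t⟩

lemma IsTranslationInvariant.measure_window (h : IsTranslationInvariant ν) (i : ℤ)
    (y : Fin (k + 1) → Ω) :
    ν ((fun η => window k η i) ⁻¹' {y}) = ν ((fun η => window k η 0) ⁻¹' {y}) := by
  rw [← (h.measurePreserving i).measure_preimage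
    (measurable_window 0 MeasurableSet.of_discrete).nullMeasurableSet]
  congr 1
  ext η
  simp [window_shift]

lemma IsTranslationInvariant.isLTI_marginal (h : IsTranslationInvariant ν) :
    IsLTI (marginal k ν) := by
  intro A t s hs
  rw [marginal, Measure.map_map (measurable_of_finite _) (measurable_window 0),
    Measure.map_map (measurable_of_finite _) (measurable_window 0)]
  conv_rhs => rw [← h t]
  rw [Measure.map_map ((measurable_of_finite _).comp (measurable_window 0)) (measurable_shift _)]
  congr 1
  ext η i
  simp only [Function.comp_apply, window, shift, hs i]
  congr 1
  push_cast
  ring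

/-- A translation invariant Gibbs state for a finite range interaction, as a stationary process of
windows. -/
lemma IsGibbsState.isPathGibbs (h : IsGibbsState Φ ν) (hΦ : IsInteraction Φ)
    (hk : HasRangeAtMost k Φ) (hν : IsTranslationInvariant ν) :
    IsPathGibbs ν (shift 1) (fun η => window k η 0) (Fin.init (α := fun _ => Ω))
      (Fin.tail (α := fun _ => Ω)) (fun i x => (siteWeight Φ (i : ℤ) x).toReal) where
  mp := hν.measurePreserving 1
  meas := measurable_window 0
  tgt_eq η := by
    rw [window_shift]
    exact (init_window_succ η 0).symm
  weight_pos i y hy := by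
    have := h.isProbabilityMeasure
    refine ENNReal.toReal_pos ?_ (siteWeight_ne_top hΦ _ _)
    rw [siteWeight, Finset.prod_ne_zero_iff]
    intro A hA
    rw [mem_setsFrom] at hA
    rw [Ne, EReal.exp_eq_zero_iff, EReal.neg_eq_bot_iff]
    -- A charged window is charged at every position `i` by translation invariance, although the
    -- weights depend on `i`.
    refine h.interaction_ne_top hΦ hk ⟨_, hA.2⟩ fun h0 => hy ?_
    have h1 : ν ((fun η => window k η (i : ℤ)) ⁻¹' {y}) = 0 := by
      refine measure_mono_null ?_ h0
      rintro η rfl j hj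
      exact (extend_window η (hA.1 hj)).symm
    rw [hν.measure_window] at h1
    simp [measureReal_def, h1]
  swap n w w' hn hw hw' hs ht := by
    obtain ⟨η, hη⟩ := exists_config_of_isPath hw
    obtain ⟨ξ₀, hξ₀⟩ := exists_config_of_isPath hw'
    -- Only the interior `[k, n)` is taken from `ξ₀`. The sites before and after it belong to the
    -- end vertices, which the two paths share, so the windows of `ξ` are still those of `w'`.
    set ξ : ℤ → Ω := fun i => if i ∈ Finset.Ico (k : ℤ) n then ξ₀ i else η i with hξdef
    have hηξ : ∀ i, i ∉ Finset.Ico (k : ℤ) n → η i = ξ i := fun i hi => by simp only [hξdef, if_neg hi]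
    have hξ : ∀ i < n, window k ξ i = w' i := by
      intro i hi
      rw [← hξ₀ i hi]
      refine window_congr fun j hj => ?_
      simp only [hξdef]
      split_ifs with hjΛ
      · rfl
      · rw [Finset.mem_Icc] at hj
        rw [Finset.mem_Ico, not_and_or] at hjΛ
        by_cases hjk : j < k
        · have h1 := hη 0 hn
          have h2 := hξ₀ 0 hn
          rw [← h1, ← h2] at hs
          have := congrFun hs ⟨j.toNat, by omega⟩
          simp only [Fin.init, window, Fin.val_castSucc] at this
          rwa [show ((0 : ℕ) : ℤ) + (j.toNat : ℤ) = j by omega] at this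
        · have h1 := hη (n - 1) (by omega)
          have h2 := hξ₀ (n - 1) (by omega)
          rw [← h1, ← h2] at ht
          have := congrFun ht ⟨(j - n).toNat, by omega⟩
          simp only [Fin.tail, window, Fin.val_succ] at this
          rwa [show ((n - 1 : ℕ) : ℤ) + (((j - n).toNat + 1 : ℕ) : ℤ) = j by omega] at this
    have key := congrArg ENNReal.toReal (h.swap hΦ hk n hηξ)
    rw [ENNReal.toReal_mul, ENNReal.toReal_mul, ENNReal.toReal_prod, ENNReal.toReal_prod,
      ← wordEvent_window hn, ← wordEvent_window hn] at key
    rw [wordEvent_congr (w := w) (w' := fun i => window k η i) fun i hi => (hη i hi).symm,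
      wordEvent_congr (w := w') (w' := fun i => window k ξ i) fun i hi => (hξ i hi).symm]
    rw [measureReal_def, measureReal_def]
    convert key using 2
    · exact Finset.prod_congr rfl fun i hi => by rw [hξ i (Finset.mem_range.1 hi)]
    · exact Finset.prod_congr rfl fun i hi => by rw [hη i (Finset.mem_range.1 hi)]

lemma marginal_apply (s : Set (Fin (k + 1) → Ω)) :
    marginal k ν s = ν ((fun η => window k η 0) ⁻¹' s) :=
  Measure.map_apply (measurable_window 0) MeasurableSet.of_discrete

/-- A translation invariant Gibbs state for an interaction of range at most `k` is the Markov
extension of its marginal. -/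
theorem IsGibbsState.isMarkovExtension (h : IsGibbsState Φ ν) (hΦ : IsInteraction Φ)
    (hk : HasRangeAtMost k Φ) (hν : IsTranslationInvariant ν) :
    IsMarkovExtension (marginal k ν) ν := by
  have := h.isProbabilityMeasure
  have : IsProbabilityMeasure (marginal k ν) :=
    Measure.isProbabilityMeasure_map (measurable_window 0).aemeasurable
  -- Part (1) supplies the Markov process with the edge distribution of `ν`, to be identified with
  -- `ν` by `eq_markov`.
  obtain ⟨μ, hμ⟩ := exists_isMarkovExtension (hν.isLTI_marginal (k := k))
  have := hμ.isProbabilityMeasure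
  have hμT := hμ.isTranslationInvariant
  have hedge : ∀ y, μ.real ((fun η => window k η 0) ⁻¹' {y}) =
      ν.real ((fun η => window k η 0) ⁻¹' {y}) := fun y => by
    rw [measureReal_def, measureReal_def, ← marginal_apply, ← marginal_apply, hμ.marginal_eq]
  have hIcc : ∀ n : ℕ, Finset.Ico (0 : ℤ) (((n + 1 : ℕ) : ℤ) + k) =
      Finset.Icc (0 : ℤ) (0 + k + n) := fun n => by
    ext i; simp only [Finset.mem_Ico, Finset.mem_Icc]; push_cast; omega
  have hmarkov : ∀ n w, IsPath (Fin.init (α := fun _ => Ω)) (Fin.tail (α := fun _ => Ω)) (n + 1) w →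
      μ.real (wordEvent (shift 1) (fun η => window k η 0) (n + 1) w) =
      ν.real ((fun η => window k η 0) ⁻¹' {w 0}) * ∏ i ∈ Finset.range n,
        (ν.real ((fun η => window k η 0) ⁻¹' {w (i + 1)}) /
          ν.real {x | Fin.init (window k x 0) = Fin.init (w (i + 1))}) := by
    intro n w hw
    obtain ⟨η, hη⟩ := exists_config_of_isPath hw
    rw [wordEvent_congr (w := w) (w' := fun i => window k η i) fun i hi => (hη i hi).symm,
      wordEvent_window (Nat.succ_pos n), hIcc, measureReal_def, hμ.measure_cylinderAt, chainWeight,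
      ENNReal.toReal_mul, ENNReal.toReal_prod, marginal_apply]
    congr 1
    · rw [← hη 0 (Nat.succ_pos n)]
      rfl
    · refine Finset.prod_congr rfl fun i hi => ?_
      have h1 := hη (i + 1) (by have := Finset.mem_range.1 hi; omega)
      push_cast at h1
      rw [zero_add, h1, condLast, ENNReal.toReal_div, marginal_apply, marginal_apply]
      rfl
  have key := (h.isPathGibbs hΦ hk hν).eq_markov (hμT.measurePreserving 1) hedge hmarkov
  have heq : ν = μ := by
    refine ext_of_interval (k := k) fun a n η => ?_
    have hcyl : ∀ {κ : Measure (ℤ → Ω)}, IsTranslationInvariant κ →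
        κ (cylinderAt (Finset.Icc a (a + k + n)) η) =
        κ (cylinderAt (Finset.Icc 0 (0 + k + n)) (shift a η)) := by
      intro κ hκ
      refine Eq.trans ?_ ((hκ.measurePreserving a).measure_preimage
        (measurableSet_cylinderAt (Finset.Icc (0 : ℤ) (0 + k + n)) (shift a η)).nullMeasurableSet)
      congr 1
      ext ξ
      simp only [cylinderAt, shift, Set.mem_preimage, Set.mem_ofPred_eq, Finset.mem_Icc]
      constructor
      · intro h i hi
        exact h (i + a) (by omega)
      · intro h i hi
        have := h (i - a) (by omega)
        rwa [sub_add_cancel] at this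
    rw [hcyl hν, hcyl hμT, ← hIcc, ← wordEvent_window (Nat.succ_pos n)]
    refine (ENNReal.toReal_eq_toReal_iff' (measure_ne_top _ _) (measure_ne_top _ _)).1
      (key n _ fun i _ => ?_)
    push_cast
    rw [init_window_succ]
  rw [heq] at hμ ⊢
  exact hμ

end

end GibbsMarkov

end

theorem mainTheorem7 {Ω : Type*} [Fintype Ω] [MeasurableSpace Ω] [DiscreteMeasurableSpace Ω]
    (k : ℕ) :
    (∀ m : Measure (Fin (k + 1) → Ω), IsProbabilityMeasure m → GibbsMarkov.IsLTI m →
      (∃! μ : Measure (ℤ → Ω), GibbsMarkov.IsMarkovExtension m μ) ∧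
      GibbsMarkov.IsInteraction
        (GibbsMarkov.windowInteraction (GibbsMarkov.markovPotential m)) ∧
      GibbsMarkov.HasRangeAtMost k
        (GibbsMarkov.windowInteraction (GibbsMarkov.markovPotential m)) ∧
      GibbsMarkov.IsTIInteraction
        (GibbsMarkov.windowInteraction (GibbsMarkov.markovPotential m)) ∧
      ∀ μ : Measure (ℤ → Ω), GibbsMarkov.IsMarkovExtension m μ →
        GibbsMarkov.marginal k μ = m ∧
        GibbsMarkov.IsTranslationInvariant μ ∧
        GibbsMarkov.IsGibbsState
          (GibbsMarkov.windowInteraction (GibbsMarkov.markovPotential m)) μ) ∧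
    (∀ (Φ : Finset ℤ → (ℤ → Ω) → EReal) (ν : Measure (ℤ → Ω)),
      GibbsMarkov.IsInteraction Φ → GibbsMarkov.HasRangeAtMost k Φ →
      GibbsMarkov.IsTranslationInvariant ν → GibbsMarkov.IsGibbsState Φ ν →
        GibbsMarkov.IsLTI (GibbsMarkov.marginal k ν) ∧
        GibbsMarkov.IsMarkovExtension (GibbsMarkov.marginal k ν) ν) := by
  refine ⟨fun m hm hLTI => ?_, fun Φ ν hΦ hk hν h =>
    ⟨hν.isLTI_marginal, h.isMarkovExtension hΦ hk hν⟩⟩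
  obtain ⟨μ, hμ⟩ := GibbsMarkov.exists_isMarkovExtension hLTI
  exact ⟨⟨μ, hμ, fun ν hν => hν.unique hμ⟩,
    GibbsMarkov.isInteraction_windowInteraction (GibbsMarkov.markovPotential_ne_bot m),
    GibbsMarkov.hasRangeAtMost_windowInteraction,
    GibbsMarkov.isTIInteraction_windowInteraction,
    fun μ hμ => ⟨hμ.marginal_eq, hμ.isTranslationInvariant, hμ.isGibbsState⟩⟩
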